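/- Let $\mathbb{D}$ be the open unit disc, $\mathbb{T}$ the unit circle with normalized arc length, and $H^2$ the Hardy space on $\mathbb{D}$, regarded through boundary values as a closed subspace of $L^2(\mathbb{T})$ with orthogonal projection $P_{H^2}$. For $\varphi\in L^\infty(\mathbb{T})$ let $T_\varphi f=P_{H^2}(\varphi f)$ be the Toeplitz operator on $H^2$. An automorphism of $\mathbb{D}$ with zero $a\in\mathbb{D}$ is a map $\psi(z)=\lambda\frac{a-z}{1-\overline{a}z}$ with $|\lambda|=1$. For $\theta$ inner (a bounded analytic function on $\mathbb D$ that is unimodular a.e. on $\mathbb{T}$; unimodular constants are allowed) or $\theta=0$, put $K_\theta=H^2\ominus\theta H^2$, so that $K_0=H^2$. For a family of bounded operators $T_i$ on $H^2$, a closed subspace $\mathcal{M}\subseteq H^2$ is called nearly invariant with respect to $\{T_i^{-1}\}$ if, whenever $f\in H^2$ and $T_if\in\mathcal{M}$ for some $i$, then $f\in\mathcal{M}$. **Theorem.** (1) Let $\psi_1\ne\psi_2$ be automorphisms of $\mathbb{D}$ with zeros $a_1\neq a_2$. A linear subspace $\mathcal{M}$ of $H^2$ is closed and nearly invariant with respect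 to the discrete semigroup $\{T_{\psi_1^m\psi_2^n}^{-1}: m,n\in\mathbb{N}_0\}$ if and only if $$\mathcal{M}=(u\circ\psi_1)\,\operatorname{Ker}T_{(\overline{\theta}\circ\psi_1)\psi_1/z}$$ for some $\theta$ that is inner or identically $0$ and some $u\in H^2$ such that $u(0)\neq0$, $u(\psi_1(a_2))\neq0$, and multiplication by $u$ is isometric from $K_\theta$ into $H^2$. (2) Let $(\psi_k)_{k\ge 1}$ be pairwise different automorphisms of $\mathbb{D}$ with zeros $a_k$. A linear subspace $\mathcal{M}$ of $H^2$ is closed and nearly invariant with respect to $\{T_{\prod_i\psi_i^{m_i}}^{-1}: m_i\in\mathbb{N}_0,\ m_i=0 \text{ except for finitely many } i\}$ if and only if $$\mathcal{M}=(u\circ\psi_1)\,\operatorname{Ker}T_{(\overline{\theta}\circ\psi_1)\psi_1/z}$$ for some $\theta$ that is inner or identically $0$ and some $u\in H^2$ such that $u(0)\neq0$, $u(\psi_1(a_k))\neq0$ for all $k\geq 1$, and multiplication by $u$ is isometric from $K_\theta$ into $H^2$. -/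

import Mathlib

open MeasureTheory Complex
open scoped ENNReal UnitDisc ComplexConjugate

namespace HardyDisc

/-! ### The unit circle with normalized arc length -/

noncomputable instance circleMeasurableSpace : MeasurableSpace Circle := borel Circle

instance circleBorelSpace : BorelSpace Circle := ⟨rfl⟩

/-- Normalized arc length measure `m` on the unit circle: the push-forward of the Haar probability
measure of `ℝ / ℤ` under `t ↦ exp (2 π i t)`. -/
noncomputable def arc : Measure Circle :=
  Measure.map AddCircle.toCircle (AddCircle.haarAddCircle : Measure UnitAddCircle)

theorem measurable_toCircle : Measurable (AddCircle.toCircle : UnitAddCircle → Circle) :=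
  AddCircle.continuous_toCircle.measurable

instance arc_isProbabilityMeasure : IsProbabilityMeasure arc :=
  Measure.isProbabilityMeasure_map measurable_toCircle.aemeasurable

/-- The space `L²(𝕋)`. -/
noncomputable abbrev L2 : Type := Lp ℂ 2 arc

/-- The space `L^∞(𝕋)`. -/
noncomputable abbrev Linf : Type := Lp ℂ ∞ arc

/-- The `n`-th Fourier coefficient `∫ f(ζ) ζ^{-n} dm(ζ)`. -/
noncomputable def coeff (f : Circle → ℂ) (n : ℤ) : ℂ :=
  ∫ ζ, (ζ : ℂ) ^ (-n) * f ζ ∂arc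

/-! ### The Hardy space `H²` -/

theorem continuous_circle_zpow (n : ℤ) : Continuous fun ζ : Circle => (ζ : ℂ) ^ n :=
  Continuous.zpow₀ (by fun_prop) n fun ζ => Or.inl ζ.coe_ne_zero

/-- The character `ζ ↦ ζ ^ n`, as an element of `L²(𝕋)`. -/
noncomputable def monomial (n : ℤ) : L2 :=
  ContinuousMap.toLp (E := ℂ) 2 arc ℂ ⟨fun ζ : Circle => (ζ : ℂ) ^ n, continuous_circle_zpow n⟩

theorem inner_monomial (n : ℤ) (f : L2) : inner ℂ (monomial n) f = coeff f n := by
  rw [MeasureTheory.L2.inner_def, coeff]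
  refine integral_congr_ae ?_
  filter_upwards [ContinuousMap.coeFn_toLp (p := 2) (𝕜 := ℂ) arc
    (⟨fun ζ : Circle => (ζ : ℂ) ^ n, continuous_circle_zpow n⟩ : C(Circle, ℂ))] with ζ hζ
  have h : (monomial n : Circle → ℂ) ζ = (ζ : ℂ) ^ n := hζ
  rw [h, RCLike.inner_apply, map_zpow₀, ← Circle.coe_inv_eq_conj, Circle.coe_inv, inv_zpow,
    zpow_neg, mul_comm]

/-- The Hardy space `H²`, as the subspace of `L²(𝕋)` of the functions whose Fourier coefficients of
negative index vanish. Such an `f` is identified with the analytic function `discFun f` on `𝔻`. -/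
noncomputable def H2 : Submodule ℂ L2 where
  carrier := {f | ∀ n : ℤ, n < 0 → coeff f n = 0}
  zero_mem' n _ := by rw [← inner_monomial, inner_zero_right]
  add_mem' {f g} hf hg n hn := by
    rw [← inner_monomial, inner_add_right, inner_monomial, inner_monomial, hf n hn, hg n hn,
      add_zero]
  smul_mem' c f hf n hn := by
    rw [← inner_monomial, inner_smul_right, inner_monomial, hf n hn, mul_zero]

theorem mem_H2_iff (f : L2) : f ∈ H2 ↔ ∀ n : ℤ, n < 0 → coeff f n = 0 := Iff.rfl

theorem isClosed_H2 : IsClosed (H2 : Set L2) := by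
  have h : (H2 : Set L2) = ⋂ n : ℤ, ⋂ _ : n < 0, {f : L2 | inner ℂ (monomial n) f = 0} := by
    ext f
    simp [mem_H2_iff, inner_monomial]
  rw [h]
  exact isClosed_iInter fun n => isClosed_iInter fun _ =>
    isClosed_eq (continuous_const.inner continuous_id) continuous_const

instance completeSpace_H2 : CompleteSpace H2 := isClosed_H2.completeSpace_coe

/-- The analytic function `z ↦ ∑ f̂(n) zⁿ` on the unit disc attached to `f ∈ H²`. -/
noncomputable def discFun (f : H2) (z : 𝔻) : ℂ :=
  ∑' n : ℕ, coeff (f : L2) n * (z : ℂ) ^ n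

theorem norm_coeff_le (f : L2) (n : ℤ) : ‖coeff f n‖ ≤ ‖monomial n‖ * ‖f‖ := by
  rw [← inner_monomial]
  exact norm_inner_le_norm _ _

theorem norm_monomial_le (n : ℤ) : ‖monomial n‖ ≤ 1 := by
  refine (Lp.norm_le_of_ae_bound zero_le_one ?_).trans (by simp [measureUnivNNReal])
  filter_upwards [ContinuousMap.coeFn_toLp (p := 2) (𝕜 := ℂ) arc
    (⟨fun ζ : Circle => (ζ : ℂ) ^ n, continuous_circle_zpow n⟩ : C(Circle, ℂ))] with ζ hζ
  have h : (monomial n : Circle → ℂ) ζ = (ζ : ℂ) ^ n := hζ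
  rw [h, norm_zpow, Circle.norm_coe, one_zpow]

/-- The power series that defines `discFun f` converges on the whole disc. -/
theorem summable_discFun (f : H2) (z : 𝔻) :
    Summable fun n : ℕ => coeff (f : L2) n * (z : ℂ) ^ n := by
  refine Summable.of_norm_bounded (g := fun n : ℕ => ‖(f : L2)‖ * ‖(z : ℂ)‖ ^ n)
    ((summable_geometric_of_lt_one (norm_nonneg _) z.norm_lt_one).mul_left _) fun n => ?_
  rw [norm_mul, norm_pow]
  refine mul_le_mul_of_nonneg_right ?_ (by positivity)
  refine (norm_coeff_le _ _).trans ?_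
  exact mul_le_of_le_one_left (norm_nonneg _) (norm_monomial_le _)

/-! ### Toeplitz operators, inner functions, model spaces -/

/-- Multiplication by a symbol `φ ∈ L^∞(𝕋)` on `L²(𝕋)`. -/
noncomputable def mulOp (φ : Linf) : L2 →L[ℂ] L2 :=
  (ContinuousLinearMap.mul ℂ ℂ).holderL arc ∞ 2 2 φ

/-- The Toeplitz operator `T_φ f = P_{H²} (φ f)` on `H²`. -/
noncomputable def toeplitz (φ : Linf) : H2 →L[ℂ] H2 :=
  H2.orthogonalProjectionOnto ∘L mulOp φ ∘L H2.subtypeL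

/-- `θ` is (the boundary function of) an inner function: it belongs to `H^∞` and is unimodular
almost everywhere on the circle. -/
def IsInner (θ : Linf) : Prop :=
  (∀ n : ℤ, n < 0 → coeff θ n = 0) ∧ ∀ᵐ ζ ∂arc, ‖θ ζ‖ = 1

/-- The space `K_θ = H² ⊖ θ H²`. -/
noncomputable def modelSpace (θ : Linf) : Submodule ℂ H2 :=
  (H2.map (mulOp θ : L2 →ₗ[ℂ] L2))ᗮ.comap H2.subtype

/-- Multiplication by `u` maps `K ⊆ H²` isometrically into `H²`. -/
def IsIsometricMultiplier (u : H2) (K : Submodule ℂ H2) : Prop :=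
  ∀ f ∈ K, ∃ g : H2, (∀ z : 𝔻, discFun g z = discFun u z * discFun f z) ∧ ‖g‖ = ‖f‖

/-! ### Automorphisms of the disc -/

/-- The automorphism `ψ(z) = lam (a - z) / (1 - ā z)` of the unit disc, with zero `a`. -/
@[ext]
structure DiscAut where
  a : 𝔻
  lam : Circle

namespace DiscAut

noncomputable def toFun (ψ : DiscAut) (z : ℂ) : ℂ :=
  ψ.lam * (ψ.a - z) / (1 - conj (ψ.a : ℂ) * z)

theorem denom_ne_zero (a : 𝔻) {z : ℂ} (hz : ‖z‖ ≤ 1) : 1 - conj (a : ℂ) * z ≠ 0 := by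
  intro h
  have h1 : conj (a : ℂ) * z = 1 := (sub_eq_zero.mp h).symm
  have h2 : ‖(a : ℂ)‖ * ‖z‖ = 1 := by
    rw [← norm_conj (a : ℂ), ← norm_mul, h1, norm_one]
  nlinarith [a.norm_lt_one, norm_nonneg (a : ℂ), norm_nonneg z]

theorem normSq_identity (a z : ℂ) :
    normSq (1 - conj a * z) - normSq (a - z) = (1 - normSq a) * (1 - normSq z) := by
  simp only [normSq_apply, sub_re, sub_im, mul_re, mul_im, one_re, one_im, conj_re, conj_im]
  ring

theorem norm_toFun (ψ : DiscAut) (z : ℂ) :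
    ‖ψ.toFun z‖ = ‖(ψ.a : ℂ) - z‖ / ‖1 - conj (ψ.a : ℂ) * z‖ := by
  rw [toFun, norm_div, norm_mul, Circle.norm_coe, one_mul]

theorem norm_toFun_lt_one (ψ : DiscAut) (z : 𝔻) : ‖ψ.toFun z‖ < 1 := by
  have hd := norm_pos_iff.mpr (denom_ne_zero ψ.a z.norm_lt_one.le)
  rw [norm_toFun, div_lt_one hd, ← sq_lt_sq₀ (norm_nonneg _) (norm_nonneg _), ← normSq_eq_norm_sq,
    ← normSq_eq_norm_sq, ← sub_pos, normSq_identity]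
  exact mul_pos (sub_pos.mpr ψ.a.normSq_lt_one) (sub_pos.mpr z.normSq_lt_one)

theorem norm_toFun_circle (ψ : DiscAut) (ζ : Circle) : ‖ψ.toFun ζ‖ = 1 := by
  have hd := denom_ne_zero ψ.a (Circle.norm_coe ζ).le
  rw [norm_toFun, div_eq_one_iff_eq (norm_ne_zero_iff.mpr hd),
    ← sq_eq_sq₀ (norm_nonneg _) (norm_nonneg _), ← normSq_eq_norm_sq, ← normSq_eq_norm_sq, eq_comm,
    ← sub_eq_zero, normSq_identity, Circle.normSq_coe, sub_self, mul_zero]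

/-- `ψ` as a self-map of the open disc. -/
noncomputable def onDisc (ψ : DiscAut) (z : 𝔻) : 𝔻 :=
  UnitDisc.mk (ψ.toFun z) (ψ.norm_toFun_lt_one z)

/-- `ψ` as a self-map of the circle. -/
noncomputable def onCircle (ψ : DiscAut) (ζ : Circle) : Circle :=
  ⟨ψ.toFun ζ, mem_sphere_zero_iff_norm.mpr (ψ.norm_toFun_circle ζ)⟩

@[simp] theorem coe_onDisc (ψ : DiscAut) (z : 𝔻) : (ψ.onDisc z : ℂ) = ψ.toFun z := rfl

@[simp] theorem coe_onCircle (ψ : DiscAut) (ζ : Circle) : (ψ.onCircle ζ : ℂ) = ψ.toFun ζ := rfl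

theorem continuous_onCircle (ψ : DiscAut) : Continuous ψ.onCircle := by
  refine Continuous.subtype_mk (f := fun ζ : Circle => ψ.toFun ζ) ?_ _
  unfold toFun
  exact Continuous.div (by fun_prop) (by fun_prop)
    fun ζ => denom_ne_zero ψ.a (Circle.norm_coe ζ).le

/-- The restriction of `ψ` to the circle, as a continuous function. -/
noncomputable def boundary (ψ : DiscAut) : C(Circle, ℂ) :=
  ⟨fun ζ => (ψ.onCircle ζ : ℂ), continuous_subtype_val.comp ψ.continuous_onCircle⟩

end DiscAut

/-! ### Automorphisms preserve null sets of the circle -/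

instance circle_isIsometricSMul : IsIsometricSMul Circle Circle where
  isometry_smul c := Isometry.of_dist_eq fun x y => by
    change dist ((c : ℂ) * x) ((c : ℂ) * y) = dist (x : ℂ) (y : ℂ)
    rw [dist_eq_norm, dist_eq_norm, ← mul_sub, norm_mul, Circle.norm_coe, one_mul]

instance arc_isMulLeftInvariant : arc.IsMulLeftInvariant where
  map_mul_left_eq_self c := by
    obtain ⟨t, rfl⟩ := Circle.exp_surjective c
    have ht : AddCircle.toCircle ((t / (2 * Real.pi) : ℝ) : UnitAddCircle) = Circle.exp t := by
      rw [AddCircle.toCircle_apply_mk]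
      congr 1
      field_simp
    rw [arc, Measure.map_map (continuous_const_mul _).measurable measurable_toCircle]
    have hc : (fun x => Circle.exp t * x) ∘ (AddCircle.toCircle : UnitAddCircle → Circle) =
        AddCircle.toCircle ∘ fun x => ((t / (2 * Real.pi) : ℝ) : UnitAddCircle) + x := by
      funext x
      simp [AddCircle.toCircle_add, ht]
    rw [hc, ← Measure.map_map measurable_toCircle (continuous_const_add _).measurable,
      map_add_left_eq_self]

theorem lipschitz_exp : LipschitzWith 1 (Circle.exp : ℝ → Circle) := by
  refine LipschitzWith.of_dist_le_mul fun x y => ?_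
  change dist (Circle.exp x : ℂ) (Circle.exp y : ℂ) ≤ _
  have h : (Circle.exp x : ℂ) - Circle.exp y =
      Circle.exp y * (Complex.exp (I * ((x - y : ℝ) : ℂ)) - 1) := by
    rw [mul_sub, mul_one, Circle.coe_exp, Circle.coe_exp, ← Complex.exp_add]
    congr 2
    push_cast
    ring
  rw [dist_eq_norm, h, norm_mul, Circle.norm_coe, one_mul, NNReal.coe_one, one_mul,
    Real.dist_eq]
  exact Real.norm_exp_I_mul_ofReal_sub_one_le

theorem hausdorff_circle_lt_top : (μH[1] : Measure Circle) Set.univ < ∞ := by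
  have h := lipschitz_exp.hausdorffMeasure_image_le zero_le_one (Set.Icc (-Real.pi) Real.pi)
  have hs : Circle.exp '' Set.Icc (-Real.pi) Real.pi = Set.univ := by
    refine Set.eq_univ_of_forall fun z => ⟨(z : ℂ).arg, ?_, Circle.exp_arg z⟩
    exact ⟨(Complex.neg_pi_lt_arg _).le, Complex.arg_le_pi _⟩
  rw [hs, hausdorffMeasure_real, Real.volume_Icc] at h
  refine h.trans_lt ?_
  simp

theorem hausdorff_circle_ne_zero : (μH[1] : Measure Circle) ≠ 0 := by
  intro h0
  have hl : LipschitzWith 1 (fun ζ : Circle => (ζ : ℂ).re) := by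
    refine LipschitzWith.of_dist_le_mul fun x y => ?_
    rw [NNReal.coe_one, one_mul, Real.dist_eq, ← Complex.sub_re]
    exact (Complex.abs_re_le_norm _).trans_eq (dist_eq_norm (x : ℂ) y).symm
  have h := hl.hausdorffMeasure_image_le zero_le_one Set.univ
  rw [h0, hausdorffMeasure_real] at h
  have hsub : Set.Icc (-1 : ℝ) 1 ⊆ (fun ζ : Circle => (ζ : ℂ).re) '' Set.univ := by
    intro x hx
    refine ⟨Circle.exp (Real.arccos x), trivial, ?_⟩
    simp only [Circle.coe_exp, Complex.exp_ofReal_mul_I_re]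
    exact Real.cos_arccos hx.1 hx.2
  have h2 := (measure_mono hsub).trans h
  rw [Real.volume_Icc] at h2
  norm_num at h2

theorem arc_eq_zero_iff (s : Set Circle) : arc s = 0 ↔ (μH[1] : Measure Circle) s = 0 := by
  have : IsFiniteMeasure (μH[1] : Measure Circle) := ⟨hausdorff_circle_lt_top⟩
  exact ⟨fun h => absolutelyContinuous_of_isMulLeftInvariant _ _ (IsProbabilityMeasure.ne_zero arc) h,
    fun h => absolutelyContinuous_of_isMulLeftInvariant _ _ hausdorff_circle_ne_zero h⟩

namespace DiscAut

/-- The inverse automorphism. -/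
noncomputable def symm (ψ : DiscAut) : DiscAut where
  a := UnitDisc.mk (ψ.lam * ψ.a) (by
    rw [norm_mul, Circle.norm_coe, one_mul]
    exact ψ.a.norm_lt_one)
  lam := ψ.lam⁻¹

theorem symm_toFun_toFun (ψ : DiscAut) {z : ℂ} (hz : ‖z‖ ≤ 1) : ψ.symm.toFun (ψ.toFun z) = z := by
  have hd := denom_ne_zero ψ.a hz
  have hl : (ψ.lam : ℂ) ≠ 0 := ψ.lam.coe_ne_zero
  have hll : conj (ψ.lam : ℂ) = (ψ.lam : ℂ)⁻¹ := by
    rw [← Circle.coe_inv_eq_conj, Circle.coe_inv]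
  have ha : 1 - conj (ψ.a : ℂ) * ψ.a ≠ 0 := denom_ne_zero ψ.a ψ.a.norm_lt_one.le
  have e1 : (ψ.lam : ℂ) * ψ.a - ψ.toFun z =
      ψ.lam * (1 - conj (ψ.a : ℂ) * ψ.a) * z / (1 - conj (ψ.a : ℂ) * z) := by
    rw [toFun, eq_div_iff hd, sub_mul, div_mul_cancel₀ _ hd]
    ring
  have e2 : 1 - (ψ.lam : ℂ)⁻¹ * conj (ψ.a : ℂ) * ψ.toFun z =
      (1 - conj (ψ.a : ℂ) * ψ.a) / (1 - conj (ψ.a : ℂ) * z) := by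
    rw [toFun, eq_div_iff hd, sub_mul, one_mul, mul_assoc _ (_ / _), div_mul_cancel₀ _ hd]
    field_simp
    ring
  have e3 : ψ.symm.toFun (ψ.toFun z) = (ψ.lam : ℂ)⁻¹ * (ψ.lam * ψ.a - ψ.toFun z) /
      (1 - (ψ.lam : ℂ)⁻¹ * conj (ψ.a : ℂ) * ψ.toFun z) := by
    conv_lhs => rw [toFun]
    simp only [symm, UnitDisc.coe_mk, Circle.coe_inv, map_mul, hll]
  rw [e3, e1, e2]
  generalize 1 - conj (ψ.a : ℂ) * ψ.a = p at ha
  generalize 1 - conj (ψ.a : ℂ) * z = d at hd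
  field_simp

theorem symm_symm (ψ : DiscAut) : ψ.symm.symm = ψ := by
  ext
  · simp [symm]
  · simp [symm]

theorem lipschitz_onCircle (ψ : DiscAut) : ∃ K, LipschitzWith K ψ.onCircle := by
  have h1 : 0 < 1 - ‖(ψ.a : ℂ)‖ := sub_pos.mpr ψ.a.norm_lt_one
  refine ⟨⟨2 / (1 - ‖(ψ.a : ℂ)‖) ^ 2, by positivity⟩, LipschitzWith.of_dist_le_mul fun x y => ?_⟩
  change dist (ψ.toFun x) (ψ.toFun y) ≤ 2 / (1 - ‖(ψ.a : ℂ)‖) ^ 2 * dist (x : ℂ) (y : ℂ)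
  have hb : ∀ ζ : Circle, 1 - ‖(ψ.a : ℂ)‖ ≤ ‖1 - conj (ψ.a : ℂ) * ζ‖ := fun ζ => by
    have := norm_sub_norm_le (1 : ℂ) (conj (ψ.a : ℂ) * ζ)
    rwa [norm_one, norm_mul, norm_conj, Circle.norm_coe, mul_one] at this
  have hx := denom_ne_zero ψ.a (Circle.norm_coe x).le
  have hy := denom_ne_zero ψ.a (Circle.norm_coe y).le
  have hsub : ψ.toFun x - ψ.toFun y = ψ.lam * (conj (ψ.a : ℂ) * ψ.a - 1) * (x - y) /
      ((1 - conj (ψ.a : ℂ) * x) * (1 - conj (ψ.a : ℂ) * y)) := by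
    rw [toFun, toFun, div_sub_div _ _ hx hy]
    congr 1
    ring
  have hn : ‖conj (ψ.a : ℂ) * ψ.a - 1‖ ≤ 2 := by
    refine (norm_sub_le _ _).trans ?_
    rw [norm_mul, norm_conj, norm_one]
    nlinarith [ψ.a.norm_lt_one, norm_nonneg (ψ.a : ℂ)]
  rw [dist_eq_norm, dist_eq_norm, hsub, norm_div, norm_mul, norm_mul, norm_mul, Circle.norm_coe,
    one_mul, div_mul_eq_mul_div]
  refine div_le_div₀ (by positivity) (mul_le_mul_of_nonneg_right hn (norm_nonneg _))
    (by positivity) ?_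
  rw [sq]
  exact mul_le_mul (hb x) (hb y) h1.le (norm_nonneg _)

theorem quasiMeasurePreserving_onCircle (ψ : DiscAut) :
    Measure.QuasiMeasurePreserving ψ.onCircle arc arc := by
  refine ⟨ψ.continuous_onCircle.measurable, Measure.AbsolutelyContinuous.mk fun s hs h0 => ?_⟩
  rw [Measure.map_apply ψ.continuous_onCircle.measurable hs, arc_eq_zero_iff]
  obtain ⟨K, hK⟩ := ψ.symm.lipschitz_onCircle
  have hsub : ψ.onCircle ⁻¹' s ⊆ ψ.symm.onCircle '' s := fun ζ hζ =>
    ⟨ψ.onCircle ζ, hζ, Circle.ext (ψ.symm_toFun_toFun (Circle.norm_coe ζ).le)⟩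
  have h := (measure_mono hsub).trans (hK.hausdorffMeasure_image_le zero_le_one s)
  rw [(arc_eq_zero_iff s).mp h0, mul_zero] at h
  exact le_antisymm h bot_le

end DiscAut

/-! ### Symbols -/

/-- A continuous function on the circle, as an element of `L^∞(𝕋)`. -/
noncomputable def contSymbol (φ : C(Circle, ℂ)) : Linf :=
  ContinuousMap.toLp (E := ℂ) ∞ arc ℂ φ

theorem memLp_kernelSymbol (θ : Linf) (ψ : DiscAut) :
    MemLp (fun ζ : Circle => conj (θ (ψ.onCircle ζ)) * ((ψ.onCircle ζ : ℂ) / ζ)) ∞ arc := by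
  refine memLp_top_of_bound (C := ‖θ‖) ?_ ?_
  · have h1 : AEStronglyMeasurable (fun ζ => θ (ψ.onCircle ζ)) arc :=
      (Lp.stronglyMeasurable θ).aestronglyMeasurable.comp_quasiMeasurePreserving
        ψ.quasiMeasurePreserving_onCircle
    have h2 : Continuous fun ζ : Circle => (ψ.onCircle ζ : ℂ) / ζ :=
      (continuous_subtype_val.comp ψ.continuous_onCircle).div continuous_subtype_val
        fun ζ => ζ.coe_ne_zero
    exact (Complex.continuous_conj.comp_aestronglyMeasurable h1).mul h2.aestronglyMeasurable
  · have hb : ∀ᵐ ζ ∂arc, ‖θ ζ‖ ≤ ‖θ‖ := by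
      have := ae_le_eLpNormEssSup (f := (θ : Circle → ℂ)) (μ := arc)
      filter_upwards [this] with ζ hζ
      rw [Lp.norm_def, eLpNorm_exponent_top, ← toReal_enorm]
      refine ENNReal.toReal_mono ?_ hζ
      rw [← eLpNorm_exponent_top]
      exact Lp.eLpNorm_ne_top θ
    filter_upwards [ψ.quasiMeasurePreserving_onCircle.ae hb] with ζ hζ
    rwa [norm_mul, norm_conj, norm_div, Circle.norm_coe, Circle.norm_coe, div_one, mul_one]

/-- The symbol `(θ̄ ∘ ψ) ψ / z` in `L^∞(𝕋)`. -/
noncomputable def kernelSymbol (θ : Linf) (ψ : DiscAut) : Linf :=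
  (memLp_kernelSymbol θ ψ).toLp _

/-! ### Near invariance -/

/-- `M` is nearly invariant for the left inverses of the family `T`: it contains `f` whenever it
contains `T i f` for some `i`. -/
def NearlyInvariant {ι : Type*} (T : ι → H2 →L[ℂ] H2) (M : Submodule ℂ H2) : Prop :=
  ∀ (i : ι) (f : H2), T i f ∈ M → f ∈ M

/-- `M = (u ∘ ψ) Ker T_{(θ̄ ∘ ψ) ψ / z}`, as an equality of spaces of functions on the disc. -/
def HasForm (ψ : DiscAut) (θ : Linf) (u : H2) (M : Submodule ℂ H2) : Prop :=
  discFun '' (M : Set H2) =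
    (fun (h : H2) (z : 𝔻) => discFun u (ψ.onDisc z) * discFun h z) ''
      (LinearMap.ker (toeplitz (kernelSymbol θ ψ) : H2 →ₗ[ℂ] H2) : Set H2)

end HardyDisc

open HardyDisc

/-! Analytic symbols multiply: the Toeplitz operator of a product is the product of the Toeplitz
operators. Near invariance under the semigroup is therefore near invariance under each generator
(`mem_of_toeplitz_prod_mem`). Composition with ψ₁ intertwines the shift with `T_ψ₁` (`comp_shift`),
so N = {f : f ∘ ψ₁ ∈ M} satisfies zf ∈ N ⇒ f ∈ N. Hitt's theorem (`exists_multiplier_modelSpace`)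
gives N = u K_θ when N ≠ 0, and K_θ ∘ ψ₁ is the stated Toeplitz kernel (`mem_ker_kernelSymbol`). The
space M = 0 is covered by θ = u = 1.

The values of u record the generators. If M ≠ 0 is nearly invariant for `T_χ`, some f ∈ M is nonzero
at the zero a of χ (`exists_discFun_ne_zero`), so u(ψ₁(a)) ≠ 0. Conversely, if χx = (u ∘ ψ₁)h and
u(ψ₁(a)) ≠ 0, then h(a) = 0, h = χg, and g stays in the Toeplitz kernel, so x = (u ∘ ψ₁)g lies in M
(`mem_of_toeplitz_mem_of_hasForm`).

Hitt's theorem is proved with N as the range of an isometry ι from a Hilbert space X. Let u be the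
unit vector representing evaluation at 0. Removing the u-component and dividing by z defines R on X
with ‖x‖² = |⟨u,x⟩|² + ‖Rx‖² and ιx = ⟨u,x⟩ιu + zι(Rx). Iteration gives ιx = ιu · Jx with Jx =
∑⟨u,Rⁿx⟩zⁿ. The range of J is invariant under the backward shift, so by Beurling's theorem
(`exists_modelSpace_eq`) it is some K_θ, once J is known to be isometric
(`RankOneDefect.norm_symbol`).

Isometry of J is the hard point. The form A(x,y) = ⟨x,y⟩ − ⟨Jx,Jy⟩ is nonnegative and preserved by
R, so G(w) = A(x,(1+wR)(1−wR)⁻¹x) has nonnegative real part Q. Since ιx = ιu · Jx, the Herglotz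
measure of G is singular, in the form that averages of Q/(1+tQ) over circles of radius r become
small (`RankOneDefect.exists_average_lt`). The bounded functions 1/(1+tG), substituted into R,
produce vectors y with ‖y‖ ≤ ‖x‖, with A(x,y) near 0 and with Jy near Jx coefficientwise
(`RankOneDefect.exists_approx`). In the limit A(x,x) = 0. -/

namespace HardyDisc

/-! ### Fourier analysis on the circle -/

theorem integral_arc (g : Circle → ℂ) (hg : AEStronglyMeasurable g arc) :
    ∫ ζ, g ζ ∂arc =
      ∫ t, g (AddCircle.toCircle t) ∂(AddCircle.haarAddCircle : Measure UnitAddCircle) :=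
  integral_map measurable_toCircle.aemeasurable hg

/-- Integration against g is a continuous functional on C(𝕋) that kills all characters, whose span
is dense. -/
theorem integral_continuous_mul_eq_zero {g : Circle → ℂ} (hg : Integrable g arc)
    (h : ∀ n, coeff g n = 0) (φ : C(Circle, ℂ)) : ∫ ζ, φ ζ * g ζ ∂arc = 0 := by
  let ν : Measure UnitAddCircle := AddCircle.haarAddCircle
  have hg' : Integrable (fun t : UnitAddCircle => g (AddCircle.toCircle t)) ν :=
    (integrable_map_measure hg.1 measurable_toCircle.aemeasurable).mp hg
  have hint : ∀ χ : C(UnitAddCircle, ℂ),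
      Integrable (fun t => χ t * g (AddCircle.toCircle t)) ν := fun χ =>
    hg'.bdd_mul (c := ‖χ‖) χ.continuous.aestronglyMeasurable
      (Filter.Eventually.of_forall fun t => χ.norm_coe_le_norm t)
  let Λ : C(UnitAddCircle, ℂ) →L[ℂ] ℂ :=
    LinearMap.mkContinuous
      { toFun := fun χ => ∫ t, χ t * g (AddCircle.toCircle t) ∂ν
        map_add' := fun χ₁ χ₂ => by
          rw [← integral_add (hint χ₁) (hint χ₂)]
          simp only [ContinuousMap.add_apply, add_mul]
        map_smul' := fun c χ => by
          simp only [ContinuousMap.smul_apply, smul_eq_mul, mul_assoc, RingHom.id_apply]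
          exact integral_const_mul _ _ }
      (∫ t, ‖g (AddCircle.toCircle t)‖ ∂ν) fun χ => by
        simp only [LinearMap.coe_mk, AddHom.coe_mk]
        rw [mul_comm, ← integral_const_mul]
        refine norm_integral_le_of_norm_le (hg'.norm.const_mul _)
          (Filter.Eventually.of_forall fun t => ?_)
        rw [norm_mul]
        exact mul_le_mul_of_nonneg_right (χ.norm_coe_le_norm t) (norm_nonneg _)
  have hΛ : ∀ n : ℤ, Λ (fourier n) = 0 := fun n => by
    have h1 := h (-n)
    have h2 := integral_arc (fun ζ : Circle => (ζ : ℂ) ^ (- -n) * g ζ)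
      ((continuous_circle_zpow _).aestronglyMeasurable.mul hg.1)
    rw [show ∫ ζ : Circle, (ζ : ℂ) ^ (- -n) * g ζ ∂arc = 0 from h1] at h2
    replace h2 := h2.symm
    simpa [Λ, fourier_apply, AddCircle.toCircle_zsmul] using h2
  have hΛ0 : ∀ χ, Λ χ = 0 := fun χ => by
    have hsub : (Submodule.span ℂ (Set.range (@fourier 1))).topologicalClosure ≤
        LinearMap.ker (Λ : C(UnitAddCircle, ℂ) →ₗ[ℂ] ℂ) := by
      refine Submodule.topologicalClosure_minimal _ ?_ Λ.isClosed_ker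
      rw [Submodule.span_le]
      rintro _ ⟨n, rfl⟩
      exact hΛ n
    rw [span_fourier_closure_eq_top] at hsub
    exact hsub trivial
  rw [integral_arc (fun ζ => φ ζ * g ζ) (φ.continuous.aestronglyMeasurable.mul hg.1)]
  exact hΛ0 ⟨fun t => φ (AddCircle.toCircle t), φ.continuous.comp AddCircle.continuous_toCircle⟩

/-- An integrable function on the circle is determined by its Fourier coefficients. -/
theorem ae_eq_zero_of_coeff_eq_zero {g : Circle → ℂ} (hg : Integrable g arc)
    (h : ∀ n, coeff g n = 0) : g =ᵐ[arc] 0 := by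
  refine ae_eq_zero_of_integral_contMDiff_smul_eq_zero (modelWithCornersSelf ℝ (EuclideanSpace ℝ (Fin 1))) hg.locallyIntegrable
    fun χ hχ _ => ?_
  have := integral_continuous_mul_eq_zero hg h ⟨fun ζ => (χ ζ : ℂ), by
    exact continuous_ofReal.comp hχ.continuous⟩
  simpa using this

theorem coeff_congr {f g : Circle → ℂ} (h : f =ᵐ[arc] g) (n : ℤ) : coeff f n = coeff g n :=
  integral_congr_ae (h.mono fun ζ hζ => by simp only [hζ])

theorem integrable_zpow_mul {g : Circle → ℂ} (hg : Integrable g arc) (n : ℤ) :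
    Integrable (fun ζ : Circle => (ζ : ℂ) ^ n * g ζ) arc :=
  hg.bdd_mul (c := 1) (continuous_circle_zpow n).aestronglyMeasurable
    (Filter.Eventually.of_forall fun ζ => by
      rw [norm_zpow, Circle.norm_coe, one_zpow])

theorem coeff_sub {f g : Circle → ℂ} (hf : Integrable f arc) (hg : Integrable g arc) (n : ℤ) :
    coeff (fun ζ => f ζ - g ζ) n = coeff f n - coeff g n := by
  simp only [coeff, mul_sub]
  exact integral_sub (integrable_zpow_mul hf _) (integrable_zpow_mul hg _)

theorem ae_eq_of_coeff_eq {f g : Circle → ℂ} (hf : Integrable f arc) (hg : Integrable g arc)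
    (h : ∀ n, coeff f n = coeff g n) : f =ᵐ[arc] g := by
  have := ae_eq_zero_of_coeff_eq_zero (hf.sub hg) fun n => by
    rw [show f - g = fun ζ => f ζ - g ζ from rfl, coeff_sub hf hg, h, sub_self]
  filter_upwards [this] with ζ hζ
  exact sub_eq_zero.mp hζ

theorem coeff_zpow_mul (f : Circle → ℂ) (m n : ℤ) :
    coeff (fun ζ : Circle => (ζ : ℂ) ^ m * f ζ) n = coeff f (n - m) := by
  refine integral_congr_ae (Filter.Eventually.of_forall fun ζ => ?_)
  simp only
  rw [← mul_assoc, ← zpow_add₀ ζ.coe_ne_zero]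
  congr 2
  ring

theorem coeff_conj (f : Circle → ℂ) (n : ℤ) :
    coeff (fun ζ => conj (f ζ)) n = conj (coeff f (-n)) := by
  rw [coeff, coeff, ← integral_conj]
  refine integral_congr_ae (Filter.Eventually.of_forall fun ζ => ?_)
  simp only [map_mul, map_zpow₀, ← Circle.coe_inv_eq_conj, Circle.coe_inv, inv_zpow', neg_neg]

theorem integral_zpow (n : ℤ) : ∫ ζ : Circle, (ζ : ℂ) ^ n ∂arc = if n = 0 then 1 else 0 := by
  split_ifs with hn
  · simp [hn]
  -- Rotation by exp(iπ/n) preserves the measure and multiplies ζⁿ by −1.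
  have h := integral_mul_left_eq_self (μ := arc) (fun ζ : Circle => (ζ : ℂ) ^ n)
    (Circle.exp (Real.pi / n))
  have hn' : (n : ℂ) ≠ 0 := Int.cast_ne_zero.mpr hn
  have hc : ((Circle.exp (Real.pi / n) : Circle) : ℂ) ^ n = -1 := by
    rw [Circle.coe_exp, ← Complex.exp_int_mul, ← Complex.exp_pi_mul_I]
    congr 1
    push_cast
    field_simp
  simp only [Circle.coe_mul, mul_zpow, hc, neg_mul, one_mul, integral_neg] at h
  exact self_eq_neg.mp h.symm

theorem coeFn_monomial (n : ℤ) : (monomial n : Circle → ℂ) =ᵐ[arc] fun ζ => (ζ : ℂ) ^ n :=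
  ContinuousMap.coeFn_toLp (p := 2) (𝕜 := ℂ) arc
    (⟨fun ζ : Circle => (ζ : ℂ) ^ n, continuous_circle_zpow n⟩ : C(Circle, ℂ))

theorem coeff_monomial (m n : ℤ) : coeff (monomial m) n = if n = m then 1 else 0 := by
  rw [coeff_congr (coeFn_monomial m)]
  simp only [coeff]
  have : ∀ ζ : Circle, (ζ : ℂ) ^ (-n) * (ζ : ℂ) ^ m = (ζ : ℂ) ^ (m - n) := fun ζ => by
    rw [← zpow_add₀ ζ.coe_ne_zero]
    congr 1
    ring
  simp only [this, integral_zpow, sub_eq_zero, eq_comm]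

theorem integrable_L2 (f : L2) : Integrable f arc :=
  (Lp.memLp f).integrable one_le_two

theorem integrable_mul_L2 (f g : L2) : Integrable (fun ζ => f ζ * g ζ) arc :=
  (Lp.memLp f).integrable_mul (Lp.memLp g)

theorem L2_ext {f g : L2} (h : ∀ n, coeff f n = coeff g n) : f = g :=
  Lp.ext (ae_eq_of_coeff_eq (integrable_L2 f) (integrable_L2 g) h)

/-! ### The monomial basis of the Hardy space -/

/-- The function `ζ ↦ ζ ^ n` in the Hardy space. -/
noncomputable def hmon (n : ℕ) : H2 :=
  ⟨monomial n, fun m hm => by rw [coeff_monomial, if_neg (by omega)]⟩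

theorem inner_hmon (n : ℕ) (f : H2) : inner ℂ (hmon n) f = coeff (f : L2) n := by
  rw [Submodule.coe_inner]
  exact inner_monomial n f

theorem orthonormal_hmon : Orthonormal ℂ hmon := by
  rw [orthonormal_iff_ite]
  intro i j
  rw [inner_hmon]
  simp [hmon, coeff_monomial]

theorem H2_ext {f g : H2} (h : ∀ n : ℕ, coeff (f : L2) n = coeff (g : L2) n) : f = g := by
  refine Subtype.ext (L2_ext fun n => ?_)
  rcases lt_or_ge n 0 with hn | hn
  · rw [f.2 n hn, g.2 n hn]
  · lift n to ℕ using hn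
    exact h n

theorem coeff_H2_zero (n : ℤ) : coeff ((0 : H2) : L2) n = 0 := by
  rw [← inner_monomial]
  simp

theorem coeff_H2_add (f g : H2) (n : ℤ) :
    coeff ((f + g : H2) : L2) n = coeff (f : L2) n + coeff (g : L2) n := by
  simp only [← inner_monomial, Submodule.coe_add, inner_add_right]

theorem coeff_H2_sub (f g : H2) (n : ℤ) :
    coeff ((f - g : H2) : L2) n = coeff (f : L2) n - coeff (g : L2) n := by
  simp only [← inner_monomial, Submodule.coe_sub, inner_sub_right]

theorem coeff_H2_smul (c : ℂ) (f : H2) (n : ℤ) :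
    coeff ((c • f : H2) : L2) n = c * coeff (f : L2) n := by
  simp only [← inner_monomial, Submodule.coe_smul, inner_smul_right]

/-- The monomials as a Hilbert basis of the Hardy space. -/
noncomputable def hbasis : HilbertBasis ℕ ℂ H2 :=
  HilbertBasis.mkOfOrthogonalEqBot orthonormal_hmon (by
    rw [Submodule.eq_bot_iff]
    intro f hf
    refine H2_ext fun n => ?_
    rw [coeff_H2_zero, ← inner_hmon]
    exact hf _ (Submodule.subset_span ⟨n, rfl⟩))

theorem hbasis_apply (n : ℕ) : hbasis n = hmon n := by
  rw [hbasis, HilbertBasis.coe_mkOfOrthogonalEqBot]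

theorem hbasis_repr (f : H2) (n : ℕ) : hbasis.repr f n = coeff (f : L2) n := by
  rw [HilbertBasis.repr_apply_apply, hbasis_apply, inner_hmon]

theorem hasSum_hmon (f : H2) : HasSum (fun n : ℕ => coeff (f : L2) n • hmon n) f := by
  have := hbasis.hasSum_repr f
  simpa only [hbasis_repr, hbasis_apply] using this

theorem hasSum_inner (f g : H2) :
    HasSum (fun n : ℕ => conj (coeff (f : L2) n) * coeff (g : L2) n) (inner ℂ f g) := by
  have := hbasis.hasSum_inner_mul_inner f g
  simpa only [hbasis_apply, inner_hmon, ← inner_conj_symm f (hmon _)] using this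

theorem hasSum_norm_sq (f : H2) : HasSum (fun n : ℕ => ‖coeff (f : L2) n‖ ^ 2) (‖f‖ ^ 2) := by
  have h := hasSum_inner f f
  have h2 := Complex.hasSum_re h
  convert h2 using 1
  · funext n
    rw [Complex.conj_mul']
    norm_cast
  · exact norm_sq_eq_re_inner (𝕜 := ℂ) f

/-- The function in `H²` with given square-summable Taylor coefficients. -/
noncomputable def ofCoeff (a : ℕ → ℂ) (ha : Summable fun n => ‖a n‖ ^ 2) : H2 :=
  hbasis.repr.symm ⟨a, memℓp_gen (by simpa using ha)⟩

theorem coeff_ofCoeff (a : ℕ → ℂ) (ha : Summable fun n => ‖a n‖ ^ 2) (n : ℕ) :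
    coeff (ofCoeff a ha : L2) n = a n := by
  rw [← hbasis_repr, ofCoeff, LinearIsometryEquiv.apply_symm_apply]

/-! ### Products of functions in the Hardy space -/

theorem memLp_twist (n : ℤ) (u : L2) :
    MemLp (fun ζ : Circle => conj ((ζ : ℂ) ^ n * u ζ)) 2 arc := by
  refine (Lp.memLp u).congr_norm ?_ (Filter.Eventually.of_forall fun ζ => ?_)
  · exact Complex.continuous_conj.comp_aestronglyMeasurable
      ((continuous_circle_zpow n).aestronglyMeasurable.mul (Lp.aestronglyMeasurable u))
  · rw [norm_conj, norm_mul, norm_zpow, Circle.norm_coe, one_zpow, one_mul]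

/-- The function `ζ ↦ conj (ζ ^ n * u ζ)` in `L²(𝕋)`. -/
noncomputable def twist (n : ℤ) (u : L2) : L2 := (memLp_twist n u).toLp _

theorem coeFn_twist (n : ℤ) (u : L2) :
    (twist n u : Circle → ℂ) =ᵐ[arc] fun ζ => conj ((ζ : ℂ) ^ n * u ζ) :=
  MemLp.coeFn_toLp _

/-- A product of two L² functions is only in L¹; this still makes its Fourier coefficients bounded
functionals of f, so f may be expanded in monomials term by term. -/
theorem inner_twist (n : ℤ) (u f : L2) :
    inner ℂ (twist n u) f = coeff (fun ζ => u ζ * f ζ) (-n) := by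
  rw [L2.inner_def, coeff]
  refine integral_congr_ae ?_
  filter_upwards [coeFn_twist n u] with ζ hζ
  rw [hζ, RCLike.inner_apply, conj_conj, neg_neg]
  ring

theorem coeff_mul_monomial (u : L2) (n : ℤ) (m : ℕ) :
    coeff (fun ζ => u ζ * ((hmon m : H2) : L2) ζ) n = coeff u (n - m) := by
  rw [← coeff_zpow_mul]
  refine coeff_congr ?_ n
  filter_upwards [coeFn_monomial m] with ζ hζ
  rw [hmon, hζ, mul_comm]

theorem hasSum_coeff_mul (u : L2) (f : H2) (n : ℤ) :
    HasSum (fun m : ℕ => coeff (f : L2) m * coeff u (n - m))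
      (coeff (fun ζ => u ζ * (f : L2) ζ) n) := by
  have h := ((innerSL ℂ (twist (-n) u)).comp H2.subtypeL).hasSum (hasSum_hmon f)
  simp only [ContinuousLinearMap.comp_apply, Submodule.subtypeL_apply, innerSL_apply_apply,
    inner_twist, neg_neg, map_smul, smul_eq_mul, coeff_mul_monomial] at h
  simpa only [Function.comp_def, map_smul, smul_eq_mul, ContinuousLinearMap.comp_apply,
    Submodule.subtypeL_apply, innerSL_apply_apply, inner_twist, neg_neg, coeff_mul_monomial] using h

/-- The Fourier coefficients of a product of two `H²` functions of negative index vanish. -/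
theorem coeff_mul_neg (u f : H2) {n : ℤ} (hn : n < 0) :
    coeff (fun ζ => (u : L2) ζ * (f : L2) ζ) n = 0 := by
  refine (hasSum_coeff_mul u f n).unique ?_
  convert hasSum_zero with m
  rw [u.2 _ (by omega), mul_zero]

/-- The Fourier coefficients of a product of two `H²` functions are their Cauchy products. -/
theorem coeff_mul_nat (u f : H2) (n : ℕ) :
    coeff (fun ζ => (u : L2) ζ * (f : L2) ζ) n =
      ∑ m ∈ Finset.range (n + 1), coeff (f : L2) m * coeff (u : L2) (n - m : ℕ) := by
  refine (hasSum_coeff_mul u f n).unique ?_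
  have h : ∀ m ∉ Finset.range (n + 1),
      coeff (f : L2) m * coeff (u : L2) ((n : ℤ) - m) = 0 := fun m hm => by
    rw [Finset.mem_range, not_lt] at hm
    rw [u.2 _ (by omega), mul_zero]
  rw [Finset.sum_congr rfl (g := fun m : ℕ => coeff (f : L2) m * coeff (u : L2) ((n : ℤ) - m))
    fun m hm => by rw [Nat.cast_sub (by simpa [Nat.lt_succ_iff] using hm)]]
  exact hasSum_sum_of_ne_finset_zero h

/-! ### The analytic function attached to a function in the Hardy space -/

theorem hasSum_discFun (f : H2) (z : 𝔻) :
    HasSum (fun n : ℕ => coeff (f : L2) n * (z : ℂ) ^ n) (discFun f z) :=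
  (summable_discFun f z).hasSum

theorem hasFPowerSeriesOnBall_of_hasSum {a : ℕ → ℂ} {F : ℂ → ℂ}
    (h : ∀ z : ℂ, ‖z‖ < 1 → HasSum (fun n => a n * z ^ n) (F z)) :
    HasFPowerSeriesOnBall F (FormalMultilinearSeries.ofScalars ℂ a) 0 1 where
  r_le := by
    refine ENNReal.le_of_forall_nnreal_lt fun r hr => ?_
    refine FormalMultilinearSeries.le_radius_of_summable _ ?_
    have hr' : ‖((r : ℝ) : ℂ)‖ < 1 := by
      rw [Complex.norm_real, NNReal.norm_eq]
      exact_mod_cast hr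
    have := (h _ hr').summable.norm
    simpa [FormalMultilinearSeries.ofScalars_norm] using this
  r_pos := zero_lt_one
  hasSum {z} hz := by
    have hz' : ‖z‖ < 1 := by
      rw [mem_eball_zero_iff, ← ofReal_norm, ENNReal.ofReal_lt_one] at hz
      exact hz
    simpa [FormalMultilinearSeries.ofScalars_apply_eq, mul_comm] using h z hz'

/-- A function on the disc has at most one Taylor series. -/
theorem taylor_unique {a b : ℕ → ℂ} {F : ℂ → ℂ}
    (ha : ∀ z : ℂ, ‖z‖ < 1 → HasSum (fun n => a n * z ^ n) (F z))
    (hb : ∀ z : ℂ, ‖z‖ < 1 → HasSum (fun n => b n * z ^ n) (F z)) : a = b := by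
  have := (hasFPowerSeriesOnBall_of_hasSum ha).hasFPowerSeriesAt.eq_formalMultilinearSeries
    (hasFPowerSeriesOnBall_of_hasSum hb).hasFPowerSeriesAt
  exact FormalMultilinearSeries.ofScalars_series_injective (𝕜 := ℂ) (E := ℂ) this

/-- The sum of the Taylor series of `f`, as a function on `ℂ`. -/
noncomputable def taylorSum (f : H2) (z : ℂ) : ℂ := ∑' n : ℕ, coeff (f : L2) n * z ^ n

theorem hasSum_taylorSum (f : H2) (z : ℂ) (hz : ‖z‖ < 1) :
    HasSum (fun n : ℕ => coeff (f : L2) n * z ^ n) (taylorSum f z) :=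
  hasSum_discFun f (UnitDisc.mk z hz)

/-- The analytic function determines the function in the Hardy space. -/
theorem discFun_injective : Function.Injective discFun := by
  intro f g hfg
  refine H2_ext fun n => congrFun (taylor_unique (F := taylorSum f)
    (a := fun n : ℕ => coeff (f : L2) n) (b := fun n : ℕ => coeff (g : L2) n)
    (hasSum_taylorSum f) fun z hz => ?_) n
  have h : taylorSum f z = taylorSum g z := congrFun hfg (UnitDisc.mk z hz)
  rw [h]
  exact hasSum_taylorSum g z hz

theorem continuous_discFun (f : H2) : Continuous (discFun f) := by
  have h := (hasFPowerSeriesOnBall_of_hasSum (hasSum_taylorSum f)).continuousOn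
  refine h.comp_continuous UnitDisc.continuous_coe fun z => ?_
  rw [mem_eball_zero_iff, ← ofReal_norm, ENNReal.ofReal_lt_one]
  exact z.norm_lt_one

theorem discFun_add (f g : H2) (z : 𝔻) : discFun (f + g) z = discFun f z + discFun g z := by
  refine (hasSum_discFun _ z).unique ?_
  simpa only [coeff_H2_add, add_mul] using (hasSum_discFun f z).add (hasSum_discFun g z)

theorem discFun_smul (c : ℂ) (f : H2) (z : 𝔻) : discFun (c • f) z = c * discFun f z := by
  refine (hasSum_discFun _ z).unique ?_
  simpa only [coeff_H2_smul, mul_assoc] using (hasSum_discFun f z).mul_left c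

theorem discFun_sub (f g : H2) (z : 𝔻) : discFun (f - g) z = discFun f z - discFun g z := by
  refine (hasSum_discFun _ z).unique ?_
  simpa only [coeff_H2_sub, sub_mul] using (hasSum_discFun f z).sub (hasSum_discFun g z)

theorem discFun_zero_left (z : 𝔻) : discFun 0 z = 0 := by
  refine (hasSum_discFun _ z).unique ?_
  simpa only [coeff_H2_zero, zero_mul] using hasSum_zero

theorem discFun_at_zero (f : H2) : discFun f 0 = coeff (f : L2) 0 := by
  refine (hasSum_discFun f 0).unique ?_
  convert hasSum_ite_eq (0 : ℕ) (coeff (f : L2) 0) with n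
  rcases eq_or_ne n 0 with rfl | hn <;> simp [*]

/-- A product of `H²` functions on the circle which is in `H²` is a product on the disc. -/
theorem discFun_mul_of_ae {g u f : H2}
    (h : (g : L2) =ᵐ[arc] fun ζ => (u : L2) ζ * (f : L2) ζ) (z : 𝔻) :
    discFun g z = discFun u z * discFun f z := by
  have h1 := summable_norm_iff.mpr (summable_discFun u z)
  have h2 := summable_norm_iff.mpr (summable_discFun f z)
  rw [mul_comm]
  simp only [discFun]
  rw [tsum_mul_tsum_eq_tsum_sum_range_of_summable_norm h2 h1]
  refine tsum_congr fun n => ?_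
  rw [coeff_congr h, coeff_mul_nat, Finset.sum_mul]
  refine Finset.sum_congr rfl fun m hm => ?_
  rw [Finset.mem_range, Nat.lt_succ_iff] at hm
  rw [← Nat.add_sub_of_le hm, pow_add, Nat.add_sub_cancel_left]
  ring

/-! ### Multiplication by analytic symbols -/

theorem coeFn_mulOp (φ : Linf) (f : L2) :
    (mulOp φ f : Circle → ℂ) =ᵐ[arc] fun ζ => φ ζ * f ζ :=
  (ContinuousLinearMap.mul ℂ ℂ).coeFn_holder φ f

theorem coeFn_contSymbol (φ : C(Circle, ℂ)) : (contSymbol φ : Circle → ℂ) =ᵐ[arc] φ :=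
  ContinuousMap.coeFn_toLp (p := ∞) (𝕜 := ℂ) arc φ

theorem coeFn_mulOp_contSymbol (φ : C(Circle, ℂ)) (f : L2) :
    (mulOp (contSymbol φ) f : Circle → ℂ) =ᵐ[arc] fun ζ => φ ζ * f ζ := by
  filter_upwards [coeFn_mulOp (contSymbol φ) f, coeFn_contSymbol φ] with ζ h1 h2
  rw [h1, h2]

/-- A continuous function on the circle whose Fourier coefficients of negative index vanish. -/
def IsAnalytic (φ : C(Circle, ℂ)) : Prop := ∀ n : ℤ, n < 0 → coeff φ n = 0

theorem coeFn_toLp_two (φ : C(Circle, ℂ)) :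
    (ContinuousMap.toLp (E := ℂ) 2 arc ℂ φ : Circle → ℂ) =ᵐ[arc] φ :=
  ContinuousMap.coeFn_toLp (p := 2) (𝕜 := ℂ) arc φ

/-- An analytic continuous function as an element of `H²`. -/
noncomputable def IsAnalytic.toH2 {φ : C(Circle, ℂ)} (hφ : IsAnalytic φ) : H2 :=
  ⟨ContinuousMap.toLp (E := ℂ) 2 arc ℂ φ, fun n hn => by
    rw [coeff_congr (coeFn_toLp_two φ), hφ n hn]⟩

theorem IsAnalytic.coeFn_toH2 {φ : C(Circle, ℂ)} (hφ : IsAnalytic φ) :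
    ((hφ.toH2 : L2) : Circle → ℂ) =ᵐ[arc] φ :=
  coeFn_toLp_two φ

theorem IsAnalytic.mulOp_mem {φ : C(Circle, ℂ)} (hφ : IsAnalytic φ) (f : H2) :
    mulOp (contSymbol φ) f ∈ H2 := by
  intro n hn
  rw [← coeff_mul_neg hφ.toH2 f hn]
  refine coeff_congr ?_ n
  filter_upwards [coeFn_mulOp_contSymbol φ f, hφ.coeFn_toH2] with ζ h1 h2
  rw [h1, h2]

theorem IsAnalytic.coe_toeplitz {φ : C(Circle, ℂ)} (hφ : IsAnalytic φ) (f : H2) :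
    (toeplitz (contSymbol φ) f : L2) = mulOp (contSymbol φ) f :=
  congrArg Subtype.val
    (Submodule.orthogonalProjectionOnto_mem_subspace_eq_self ⟨_, hφ.mulOp_mem f⟩)

theorem IsAnalytic.coeFn_toeplitz {φ : C(Circle, ℂ)} (hφ : IsAnalytic φ) (f : H2) :
    ((toeplitz (contSymbol φ) f : L2) : Circle → ℂ) =ᵐ[arc] fun ζ => φ ζ * (f : L2) ζ := by
  rw [hφ.coe_toeplitz]
  exact coeFn_mulOp_contSymbol φ f

theorem IsAnalytic.discFun_toeplitz {φ : C(Circle, ℂ)} (hφ : IsAnalytic φ) (f : H2) (z : 𝔻) :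
    discFun (toeplitz (contSymbol φ) f) z = discFun hφ.toH2 z * discFun f z := by
  refine discFun_mul_of_ae ?_ z
  filter_upwards [hφ.coeFn_toeplitz f, hφ.coeFn_toH2] with ζ h1 h2
  rw [h1, h2]

theorem IsAnalytic.mul {φ χ : C(Circle, ℂ)} (hφ : IsAnalytic φ) (hχ : IsAnalytic χ) :
    IsAnalytic (φ * χ) := by
  intro n hn
  rw [← coeff_mul_neg hφ.toH2 hχ.toH2 hn]
  refine coeff_congr ?_ n
  filter_upwards [hφ.coeFn_toH2, hχ.coeFn_toH2] with ζ h1 h2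
  rw [h1, h2, ContinuousMap.mul_apply]

theorem isAnalytic_one : IsAnalytic 1 := by
  intro n hn
  rw [coeff]
  simp only [ContinuousMap.one_apply, mul_one]
  rw [integral_zpow, if_neg (by omega)]

theorem IsAnalytic.pow {φ : C(Circle, ℂ)} (hφ : IsAnalytic φ) (n : ℕ) : IsAnalytic (φ ^ n) := by
  induction n with
  | zero => rw [pow_zero]; exact isAnalytic_one
  | succ n ih => rw [pow_succ]; exact ih.mul hφ

theorem toeplitz_one (f : H2) : toeplitz (contSymbol 1) f = f := by
  refine Subtype.ext (Lp.ext ?_)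
  filter_upwards [isAnalytic_one.coeFn_toeplitz f] with ζ h
  rw [h, ContinuousMap.one_apply, one_mul]

theorem IsAnalytic.toeplitz_mul {φ χ : C(Circle, ℂ)} (hφ : IsAnalytic φ) (hχ : IsAnalytic χ)
    (f : H2) :
    toeplitz (contSymbol (φ * χ)) f = toeplitz (contSymbol φ) (toeplitz (contSymbol χ) f) := by
  refine Subtype.ext (Lp.ext ?_)
  filter_upwards [(hφ.mul hχ).coeFn_toeplitz f, hχ.coeFn_toeplitz f,
    hφ.coeFn_toeplitz (toeplitz (contSymbol χ) f)] with ζ h1 h2 h3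
  rw [h1, h3, h2, ContinuousMap.mul_apply, mul_assoc]

/-! ### Shifts -/

theorem coeff_const_mul (c : ℂ) (f : Circle → ℂ) (n : ℤ) :
    coeff (fun ζ => c * f ζ) n = c * coeff f n := by
  simp only [coeff, mul_left_comm _ c]
  exact integral_const_mul _ _

theorem norm_coeff_le_integral (f : Circle → ℂ) (n : ℤ) : ‖coeff f n‖ ≤ ∫ ζ, ‖f ζ‖ ∂arc := by
  refine (norm_integral_le_integral_norm _).trans_eq (integral_congr_ae ?_)
  refine Filter.Eventually.of_forall fun ζ => ?_
  simp only
  rw [norm_mul, norm_zpow, Circle.norm_coe, one_zpow, one_mul]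

theorem integrable_continuousMap (φ : C(Circle, ℂ)) : Integrable φ arc :=
  φ.continuous.integrable_of_hasCompactSupport (HasCompactSupport.of_compactSpace _)

namespace DiscAut

/-- From (1 − āζ)ψ = λ(a − ζ), the coefficients satisfy c(n) = ā c(n−1) for n < 0. They are bounded
and |a| < 1, so going towards −∞ forces c(n) = 0. -/
theorem isAnalytic_boundary (ψ : DiscAut) : IsAnalytic ψ.boundary := by
  have hψ := integrable_continuousMap ψ.boundary
  have hrec : ∀ n : ℤ, n < 0 →
      coeff ψ.boundary n = conj (ψ.a : ℂ) * coeff ψ.boundary (n - 1) := by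
    intro n hn
    have h1 : ∀ ζ : Circle, ψ.boundary ζ - conj (ψ.a : ℂ) * ((ζ : ℂ) ^ (1 : ℤ) * ψ.boundary ζ) =
        ψ.lam * (ψ.a : ℂ) * (ζ : ℂ) ^ (0 : ℤ) - ψ.lam * (ζ : ℂ) ^ (1 : ℤ) := fun ζ => by
      have hd := denom_ne_zero ψ.a (Circle.norm_coe ζ).le
      change ψ.toFun ζ - conj (ψ.a : ℂ) * ((ζ : ℂ) ^ (1 : ℤ) * ψ.toFun ζ) = _
      have : ψ.toFun ζ * (1 - conj (ψ.a : ℂ) * ζ) = ψ.lam * (ψ.a - ζ) := by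
        rw [toFun, div_mul_cancel₀ _ hd]
      rw [zpow_one, zpow_zero]
      linear_combination this
    have h2 := coeff_sub hψ ((integrable_zpow_mul hψ 1).const_mul (conj (ψ.a : ℂ))) n
    rw [coeff_const_mul, coeff_zpow_mul] at h2
    simp only [h1] at h2
    have hz : ∀ (c : ℂ) (m : ℤ), Integrable (fun ζ : Circle => c * (ζ : ℂ) ^ m) arc := fun c m =>
      (integrable_continuousMap ⟨_, continuous_circle_zpow m⟩).const_mul c
    rw [coeff_sub (f := fun ζ : Circle => (ψ.lam * ψ.a : ℂ) * (ζ : ℂ) ^ (0 : ℤ))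
      (g := fun ζ : Circle => (ψ.lam : ℂ) * (ζ : ℂ) ^ (1 : ℤ)) (hz _ _) (hz _ _),
      coeff_const_mul, coeff_const_mul, ← coeff_congr (coeFn_monomial 0),
      ← coeff_congr (coeFn_monomial 1), coeff_monomial, coeff_monomial, if_neg (by omega),
      if_neg (by omega), mul_zero, mul_zero, sub_zero] at h2
    exact sub_eq_zero.mp h2.symm
  intro n hn
  have hit : ∀ m : ℕ, coeff ψ.boundary n = conj (ψ.a : ℂ) ^ m * coeff ψ.boundary (n - m) := by
    intro m
    induction m with
    | zero => simp
    | succ m ih =>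
      rw [ih, hrec _ (by omega), pow_succ, mul_assoc]
      push_cast
      rw [sub_sub]
  have hlim : Filter.Tendsto (fun m : ℕ => ‖(ψ.a : ℂ)‖ ^ m * ∫ ζ, ‖ψ.boundary ζ‖ ∂arc)
      Filter.atTop (nhds 0) := by
    simpa using (tendsto_pow_atTop_nhds_zero_of_lt_one (norm_nonneg _)
      ψ.a.norm_lt_one).mul_const (∫ ζ, ‖ψ.boundary ζ‖ ∂arc)
  refine norm_le_zero_iff.mp (ge_of_tendsto' hlim fun m => ?_)
  rw [hit m, norm_mul, norm_pow, norm_conj]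
  exact mul_le_mul_of_nonneg_left (norm_coeff_le_integral _ _) (by positivity)

end DiscAut

theorem discFun_hmon (n : ℕ) (z : 𝔻) : discFun (hmon n) z = (z : ℂ) ^ n := by
  refine (hasSum_discFun _ z).unique ?_
  convert hasSum_ite_eq n ((z : ℂ) ^ n) using 2 with m
  rw [hmon, coeff_monomial]
  split_ifs with h1 h2 h2
  · rw [Nat.cast_inj.mp h1, one_mul]
  · exact absurd (Nat.cast_inj.mp h1) h2
  · exact absurd (congrArg Nat.cast h2) h1
  · rw [zero_mul]

namespace DiscAut

theorem discFun_boundary (ψ : DiscAut) (z : 𝔻) :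
    discFun ψ.isAnalytic_boundary.toH2 z = ψ.onDisc z := by
  have hd := denom_ne_zero ψ.a z.norm_lt_one.le
  have h := discFun_mul_of_ae (g := (ψ.lam * ψ.a : ℂ) • hmon 0 - (ψ.lam : ℂ) • hmon 1)
    (u := ψ.isAnalytic_boundary.toH2) (f := hmon 0 - conj (ψ.a : ℂ) • hmon 1) ?_ z
  · simp only [discFun_sub, discFun_smul, discFun_hmon, pow_zero, pow_one, mul_one] at h
    rw [coe_onDisc, toFun, eq_div_iff hd, ← h]
    ring
  · filter_upwards [ψ.isAnalytic_boundary.coeFn_toH2, coeFn_monomial 0, coeFn_monomial 1,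
      Lp.coeFn_sub ((ψ.lam * ψ.a : ℂ) • monomial 0) ((ψ.lam : ℂ) • monomial 1),
      Lp.coeFn_sub (monomial 0) (conj (ψ.a : ℂ) • monomial 1),
      Lp.coeFn_smul (ψ.lam * ψ.a : ℂ) (monomial 0), Lp.coeFn_smul (ψ.lam : ℂ) (monomial 1),
      Lp.coeFn_smul (conj (ψ.a : ℂ)) (monomial 1)] with ζ h1 h2 h3 h4 h5 h6 h7 h8
    change ((ψ.lam * ψ.a : ℂ) • monomial 0 - (ψ.lam : ℂ) • monomial 1 : L2) ζ = _ *
      (monomial 0 - conj (ψ.a : ℂ) • monomial 1 : L2) ζ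
    rw [h1, h4, h5, Pi.sub_apply, Pi.sub_apply, h6, h7, h8, Pi.smul_apply, Pi.smul_apply,
      Pi.smul_apply, h2, h3]
    change _ = ψ.toFun ζ * _
    have hd := denom_ne_zero ψ.a (Circle.norm_coe ζ).le
    have : ψ.toFun ζ * (1 - conj (ψ.a : ℂ) * ζ) = ψ.lam * (ψ.a - ζ) := by
      rw [toFun, div_mul_cancel₀ _ hd]
    simp only [smul_eq_mul, zpow_zero, zpow_one]
    linear_combination -this

theorem discFun_toeplitz_boundary (ψ : DiscAut) (f : H2) (z : 𝔻) :
    discFun (toeplitz (contSymbol ψ.boundary) f) z = ψ.onDisc z * discFun f z := by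
  rw [ψ.isAnalytic_boundary.discFun_toeplitz, discFun_boundary]

/-- The identity automorphism. -/
noncomputable def one : DiscAut := ⟨0, -1⟩

theorem toFun_one (z : ℂ) : one.toFun z = z := by
  simp [one, toFun]

end DiscAut

/-- The unilateral shift on `H²`. -/
noncomputable def shift : H2 →L[ℂ] H2 := toeplitz (contSymbol DiscAut.one.boundary)

theorem coeFn_shift (f : H2) :
    ((shift f : L2) : Circle → ℂ) =ᵐ[arc] fun ζ => (ζ : ℂ) * (f : L2) ζ := by
  filter_upwards [DiscAut.one.isAnalytic_boundary.coeFn_toeplitz f] with ζ h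
  rw [shift, h]
  congr 1
  exact DiscAut.toFun_one ζ

theorem coeff_shift (f : H2) (n : ℤ) : coeff (shift f : L2) n = coeff (f : L2) (n - 1) := by
  rw [← coeff_zpow_mul, coeff_congr (coeFn_shift f)]
  simp only [zpow_one]

theorem coeff_shift_zero (f : H2) : coeff (shift f : L2) 0 = 0 := by
  rw [coeff_shift, f.2 _ (by omega)]

theorem coeff_shift_succ (f : H2) (n : ℕ) :
    coeff (shift f : L2) ((n + 1 : ℕ) : ℤ) = coeff (f : L2) n := by
  rw [coeff_shift]
  push_cast
  rw [add_sub_cancel_right]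

theorem discFun_shift (f : H2) (z : 𝔻) : discFun (shift f) z = z * discFun f z := by
  rw [shift, DiscAut.discFun_toeplitz_boundary, DiscAut.coe_onDisc, DiscAut.toFun_one]

theorem inner_shift_shift (f g : H2) : inner ℂ (shift f) (shift g) = inner ℂ f g := by
  have h := (hasSum_inner (shift f) (shift g))
  rw [← hasSum_nat_add_iff' 1] at h
  simp only [coeff_shift_succ, Finset.range_one, Finset.sum_singleton, Nat.cast_zero,
    coeff_shift_zero, mul_zero, sub_zero] at h
  exact h.unique (hasSum_inner f g)

theorem norm_shift (f : H2) : ‖shift f‖ = ‖f‖ := by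
  rw [@norm_eq_sqrt_re_inner ℂ, @norm_eq_sqrt_re_inner ℂ, inner_shift_shift]

/-- The backward shift on `H²`. -/
noncomputable def bshift : H2 →L[ℂ] H2 := ContinuousLinearMap.adjoint shift

theorem shift_hmon (n : ℕ) : shift (hmon n) = hmon (n + 1) := by
  refine Subtype.ext (Lp.ext ?_)
  filter_upwards [coeFn_shift (hmon n), coeFn_monomial n, coeFn_monomial (n + 1 : ℕ)]
    with ζ h1 h2 h3
  rw [h1]
  change _ * (monomial n : L2) ζ = (monomial ((n + 1 : ℕ) : ℤ) : L2) ζ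
  rw [h2, h3, zpow_natCast, zpow_natCast, pow_succ']

theorem coeff_bshift (f : H2) (n : ℕ) :
    coeff (bshift f : L2) n = coeff (f : L2) ((n + 1 : ℕ) : ℤ) := by
  rw [← inner_hmon, bshift, ContinuousLinearMap.adjoint_inner_right, shift_hmon, inner_hmon]

theorem shift_bshift {f : H2} (hf : coeff (f : L2) 0 = 0) : shift (bshift f) = f := by
  refine H2_ext fun n => ?_
  cases n with
  | zero => rw [Nat.cast_zero, coeff_shift_zero, hf]
  | succ n => rw [coeff_shift_succ, coeff_bshift]

/-! ### Evaluation functionals -/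

theorem summable_norm_pow_sq {z : ℂ} (hz : ‖z‖ < 1) : Summable fun n : ℕ => ‖conj z ^ n‖ ^ 2 := by
  simp only [norm_pow, norm_conj, ← pow_mul, mul_comm _ 2]
  simp only [pow_mul]
  exact summable_geometric_of_lt_one (by positivity) (by nlinarith [norm_nonneg z])

/-- The reproducing kernel of `H²`. -/
noncomputable def szego (z : 𝔻) : H2 :=
  ofCoeff (fun n => conj (z : ℂ) ^ n) (summable_norm_pow_sq z.norm_lt_one)

theorem inner_szego (z : 𝔻) (f : H2) : inner ℂ (szego z) f = discFun f z := by
  refine (hasSum_inner (szego z) f).unique ?_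
  convert hasSum_discFun f z using 2 with n
  rw [szego, coeff_ofCoeff, map_pow, conj_conj, mul_comm]

/-! ### Composition operators -/

/-- By uniqueness of Haar measure, arc length is proportional to one-dimensional Hausdorff measure,
which the Lipschitz map ψ⁻¹ enlarges at most by its Lipschitz constant. This bounds composition with
ψ on L². -/
theorem exists_map_arc_le (ψ : DiscAut) :
    ∃ C : NNReal, Measure.map ψ.onCircle arc ≤ C • arc := by
  have : IsFiniteMeasure (μH[1] : Measure Circle) := ⟨hausdorff_circle_lt_top⟩
  have : arc.IsHaarMeasure := Measure.isHaarMeasure_of_isCompact_nonempty_interior arc Set.univ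
    isCompact_univ (by simp) (by simp) (by simp)
  have hc := Measure.isMulLeftInvariant_eq_smul (μH[1] : Measure Circle) arc
  set c := (μH[1] : Measure Circle).haarScalarFactor arc
  have hc0 : c ≠ 0 := by
    intro h
    rw [h, zero_smul] at hc
    exact hausdorff_circle_ne_zero hc
  obtain ⟨K, hK⟩ := ψ.symm.lipschitz_onCircle
  refine ⟨K, Measure.le_iff.mpr fun s hs => ?_⟩
  rw [Measure.map_apply ψ.continuous_onCircle.measurable hs]
  have hsub : ψ.onCircle ⁻¹' s ⊆ ψ.symm.onCircle '' s := fun ζ hζ =>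
    ⟨ψ.onCircle ζ, hζ, Circle.ext (ψ.symm_toFun_toFun (Circle.norm_coe ζ).le)⟩
  have h := (measure_mono hsub).trans (hK.hausdorffMeasure_image_le zero_le_one s)
  rw [hc, ENNReal.rpow_one] at h
  simp only [Measure.smul_apply, ENNReal.smul_def, smul_eq_mul] at h ⊢
  rw [mul_left_comm] at h
  exact (ENNReal.mul_le_mul_iff_right (ENNReal.coe_ne_zero.mpr hc0) ENNReal.coe_ne_top).mp h

theorem memLp_comp_onCircle (ψ : DiscAut) (f : L2) : MemLp (fun ζ => f (ψ.onCircle ζ)) 2 arc := by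
  obtain ⟨C, hC⟩ := exists_map_arc_le ψ
  exact MemLp.comp_of_map ((Lp.memLp f).of_measure_le_smul (c := C) ENNReal.coe_ne_top hC)
    ψ.continuous_onCircle.aemeasurable

/-- Composition with an automorphism, on `L²(𝕋)`. -/
noncomputable def compL2 (ψ : DiscAut) : L2 →L[ℂ] L2 :=
  LinearMap.mkContinuousOfExistsBound
    { toFun := fun f => (memLp_comp_onCircle ψ f).toLp _
      map_add' := fun f g => by
        rw [← MemLp.toLp_add]
        refine MemLp.toLp_congr _ _ ?_
        exact ψ.quasiMeasurePreserving_onCircle.ae (Lp.coeFn_add f g)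
      map_smul' := fun c f => by
        rw [RingHom.id_apply, ← MemLp.toLp_const_smul]
        refine MemLp.toLp_congr _ _ ?_
        exact ψ.quasiMeasurePreserving_onCircle.ae (Lp.coeFn_smul c f) } (by
    obtain ⟨C, hC⟩ := exists_map_arc_le ψ
    refine ⟨((C : ℝ≥0∞) ^ (1 / 2 : ℝ)).toReal, fun f => ?_⟩
    simp only [LinearMap.coe_mk, AddHom.coe_mk]
    rw [Lp.norm_toLp, Lp.norm_def, ← ENNReal.toReal_mul]
    refine ENNReal.toReal_mono (ENNReal.mul_ne_top (by simp) (Lp.eLpNorm_ne_top f)) ?_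
    have h1 : AEStronglyMeasurable f (Measure.map ψ.onCircle arc) :=
      (Lp.stronglyMeasurable f).aestronglyMeasurable
    have h2 := eLpNorm_map_measure (p := 2) h1 ψ.continuous_onCircle.aemeasurable
    have h3 := eLpNorm_mono_measure (p := 2) f hC
    rw [h2] at h3
    refine h3.trans_eq ?_
    have h4 := eLpNorm_smul_measure_of_ne_top (p := 2) (μ := arc) (by simp) f (C : ℝ≥0∞)
    simpa using h4)

theorem coeFn_compL2 (ψ : DiscAut) (f : L2) :
    (compL2 ψ f : Circle → ℂ) =ᵐ[arc] fun ζ => f (ψ.onCircle ζ) :=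
  MemLp.coeFn_toLp (memLp_comp_onCircle ψ f)

theorem coeFn_comp_of_ae (ψ : DiscAut) {f g : Circle → ℂ} (h : f =ᵐ[arc] g) :
    (fun ζ => f (ψ.onCircle ζ)) =ᵐ[arc] fun ζ => g (ψ.onCircle ζ) :=
  ψ.quasiMeasurePreserving_onCircle.ae h

theorem onCircle_symm_onCircle (ψ : DiscAut) (ζ : Circle) :
    ψ.symm.onCircle (ψ.onCircle ζ) = ζ :=
  Circle.ext (ψ.symm_toFun_toFun (Circle.norm_coe ζ).le)

theorem onCircle_onCircle_symm (ψ : DiscAut) (ζ : Circle) :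
    ψ.onCircle (ψ.symm.onCircle ζ) = ζ := by
  have h := onCircle_symm_onCircle ψ.symm ζ
  rwa [ψ.symm_symm] at h

theorem onDisc_symm_onDisc (ψ : DiscAut) (z : 𝔻) : ψ.symm.onDisc (ψ.onDisc z) = z :=
  UnitDisc.coe_injective (ψ.symm_toFun_toFun z.norm_lt_one.le)

theorem onDisc_onDisc_symm (ψ : DiscAut) (z : 𝔻) : ψ.onDisc (ψ.symm.onDisc z) = z := by
  have h := onDisc_symm_onDisc ψ.symm z
  rwa [ψ.symm_symm] at h

theorem compL2_symm_compL2 (ψ : DiscAut) (f : L2) : compL2 ψ.symm (compL2 ψ f) = f := by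
  refine Lp.ext ?_
  filter_upwards [coeFn_compL2 ψ.symm (compL2 ψ f),
    coeFn_comp_of_ae ψ.symm (coeFn_compL2 ψ f)] with ζ h1 h2
  rw [h1, h2, onCircle_onCircle_symm]

theorem compL2_compL2_symm (ψ : DiscAut) (f : L2) : compL2 ψ (compL2 ψ.symm f) = f := by
  have h := compL2_symm_compL2 ψ.symm f
  rwa [ψ.symm_symm] at h

theorem compL2_hmon (ψ : DiscAut) (n : ℕ) :
    compL2 ψ (hmon n : H2) = ((ψ.isAnalytic_boundary.pow n).toH2 : L2) := by
  refine Lp.ext ?_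
  filter_upwards [coeFn_compL2 ψ (hmon n : H2), coeFn_comp_of_ae ψ (coeFn_monomial n),
    (ψ.isAnalytic_boundary.pow n).coeFn_toH2] with ζ h1 h2 h3
  rw [h1, h3]
  refine h2.trans ?_
  rw [zpow_natCast]
  rfl

theorem hasSum_compL2 (ψ : DiscAut) (f : H2) :
    HasSum (fun n : ℕ => ((coeff (f : L2) n • (ψ.isAnalytic_boundary.pow n).toH2 : H2) : L2))
      (compL2 ψ f) := by
  have h := ((compL2 ψ).comp H2.subtypeL).hasSum (hasSum_hmon f)
  simpa only [Function.comp_def, map_smul, ContinuousLinearMap.comp_apply,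
    Submodule.subtypeL_apply, compL2_hmon, Submodule.coe_smul] using h

theorem compL2_mem (ψ : DiscAut) (f : H2) : compL2 ψ f ∈ H2 :=
  isClosed_H2.mem_of_tendsto (hasSum_compL2 ψ f) (Filter.Eventually.of_forall fun _ =>
    Submodule.sum_mem _ fun _ _ => Submodule.coe_mem _)

/-- Composition with an automorphism, on `H²`. -/
noncomputable def comp (ψ : DiscAut) : H2 →L[ℂ] H2 :=
  ((compL2 ψ).comp H2.subtypeL).codRestrict H2 (compL2_mem ψ)

theorem coe_comp (ψ : DiscAut) (f : H2) : (comp ψ f : L2) = compL2 ψ f := rfl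

theorem comp_symm_comp (ψ : DiscAut) (f : H2) : comp ψ.symm (comp ψ f) = f :=
  Subtype.ext (compL2_symm_compL2 ψ f)

theorem comp_comp_symm (ψ : DiscAut) (f : H2) : comp ψ (comp ψ.symm f) = f :=
  Subtype.ext (compL2_compL2_symm ψ f)

theorem discFun_pow_boundary (ψ : DiscAut) (n : ℕ) (z : 𝔻) :
    discFun (ψ.isAnalytic_boundary.pow n).toH2 z = (ψ.onDisc z : ℂ) ^ n := by
  induction n with
  | zero =>
    have h0 := discFun_hmon 0 z
    rw [pow_zero] at h0
    rw [pow_zero (ψ.onDisc z : ℂ), ← h0]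
    refine congrFun (congrArg discFun ?_) z
    refine Subtype.ext (Lp.ext ?_)
    filter_upwards [(ψ.isAnalytic_boundary.pow 0).coeFn_toH2, coeFn_monomial 0] with ζ h1 h2
    rw [h1]
    refine Eq.trans ?_ h2.symm
    simp
  | succ n ih =>
    rw [pow_succ (ψ.onDisc z : ℂ), ← ih, ← ψ.discFun_boundary]
    refine discFun_mul_of_ae ?_ z
    filter_upwards [(ψ.isAnalytic_boundary.pow n).coeFn_toH2, ψ.isAnalytic_boundary.coeFn_toH2,
      (ψ.isAnalytic_boundary.pow (n + 1)).coeFn_toH2] with ζ h1 h2 h3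
    rw [h1, h2, h3, pow_succ, ContinuousMap.mul_apply]

theorem discFun_comp (ψ : DiscAut) (f : H2) (z : 𝔻) :
    discFun (comp ψ f) z = discFun f (ψ.onDisc z) := by
  have h := (innerSL ℂ (szego z : L2)).hasSum (hasSum_compL2 ψ f)
  simp only [innerSL_apply_apply, ← coe_comp, ← Submodule.coe_inner,
    inner_szego, discFun_smul, discFun_pow_boundary] at h
  exact h.unique (hasSum_discFun f (ψ.onDisc z))

theorem DiscAut.onDisc_a (ψ : DiscAut) : ψ.onDisc ψ.a = 0 :=
  UnitDisc.coe_injective (by simp [toFun])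

/-- This intertwining reduces near invariance under `T_ψ` to near invariance under the shift. -/
theorem comp_shift (ψ : DiscAut) (f : H2) :
    comp ψ (shift f) = toeplitz (contSymbol ψ.boundary) (comp ψ f) :=
  discFun_injective (funext fun z => by
    rw [discFun_comp, discFun_shift, ψ.discFun_toeplitz_boundary, discFun_comp])

/-- A function in `H²` which vanishes at the zero of an automorphism is divisible by it. -/
theorem exists_toeplitz_eq {ψ : DiscAut} {f : H2} (hf : discFun f ψ.a = 0) :
    ∃ g, toeplitz (contSymbol ψ.boundary) g = f := by
  have h0 : coeff (comp ψ.symm f : L2) 0 = 0 := by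
    rw [← discFun_at_zero, ← ψ.onDisc_a, discFun_comp, onDisc_symm_onDisc, hf]
  exact ⟨comp ψ (bshift (comp ψ.symm f)), by
    rw [← comp_shift, shift_bshift h0, comp_comp_symm]⟩

/-! ### The kernel of the Toeplitz operator with symbol `(θ̄ ∘ ψ) ψ / z` -/

theorem coeff_twist (n : ℤ) (u : L2) (m : ℤ) : coeff (twist n u) m = conj (coeff u (-m - n)) := by
  rw [coeff_congr (coeFn_twist n u), coeff_conj, coeff_zpow_mul]

theorem twist_twist (g : L2) : twist 1 (twist 1 g) = g := by
  refine L2_ext fun n => ?_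
  rw [coeff_twist, coeff_twist, conj_conj]
  congr 1
  ring

theorem mem_H2_orthogonal_iff (g : L2) : g ∈ H2ᗮ ↔ ∀ m : ℕ, coeff g m = 0 := by
  constructor
  · intro h m
    rw [← inner_monomial]
    exact h _ (hmon m).2
  · intro h f hf
    have hs := (innerSL ℂ g).hasSum (H2.subtypeL.hasSum (hasSum_hmon ⟨f, hf⟩))
    refine inner_eq_zero_symm.mp (hs.unique ?_)
    convert hasSum_zero with m
    rw [map_smul, map_smul, innerSL_apply_apply]
    have h1 : inner ℂ (monomial m) g = 0 := by rw [inner_monomial, h]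
    exact (congrArg _ (inner_eq_zero_symm.mp h1)).trans (smul_zero _)

/-- The involution g ↦ conj(ζg) conjugates coefficients and sends index m to −m−1, exchanging
negative and nonnegative frequencies. Orthogonality to H² thus becomes membership in H². -/
theorem twist_mem_H2_iff (g : L2) : twist 1 g ∈ H2 ↔ g ∈ H2ᗮ := by
  rw [mem_H2_orthogonal_iff, mem_H2_iff]
  simp only [coeff_twist, map_eq_zero]
  constructor
  · intro h m
    simpa using h (-m - 1) (by omega)
  · intro h n hn
    obtain ⟨m, rfl⟩ : ∃ m : ℕ, n = -(m : ℤ) - 1 := ⟨(-n - 1).toNat, by omega⟩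
    simpa using h m

theorem toeplitz_eq_zero_iff (φ : Linf) (h : H2) :
    toeplitz φ h = 0 ↔ twist 1 (mulOp φ h) ∈ H2 := by
  rw [twist_mem_H2_iff, ← Submodule.orthogonalProjectionOnto_eq_zero_iff]
  rfl

theorem inner_mulOp (θ : Linf) (e : H2) (f : H2) :
    inner ℂ (mulOp θ e) (f : L2) = conj (inner ℂ (twist 1 (mulOp θ (twist 1 f))) (e : L2)) := by
  rw [inner_twist, coeff, L2.inner_def, ← integral_conj]
  refine integral_congr_ae ?_
  filter_upwards [coeFn_mulOp θ e, coeFn_mulOp θ (twist 1 f), coeFn_twist 1 f] with ζ h1 h2 h3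
  have hζ : (ζ : ℂ) * conj (ζ : ℂ) = 1 := by
    rw [Complex.mul_conj, Circle.normSq_coe, ofReal_one]
  simp only [RCLike.inner_apply, h1, h2, h3, neg_neg, zpow_one, map_mul, conj_conj]
  linear_combination -(f : L2) ζ * (conj (θ ζ) * conj ((e : L2) ζ)) * hζ

/-- f ⊥ θH² means conj(θ)f ⊥ H², and the involution turns conj(θ)f into θ·conj(ζf). -/
theorem mem_modelSpace_iff (θ : Linf) (f : H2) :
    f ∈ modelSpace θ ↔ mulOp θ (twist 1 f) ∈ H2 := by
  rw [← twist_twist (mulOp θ (twist 1 f)), twist_mem_H2_iff, modelSpace, Submodule.mem_comap,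
    Submodule.mem_orthogonal, Submodule.mem_orthogonal']
  constructor
  · intro h e he
    have := h (mulOp θ e) (Submodule.mem_map_of_mem he)
    rw [← map_eq_zero conj, ← inner_mulOp θ ⟨e, he⟩ f]
    exact this
  · rintro h _ ⟨e, he, rfl⟩
    refine (inner_mulOp θ ⟨e, he⟩ f).trans ?_
    rw [h e he, map_zero]

theorem coeFn_kernelSymbol (θ : Linf) (ψ : DiscAut) : (kernelSymbol θ ψ : Circle → ℂ) =ᵐ[arc]
    fun ζ : Circle => conj (θ (ψ.onCircle ζ)) * ((ψ.onCircle ζ : ℂ) / ζ) :=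
  MemLp.coeFn_toLp _

/-- In conj(ζ · symbol · h) the 1/z of the symbol cancels ζ, leaving (θ ∘ ψ)·conj(ψh). This is
θ·conj(z·(h ∘ ψ⁻¹)) composed with ψ, so the kernel is K_θ ∘ ψ. -/
theorem mem_ker_kernelSymbol (θ : Linf) (ψ : DiscAut) (h : H2) :
    toeplitz (kernelSymbol θ ψ) h = 0 ↔ comp ψ.symm h ∈ modelSpace θ := by
  rw [toeplitz_eq_zero_iff, mem_modelSpace_iff]
  have key : twist 1 (mulOp (kernelSymbol θ ψ) h) =
      compL2 ψ (mulOp θ (twist 1 (comp ψ.symm h : H2))) := by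
    refine Lp.ext ?_
    filter_upwards [coeFn_twist 1 (mulOp (kernelSymbol θ ψ) h), coeFn_mulOp (kernelSymbol θ ψ) h,
      coeFn_kernelSymbol θ ψ, coeFn_compL2 ψ (mulOp θ (twist 1 (comp ψ.symm h : H2))),
      coeFn_comp_of_ae ψ (coeFn_mulOp θ (twist 1 (comp ψ.symm h : H2))),
      coeFn_comp_of_ae ψ (coeFn_twist 1 (comp ψ.symm h : H2)),
      coeFn_comp_of_ae ψ (coeFn_compL2 ψ.symm h)] with ζ h1 h2 h3 h4 h5 h6 h7
    rw [h1, h2, h3, h4, h5, h6, coe_comp, h7, onCircle_symm_onCircle, zpow_one, zpow_one]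
    have hζ := ζ.coe_ne_zero
    rw [show (ζ : ℂ) * (conj (θ (ψ.onCircle ζ)) * ((ψ.onCircle ζ : ℂ) / ζ) * (h : L2) ζ) =
      conj (θ (ψ.onCircle ζ)) * (ψ.onCircle ζ * (h : L2) ζ) by field_simp]
    rw [map_mul conj (conj (θ (ψ.onCircle ζ))), conj_conj]
  rw [key]
  constructor
  · intro hm
    have := compL2_mem ψ.symm ⟨_, hm⟩
    rwa [compL2_symm_compL2] at this
  · intro hm
    exact compL2_mem ψ ⟨_, hm⟩

/-- The kernel of a Toeplitz operator is closed under division by automorphisms. -/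
theorem toeplitz_eq_zero_of_mul {φ : Linf} {ψ : DiscAut} {g : H2}
    (h : toeplitz φ (toeplitz (contSymbol ψ.boundary) g) = 0) : toeplitz φ g = 0 := by
  rw [toeplitz_eq_zero_iff] at h ⊢
  -- Multiplying conj(zφψg) ∈ H² by ψ stays in H² and cancels conj(ψ), because |ψ| = 1 on the
  -- circle.
  have := ψ.isAnalytic_boundary.mulOp_mem ⟨_, h⟩
  convert this using 1
  refine Lp.ext ?_
  filter_upwards [coeFn_twist 1 (mulOp φ g), coeFn_mulOp φ g,
    coeFn_mulOp_contSymbol ψ.boundary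
      (twist 1 (mulOp φ (toeplitz (contSymbol ψ.boundary) g : H2))),
    coeFn_twist 1 (mulOp φ (toeplitz (contSymbol ψ.boundary) g : H2)),
    coeFn_mulOp φ (toeplitz (contSymbol ψ.boundary) g : H2),
    ψ.isAnalytic_boundary.coeFn_toeplitz g] with ζ h1 h2 h3 h4 h5 h6
  rw [h1, h2, h3, h4, h5, h6]
  have hζ : ψ.boundary ζ * conj (ψ.boundary ζ) = 1 := by
    change (ψ.onCircle ζ : ℂ) * conj (ψ.onCircle ζ : ℂ) = 1
    rw [Complex.mul_conj, Circle.normSq_coe, ofReal_one]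
  simp only [map_mul]
  linear_combination -conj ((ζ : ℂ) ^ (1 : ℤ)) * conj (φ ζ) * conj ((g : L2) ζ) * hζ

/-! ### Spaces of the form `(u ∘ ψ) Ker T` -/

/-- Undoes the composition with ψ: M ∘ ψ⁻¹ = u K_θ. The multiplier hypothesis ensures that every
product uf with f ∈ K_θ comes from an element of H². -/
theorem hasForm_iff {ψ : DiscAut} {θ : Linf} {u : H2} {M : Submodule ℂ H2}
    (hu : IsIsometricMultiplier u (modelSpace θ)) :
    HasForm ψ θ u M ↔ ∀ m : H2, m ∈ M ↔
      ∃ f ∈ modelSpace θ, ∀ z, discFun (comp ψ.symm m) z = discFun u z * discFun f z := by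
  have hker : ∀ h : H2, h ∈ LinearMap.ker (toeplitz (kernelSymbol θ ψ) : H2 →ₗ[ℂ] H2) ↔
      comp ψ.symm h ∈ modelSpace θ := fun h => by
    rw [LinearMap.mem_ker, ← mem_ker_kernelSymbol]
    rfl
  have hconv : ∀ m f : H2, (∀ z, discFun (comp ψ.symm m) z = discFun u z * discFun f z) ↔
      (fun z => discFun u (ψ.onDisc z) * discFun (comp ψ f) z) = discFun m := fun m f => by
    rw [funext_iff]
    constructor
    · intro h z
      have := h (ψ.onDisc z)
      rw [discFun_comp, onDisc_symm_onDisc] at this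
      rw [discFun_comp, this]
    · intro h z
      have := h (ψ.symm.onDisc z)
      rw [discFun_comp, onDisc_onDisc_symm] at this
      rw [discFun_comp, this]
  constructor
  · intro h m
    constructor
    · intro hm
      have h1 : discFun m ∈ discFun '' (M : Set H2) := ⟨m, hm, rfl⟩
      rw [h] at h1
      obtain ⟨x, hx, hxm⟩ := h1
      refine ⟨comp ψ.symm x, (hker x).mp hx, (hconv m _).mpr ?_⟩
      rw [comp_comp_symm]
      exact hxm
    · rintro ⟨f, hf, hfm⟩
      have h1 : discFun m ∈ discFun '' (M : Set H2) := by
        rw [h]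
        refine ⟨comp ψ f, (hker _).mpr ?_, (hconv m f).mp hfm⟩
        rwa [comp_symm_comp]
      obtain ⟨x, hx, hxm⟩ := h1
      rwa [← discFun_injective hxm]
  · intro h
    ext F
    constructor
    · rintro ⟨m, hm, rfl⟩
      obtain ⟨f, hf, hfm⟩ := (h m).mp hm
      refine ⟨comp ψ f, (hker _).mpr ?_, (hconv m f).mp hfm⟩
      rwa [comp_symm_comp]
    · rintro ⟨x, hx, rfl⟩
      have hf := (hker x).mp hx
      obtain ⟨g, hg, -⟩ := hu _ hf
      have hm : ∀ z, discFun (comp ψ.symm (comp ψ g)) z =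
          discFun u z * discFun (comp ψ.symm x) z := by
        rw [comp_symm_comp]
        exact hg
      refine ⟨comp ψ g, (h _).mpr ⟨_, hf, hm⟩, ?_⟩
      have := (hconv _ _).mp hm
      rw [comp_comp_symm] at this
      exact this.symm

theorem isClosed_modelSpace (θ : Linf) : IsClosed (modelSpace θ : Set H2) :=
  (Submodule.isClosed_orthogonal _).preimage H2.subtypeL.continuous

/-- Multiplication by u is an isometry of the complete space K_θ, so its range is closed; M is the
preimage of that range under composition with ψ⁻¹. -/
theorem isClosed_of_hasForm {ψ : DiscAut} {θ : Linf} {u : H2} {M : Submodule ℂ H2}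
    (hu : IsIsometricMultiplier u (modelSpace θ)) (h : HasForm ψ θ u M) :
    IsClosed (M : Set H2) := by
  rw [hasForm_iff hu] at h
  choose! V hV hn using hu
  let W : modelSpace θ →ₗᵢ[ℂ] H2 :=
    { toFun := fun f => V f
      map_add' := fun f g => discFun_injective (funext fun z => by
        rw [discFun_add, hV _ (f + g).2, hV _ f.2, hV _ g.2, Submodule.coe_add, discFun_add,
          mul_add])
      map_smul' := fun c f => discFun_injective (funext fun z => by
        rw [RingHom.id_apply, discFun_smul, hV _ (c • f).2, hV _ f.2, Submodule.coe_smul,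
          discFun_smul, mul_left_comm])
      norm_map' := fun f => hn _ f.2 }
  have : CompleteSpace (modelSpace θ) := (isClosed_modelSpace θ).completeSpace_coe
  have hcl : IsClosed (Set.range W) := W.isometry.isClosedEmbedding.isClosed_range
  have hM : (M : Set H2) = comp ψ.symm ⁻¹' Set.range W := by
    ext m
    rw [SetLike.mem_coe, h]
    constructor
    · rintro ⟨f, hf, hfm⟩
      exact ⟨⟨f, hf⟩, discFun_injective (funext fun z => (hV f hf z).trans (hfm z).symm)⟩
    · rintro ⟨f, hf⟩
      exact ⟨f, f.2, fun z => by rw [← hf]; exact hV f f.2 z⟩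
  rw [hM]
  exact hcl.preimage (comp ψ.symm).continuous

instance : ConnectedSpace 𝔻 := by
  have h : IsConnected (Metric.ball (0 : ℂ) 1) :=
    (convex_ball 0 1).isConnected ⟨0, by simp⟩
  exact isConnected_iff_connectedSpace.mp h

instance : Nontrivial 𝔻 :=
  ⟨⟨0, UnitDisc.mk (1 / 2) (by norm_num), fun h => by
    have := congrArg (fun z : 𝔻 => (z : ℂ)) h
    norm_num at this⟩⟩

instance : T2Space 𝔻 := UnitDisc.isEmbedding_coe.t2Space

theorem onDisc_eq_zero_iff (ψ : DiscAut) (z : 𝔻) : ψ.onDisc z = 0 ↔ z = ψ.a := by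
  constructor
  · intro h
    rw [← onDisc_symm_onDisc ψ z, h, ← ψ.onDisc_a, onDisc_symm_onDisc]
  · rintro rfl
    exact ψ.onDisc_a

/-- From χx = (u ∘ ψ)h and u(ψ(a)) ≠ 0, the zero of χ at a must be a zero of h. Write h = χg;
kernels of Toeplitz operators allow this division, so x = (u ∘ ψ)g. -/
theorem mem_of_toeplitz_mem_of_hasForm {ψ χ : DiscAut} {θ : Linf} {u : H2} {M : Submodule ℂ H2}
    (hu : IsIsometricMultiplier u (modelSpace θ)) (h : HasForm ψ θ u M)
    (h0 : discFun u (ψ.onDisc χ.a) ≠ 0) (x : H2)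
    (hx : toeplitz (contSymbol χ.boundary) x ∈ M) : x ∈ M := by
  rw [hasForm_iff hu] at h
  obtain ⟨f, hf, hfx⟩ := (h _).mp hx
  have hfx' : ∀ z, (χ.onDisc z : ℂ) * discFun x z =
      discFun u (ψ.onDisc z) * discFun (comp ψ f) z := fun z => by
    have := hfx (ψ.onDisc z)
    rwa [discFun_comp, onDisc_symm_onDisc, χ.discFun_toeplitz_boundary, ← discFun_comp ψ f] at this
  have hf0 : discFun (comp ψ f) χ.a = 0 := by
    have := hfx' χ.a
    rw [χ.onDisc_a, UnitDisc.coe_zero, zero_mul] at this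
    exact (mul_eq_zero.mp this.symm).resolve_left h0
  obtain ⟨g, hg⟩ := exists_toeplitz_eq hf0
  have hgker : comp ψ.symm g ∈ modelSpace θ := by
    rw [← mem_ker_kernelSymbol]
    refine toeplitz_eq_zero_of_mul (ψ := χ) ?_
    rw [hg, mem_ker_kernelSymbol, comp_symm_comp]
    exact hf
  have hxg : discFun x = fun z => discFun u (ψ.onDisc z) * discFun g z := by
    have hc : Continuous ψ.onDisc := by
      rw [UnitDisc.isEmbedding_coe.continuous_iff]
      change Continuous fun z : 𝔻 => ψ.toFun z
      unfold DiscAut.toFun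
      exact Continuous.div
        (continuous_const.mul (continuous_const.sub UnitDisc.continuous_coe))
        (continuous_const.sub (continuous_const.mul UnitDisc.continuous_coe))
        fun z => DiscAut.denom_ne_zero ψ.a z.norm_lt_one.le
    -- Cancelling χ is possible off its zero; continuity extends the identity to that point.
    refine Continuous.ext_on (dense_compl_singleton χ.a) (continuous_discFun x)
      (((continuous_discFun u).comp hc).mul (continuous_discFun g)) fun z hz => ?_
    have hz' : (χ.onDisc z : ℂ) ≠ 0 := fun h => hz
      ((onDisc_eq_zero_iff χ z).mp (UnitDisc.coe_eq_zero.mp h))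
    refine mul_left_cancel₀ hz' ?_
    rw [hfx', ← hg, χ.discFun_toeplitz_boundary]
    ring
  refine (h x).mpr ⟨_, hgker, fun z => ?_⟩
  rw [discFun_comp, hxg, discFun_comp]
  simp only [onDisc_onDisc_symm]

/-! ### Near invariance under a single operator -/

/-- An element of N vanishing at 0 can be divided by z inside N, and the quotient vanishes at 0
again; iterating kills every coefficient. -/
theorem eq_bot_of_coeff_zero {N : Submodule ℂ H2} (hN : ∀ h, shift h ∈ N → h ∈ N)
    (h0 : ∀ f ∈ N, coeff (f : L2) 0 = 0) : N = ⊥ := by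
  rw [Submodule.eq_bot_iff]
  have key : ∀ n : ℕ, ∀ f ∈ N, coeff (f : L2) n = 0 := by
    intro n
    induction n with
    | zero => exact_mod_cast h0
    | succ n ih =>
      intro f hf
      rw [← coeff_bshift]
      refine ih _ (hN _ ?_)
      rwa [shift_bshift (h0 f hf)]
  intro f hf
  refine H2_ext fun n => ?_
  rw [key n f hf, coeff_H2_zero]

theorem shift_mem_comap {M : Submodule ℂ H2} {ψ : DiscAut}
    (hM : ∀ h, toeplitz (contSymbol ψ.boundary) h ∈ M → h ∈ M) (h : H2)
    (hh : shift h ∈ M.comap (comp ψ : H2 →ₗ[ℂ] H2)) : h ∈ M.comap (comp ψ : H2 →ₗ[ℂ] H2) := by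
  rw [Submodule.mem_comap] at hh ⊢
  refine hM _ ?_
  have := comp_shift ψ h
  exact this ▸ hh

/-- Moving the zero of ψ to the origin reduces this to `eq_bot_of_coeff_zero`. It is the source of
the nonvanishing conditions on u. -/
theorem exists_discFun_ne_zero {M : Submodule ℂ H2} (hne : M ≠ ⊥) {ψ : DiscAut}
    (hM : ∀ h, toeplitz (contSymbol ψ.boundary) h ∈ M → h ∈ M) :
    ∃ f ∈ M, discFun f ψ.a ≠ 0 := by
  by_contra! hcon
  refine hne ?_
  have h := eq_bot_of_coeff_zero (shift_mem_comap hM) fun f hf => by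
    rw [← discFun_at_zero, ← ψ.onDisc_a, ← discFun_comp]
    exact hcon _ hf
  rw [Submodule.eq_bot_iff]
  intro f hf
  have h1 : comp ψ.symm f ∈ M.comap (comp ψ : H2 →ₗ[ℂ] H2) := by
    rw [Submodule.mem_comap]
    change comp ψ (comp ψ.symm f) ∈ M
    rwa [comp_comp_symm]
  rw [h, Submodule.mem_bot] at h1
  rw [← comp_comp_symm ψ f, h1, map_zero]

/-! ### Invariant subspaces of the backward shift -/

theorem inner_H2_symm (f g : H2) : inner ℂ f g = conj (inner ℂ g f) :=
  (inner_conj_symm f g).symm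

theorem coeFn_shift_pow (n : ℕ) (f : H2) :
    (((shift ^ n) f : H2) : L2) =ᵐ[arc] fun ζ => (ζ : ℂ) ^ n * (f : L2) ζ := by
  induction n with
  | zero => exact Filter.Eventually.of_forall fun ζ => by simp
  | succ n ih =>
    filter_upwards [ih, coeFn_shift ((shift ^ n) f)] with ζ h1 h2
    rw [pow_succ', mul_apply_eq_comp, h2, h1, pow_succ']
    ring

theorem inner_shift_pow (n : ℕ) (f g : H2) :
    inner ℂ ((shift ^ n) f) g = coeff (fun ζ => conj ((f : L2) ζ) * (g : L2) ζ) n := by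
  rw [Submodule.coe_inner, L2.inner_def, coeff]
  refine integral_congr_ae ?_
  filter_upwards [coeFn_shift_pow n f] with ζ h1
  rw [h1, RCLike.inner_apply, map_mul, map_pow, ← Circle.coe_inv_eq_conj, Circle.coe_inv,
    zpow_neg, zpow_natCast, inv_pow]
  ring

theorem integrable_conj_mul (f g : L2) : Integrable (fun ζ => conj (f ζ) * g ζ) arc := by
  have h : MemLp (fun ζ => conj (f ζ)) 2 arc := (Lp.memLp f).star
  exact h.integrable_mul (Lp.memLp g)

theorem inner_shift_pow_right (n : ℕ) (f g : H2) :
    inner ℂ f ((shift ^ n) g) = coeff (fun ζ => conj ((f : L2) ζ) * (g : L2) ζ) (-n) := by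
  rw [inner_H2_symm, inner_shift_pow, ← neg_neg (n : ℤ), ← coeff_conj, neg_neg]
  refine coeff_congr (Filter.Eventually.of_forall fun ζ => ?_) _
  simp only [map_mul, conj_conj, mul_comm]

/-- Beurling's theorem, for the backward shift. -/
theorem exists_modelSpace_eq {K : Submodule ℂ H2} (hK : IsClosed (K : Set H2))
    (hinv : ∀ f ∈ K, bshift f ∈ K) : ∃ θ : Linf, (IsInner θ ∨ θ = 0) ∧ modelSpace θ = K := by
  have : CompleteSpace K := hK.completeSpace_coe
  have hE : ∀ e ∈ Kᗮ, shift e ∈ Kᗮ := fun e he k hk => by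
    rw [← ContinuousLinearMap.adjoint_inner_left]
    exact he _ (hinv k hk)
  by_cases hbot : Kᗮ = ⊥
  · refine ⟨0, Or.inr rfl, ?_⟩
    rw [Submodule.orthogonal_eq_bot_iff.mp hbot, eq_top_iff]
    intro f _
    rw [mem_modelSpace_iff]
    have : mulOp 0 = 0 := by
      rw [mulOp, map_zero]
    rw [this]
    exact H2.zero_mem
  let V : H2 →ₗᵢ[ℂ] H2 := ⟨(shift : H2 →ₗ[ℂ] H2), norm_shift⟩
  -- A wandering vector, orthogonal to z·Kᗮ. Without one, Kᗮ = z·Kᗮ, and infinite divisibility by z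
  -- would make Kᗮ zero.
  obtain ⟨w, hw, hw1, hworth⟩ : ∃ w ∈ Kᗮ, ‖w‖ = 1 ∧ ∀ e ∈ Kᗮ, inner ℂ (shift e) w = 0 := by
    let E₁ : Submodule ℂ H2 := Kᗮ.map V.toLinearMap
    have hE₁ : CompleteSpace E₁ := by
      have : CompleteSpace Kᗮ := (Submodule.isClosed_orthogonal K).completeSpace_coe
      exact (V.isComplete_map_iff.mpr
        (completeSpace_coe_iff_isComplete.mp this)).completeSpace_coe
    obtain ⟨w, hw, hw0, hworth⟩ : ∃ w ∈ Kᗮ, w ≠ 0 ∧ w ∈ E₁ᗮ := by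
      by_contra! hcon
      refine hbot (eq_bot_of_coeff_zero (fun h hh => ?_) fun f hf => ?_)
      all_goals
        have hsub : ∀ x ∈ Kᗮ, ∃ e ∈ Kᗮ, shift e = x := fun x hx => by
          obtain ⟨y, hy, z, hz, hyz⟩ := E₁.exists_add_mem_mem_orthogonal x
          obtain ⟨e, he, rfl⟩ := hy
          refine ⟨e, he, ?_⟩
          by_contra hne
          refine hcon z ?_ ?_ hz
          · have : z = x - shift e := by rw [hyz]; exact (add_sub_cancel_left _ _).symm
            rw [this]
            exact Submodule.sub_mem _ hx (hE e he)
          · rintro rfl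
            rw [add_zero] at hyz
            exact hne hyz.symm
      · obtain ⟨e, he, heh⟩ := hsub _ hh
        rwa [← V.injective (show V e = V h from heh)]
      · obtain ⟨e, -, rfl⟩ := hsub f hf
        exact coeff_shift_zero e
    have hn : (‖w‖ : ℂ) ≠ 0 := by exact_mod_cast norm_ne_zero_iff.mpr hw0
    refine ⟨(‖w‖ : ℂ)⁻¹ • w, Submodule.smul_mem _ _ hw, ?_, fun e he => ?_⟩
    · rw [norm_smul, norm_inv, Complex.norm_real, norm_norm]
      exact inv_mul_cancel₀ (norm_ne_zero_iff.mpr hw0)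
    · refine (inner_smul_right (𝕜 := ℂ) (shift e) w _).trans ?_
      rw [show inner ℂ (shift e) w = 0 from hworth _ (Submodule.mem_map_of_mem he), mul_zero]
  have hEpow : ∀ (n : ℕ), ∀ e ∈ Kᗮ, (shift ^ n) e ∈ Kᗮ := fun n e he => by
    induction n with
    | zero => simpa using he
    | succ n ih => rw [pow_succ', mul_apply_eq_comp]; exact hE _ ih
  have horth : ∀ n : ℕ, ∀ e ∈ Kᗮ, inner ℂ ((shift ^ (n + 1)) e) w = 0 := fun n e he => by
    rw [pow_succ', mul_apply_eq_comp]
    exact hworth _ (hEpow n e he)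
  -- Orthogonality of w to all zⁿw with n ≥ 1 says that |w|² has the Fourier coefficients of 1, so w
  -- is inner.
  have hcoe : ∀ n : ℤ, coeff (fun ζ => conj ((w : L2) ζ) * (w : L2) ζ) n =
      coeff (fun _ => 1) n := by
    have h1 : ∀ n : ℤ, coeff (fun _ => 1) n = if n = 0 then 1 else 0 := fun n => by
      simp only [coeff, mul_one, integral_zpow, neg_eq_zero]
    intro n
    rw [h1]
    split_ifs with hn
    · rw [hn, ← Nat.cast_zero, ← inner_shift_pow, pow_zero, one_apply_eq_self,
        show inner ℂ w w = (‖w‖ : ℂ) ^ 2 from inner_self_eq_norm_sq_to_K w, hw1, ofReal_one,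
        one_pow]
    · rcases lt_or_gt_of_ne hn with hlt | hgt
      · obtain ⟨m, rfl⟩ : ∃ m : ℕ, n = -((m + 1 : ℕ) : ℤ) := ⟨(-n - 1).toNat, by omega⟩
        rw [← inner_shift_pow_right, inner_H2_symm, horth m w hw, map_zero]
      · obtain ⟨m, rfl⟩ : ∃ m : ℕ, n = ((m + 1 : ℕ) : ℤ) := ⟨(n - 1).toNat, by omega⟩
        rw [← inner_shift_pow, horth m w hw]
  have hunit : ∀ᵐ ζ ∂arc, ‖(w : L2) ζ‖ = 1 := by
    filter_upwards [ae_eq_of_coeff_eq (integrable_conj_mul w w) (integrable_const 1) hcoe]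
      with ζ hζ
    rw [Complex.conj_mul'] at hζ
    have h2 : ‖(w : L2) ζ‖ ^ 2 = 1 := by exact_mod_cast hζ
    exact (pow_eq_one_iff_of_nonneg (norm_nonneg _) two_ne_zero).mp h2
  have hmem : MemLp (w : L2) ∞ arc := memLp_top_of_bound (Lp.aestronglyMeasurable _) 1
    (hunit.mono fun ζ hζ => hζ.le)
  let θ : Linf := hmem.toLp _
  have hθ : (θ : Circle → ℂ) =ᵐ[arc] (w : L2) := MemLp.coeFn_toLp hmem
  have hmon_eq : ∀ n : ℕ, mulOp θ (hmon n : H2) = (((shift ^ n) w : H2) : L2) := fun n => by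
    refine Lp.ext ?_
    filter_upwards [coeFn_mulOp θ (hmon n : H2), hθ, coeFn_monomial n, coeFn_shift_pow n w]
      with ζ h1 h2 h3 h4
    rw [h1, h2, h4]
    change _ * (monomial n : L2) ζ = _
    rw [h3, zpow_natCast, mul_comm]
  have hmodel : ∀ f : H2, f ∈ modelSpace θ ↔ ∀ n : ℕ, inner ℂ ((shift ^ n) w) f = 0 := by
    intro f
    constructor
    · intro hf n
      rw [Submodule.coe_inner, ← hmon_eq]
      exact hf _ (Submodule.mem_map_of_mem (hmon n).2)
    · rintro hf _ ⟨e, he, rfl⟩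
      have hs := (innerSL ℂ (f : L2)).hasSum
        (((mulOp θ).comp H2.subtypeL).hasSum (hasSum_hmon ⟨e, he⟩))
      refine inner_eq_zero_symm.mp (hs.unique ?_)
      convert hasSum_zero with m
      rw [map_smul, map_smul, ContinuousLinearMap.comp_apply, Submodule.subtypeL_apply, hmon_eq,
        innerSL_apply_apply, ← Submodule.coe_inner, inner_H2_symm, hf, map_zero, smul_zero]
  refine ⟨θ, Or.inl ⟨fun n hn => ?_, ?_⟩, ?_⟩
  · rw [coeff_congr hθ]
    exact w.2 n hn
  · filter_upwards [hunit, hθ] with ζ h1 h2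
    rw [h2, h1]
  · have hle : K ≤ modelSpace θ := fun f hf => (hmodel f).mpr fun n => by
      rw [inner_H2_symm, hEpow n w hw f hf, map_zero]
    refine le_antisymm (fun f hf => ?_) hle
    obtain ⟨k, hk, e, he, rfl⟩ := K.exists_add_mem_mem_orthogonal f
    have he' : e ∈ modelSpace θ := by
      have := Submodule.sub_mem _ hf (hle hk)
      rwa [add_sub_cancel_left] at this
    -- For e ∈ Kᗮ ∩ K_θ, negative coefficients of conj(w)e vanish because w ⊥ z·Kᗮ, the others
    -- because e ⊥ θH². Unimodularity of w then gives e = 0.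
    have hz : (fun ζ => conj ((w : L2) ζ) * (e : L2) ζ) =ᵐ[arc] 0 := by
      refine ae_eq_zero_of_coeff_eq_zero (integrable_conj_mul w e) fun n => ?_
      rcases lt_or_ge n 0 with hlt | hge
      · obtain ⟨m, rfl⟩ : ∃ m : ℕ, n = -((m + 1 : ℕ) : ℤ) := ⟨(-n - 1).toNat, by omega⟩
        rw [← inner_shift_pow_right, inner_H2_symm, horth m e he, map_zero]
      · lift n to ℕ using hge
        rw [← inner_shift_pow, (hmodel e).mp he']
    have : e = 0 := by
      refine Subtype.ext (Lp.ext ?_)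
      filter_upwards [hz, hunit, Lp.coeFn_zero ℂ 2 arc] with ζ h1 h2 h3
      rw [Submodule.coe_zero, h3]
      refine (mul_eq_zero.mp h1).resolve_left ?_
      rw [map_eq_zero, ← norm_eq_zero, h2]
      exact one_ne_zero
    rw [this, add_zero]
    exact hk

/-! ### Power series on the circle -/

theorem hasSum_of_eq {f g : ℕ → ℂ} {s : ℂ} (h : ∀ n, f n = g n) (hf : HasSum f s) : HasSum g s :=
  funext h ▸ hf

theorem summable_sq_of_summable_norm {a : ℕ → ℂ} (ha : Summable fun n => ‖a n‖) :
    Summable fun n => ‖a n‖ ^ 2 := by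
  refine Summable.of_norm_bounded_eventually_nat ha ?_
  filter_upwards [ha.tendsto_atTop_zero.eventually_le_const (zero_lt_one)] with n hn
  rw [norm_pow, norm_norm, sq]
  exact mul_le_of_le_one_left (norm_nonneg _) hn

/-- Applied below to dilations ζ ↦ F(rζ) with r < 1, whose series converge uniformly on the circle;
Parseval and the mean value property follow for them. -/
theorem exists_H2_of_hasSum {a : ℕ → ℂ} (ha : Summable fun n => ‖a n‖) {F : Circle → ℂ}
    (hF : ∀ ζ : Circle, HasSum (fun n => a n * (ζ : ℂ) ^ n) (F ζ)) :
    ∃ h : H2, (h : L2) =ᵐ[arc] F ∧ ∀ n : ℕ, coeff (h : L2) n = a n := by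
  let mono : ℕ → C(Circle, ℂ) := fun n =>
    ⟨fun ζ : Circle => (ζ : ℂ) ^ (n : ℤ), continuous_circle_zpow n⟩
  have hmono : ∀ n, ‖mono n‖ ≤ 1 := fun n => by
    refine (ContinuousMap.norm_le _ zero_le_one).mpr fun ζ => ?_
    change ‖(ζ : ℂ) ^ (n : ℤ)‖ ≤ 1
    rw [norm_zpow, Circle.norm_coe, one_zpow]
  have hsum : Summable fun n => a n • mono n := Summable.of_norm_bounded ha fun n => by
    rw [norm_smul]
    exact mul_le_of_le_one_right (norm_nonneg _) (hmono n)
  obtain ⟨Φ, hΦ⟩ := hsum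
  have hΦF : ∀ ζ, Φ ζ = F ζ := fun ζ => by
    have h := (ContinuousMap.evalCLM ℂ ζ).hasSum hΦ
    refine h.unique ?_
    simpa [mono] using hF ζ
  let h : H2 := ofCoeff a (summable_sq_of_summable_norm ha)
  have hh : ∀ n : ℕ, coeff (h : L2) n = a n := coeff_ofCoeff a _
  refine ⟨h, ?_, hh⟩
  have h1 := (ContinuousMap.toLp (E := ℂ) 2 arc ℂ).hasSum hΦ
  have h2 := H2.subtypeL.hasSum (hasSum_hmon h)
  have h3 : (h : L2) = ContinuousMap.toLp (E := ℂ) 2 arc ℂ Φ := by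
    refine h2.unique ?_
    convert h1 using 2 with n
    rw [map_smul, map_smul, hh]
    rfl
  rw [h3]
  filter_upwards [coeFn_toLp_two Φ] with ζ hζ
  rw [hζ, hΦF]

theorem hasSum_integral_conj_mul {a b : ℕ → ℂ} (ha : Summable fun n => ‖a n‖)
    (hb : Summable fun n => ‖b n‖) {F G : Circle → ℂ}
    (hF : ∀ ζ : Circle, HasSum (fun n => a n * (ζ : ℂ) ^ n) (F ζ))
    (hG : ∀ ζ : Circle, HasSum (fun n => b n * (ζ : ℂ) ^ n) (G ζ)) :
    HasSum (fun n => conj (a n) * b n) (∫ ζ, conj (F ζ) * G ζ ∂arc) := by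
  obtain ⟨f, hf, hfa⟩ := exists_H2_of_hasSum ha hF
  obtain ⟨g, hg, hgb⟩ := exists_H2_of_hasSum hb hG
  have h := hasSum_inner f g
  simp only [hfa, hgb] at h
  convert h using 1
  rw [Submodule.coe_inner, L2.inner_def]
  refine integral_congr_ae ?_
  filter_upwards [hf, hg] with ζ h1 h2
  rw [RCLike.inner_apply, h1, h2, mul_comm]

theorem integral_mul_eq {a b : ℕ → ℂ} (ha : Summable fun n => ‖a n‖)
    (hb : Summable fun n => ‖b n‖) {F G : Circle → ℂ}
    (hF : ∀ ζ : Circle, HasSum (fun n => a n * (ζ : ℂ) ^ n) (F ζ))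
    (hG : ∀ ζ : Circle, HasSum (fun n => b n * (ζ : ℂ) ^ n) (G ζ)) :
    ∫ ζ, F ζ * G ζ ∂arc = a 0 * b 0 := by
  obtain ⟨f, hf, hfa⟩ := exists_H2_of_hasSum ha hF
  obtain ⟨g, hg, hgb⟩ := exists_H2_of_hasSum hb hG
  have h := coeff_mul_nat f g 0
  rw [Finset.range_one, Finset.sum_singleton, Nat.sub_zero, hfa, hgb, mul_comm] at h
  rw [← h, coeff]
  refine integral_congr_ae ?_
  filter_upwards [hf, hg] with ζ h1 h2
  simp [h1, h2]

theorem continuous_of_hasSum {a : ℕ → ℂ} (ha : Summable fun n => ‖a n‖) {F : Circle → ℂ}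
    (hF : ∀ ζ : Circle, HasSum (fun n => a n * (ζ : ℂ) ^ n) (F ζ)) : Continuous F := by
  have : F = fun ζ : Circle => ∑' n, a n * (ζ : ℂ) ^ n := funext fun ζ => (hF ζ).tsum_eq.symm
  rw [this]
  refine continuous_tsum (fun n => ?_) ha fun n ζ => ?_
  · exact continuous_const.mul (continuous_subtype_val.pow n)
  · rw [norm_mul, norm_pow, Circle.norm_coe, one_pow, mul_one]

theorem integrable_of_continuous {F : Circle → ℂ} (hF : Continuous F) : Integrable F arc :=
  integrable_continuousMap ⟨F, hF⟩

theorem integral_sub_of_continuous {F G : Circle → ℂ} (hF : Continuous F) (hG : Continuous G) :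
    ∫ ζ, (F ζ - G ζ) ∂arc = ∫ ζ, F ζ ∂arc - ∫ ζ, G ζ ∂arc :=
  integral_sub (integrable_of_continuous hF) (integrable_of_continuous hG)

theorem integral_add_of_continuous {F G : Circle → ℂ} (hF : Continuous F) (hG : Continuous G) :
    ∫ ζ, (F ζ + G ζ) ∂arc = ∫ ζ, F ζ ∂arc + ∫ ζ, G ζ ∂arc :=
  integral_add (integrable_of_continuous hF) (integrable_of_continuous hG)

theorem integral_eq_of_hasSum {a : ℕ → ℂ} (ha : Summable fun n => ‖a n‖) {F : Circle → ℂ}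
    (hF : ∀ ζ : Circle, HasSum (fun n => a n * (ζ : ℂ) ^ n) (F ζ)) : ∫ ζ, F ζ ∂arc = a 0 := by
  obtain ⟨f, hf, hfa⟩ := exists_H2_of_hasSum ha hF
  have := hfa 0
  rw [coeff_congr hf, coeff] at this
  simpa using this

theorem integral_norm_sq_of_hasSum {a : ℕ → ℂ} (ha : Summable fun n => ‖a n‖) {F : Circle → ℂ}
    (hF : ∀ ζ : Circle, HasSum (fun n => a n * (ζ : ℂ) ^ n) (F ζ)) :
    HasSum (fun n => ‖a n‖ ^ 2) (∫ ζ, ‖F ζ‖ ^ 2 ∂arc) := by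
  have h := hasSum_integral_conj_mul ha ha hF hF
  simp only [Complex.conj_mul', ← Complex.ofReal_pow] at h
  have h2 : ∫ ζ : Circle, ((‖F ζ‖ ^ 2 : ℝ) : ℂ) ∂arc = ((∫ ζ : Circle, ‖F ζ‖ ^ 2 ∂arc : ℝ) : ℂ) :=
    integral_ofReal
  rw [h2] at h
  exact Complex.hasSum_ofReal.mp h

/-! ### Resolvents of contractions -/

section Contraction

variable {X : Type*} [NormedAddCommGroup X] [InnerProductSpace ℂ X]

theorem norm_pow_apply_le {R : X →L[ℂ] X} (hR : ∀ x, ‖R x‖ ≤ ‖x‖) (n : ℕ) (x : X) :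
    ‖(R ^ n) x‖ ≤ ‖x‖ := by
  induction n with
  | zero => simp
  | succ n ih => rw [pow_succ', mul_apply_eq_comp]; exact (hR _).trans ih

/-- The vector `(1 - w R)⁻¹ x = ∑ wⁿ Rⁿ x`. -/
noncomputable def resolv (R : X →L[ℂ] X) (x : X) (w : ℂ) : X := ∑' n : ℕ, w ^ n • (R ^ n) x

theorem summable_smul_pow [CompleteSpace X] {R : X →L[ℂ] X} (hR : ∀ x, ‖R x‖ ≤ ‖x‖) (x : X) {a : ℕ → ℂ}
    (ha : Summable fun n => ‖a n‖) : Summable fun n : ℕ => a n • (R ^ n) x := by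
  refine Summable.of_norm_bounded (ha.mul_right ‖x‖) fun n => ?_
  rw [norm_smul]
  exact mul_le_mul_of_nonneg_left (norm_pow_apply_le hR n x) (norm_nonneg _)

theorem hasSum_resolv [CompleteSpace X] {R : X →L[ℂ] X} (hR : ∀ x, ‖R x‖ ≤ ‖x‖) (x : X) {w : ℂ} (hw : ‖w‖ < 1) :
    HasSum (fun n : ℕ => w ^ n • (R ^ n) x) (resolv R x w) := by
  refine (summable_smul_pow hR x ?_).hasSum
  simpa only [norm_pow] using summable_geometric_of_lt_one (norm_nonneg w) hw

theorem resolv_eq [CompleteSpace X] {R : X →L[ℂ] X} (hR : ∀ x, ‖R x‖ ≤ ‖x‖) (x : X) {w : ℂ} (hw : ‖w‖ < 1) :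
    resolv R x w = x + w • R (resolv R x w) := by
  have h := hasSum_resolv hR x hw
  have h1 := (R.hasSum h).const_smul w
  rw [← hasSum_nat_add_iff' 1] at h
  have h2 := h.unique (a₂ := w • R (resolv R x w)) (by
    convert h1 using 2 with n
    rw [map_smul, smul_smul, pow_succ', pow_succ', mul_apply_eq_comp])
  rw [← h2]
  simp

theorem hasSum_inner_resolv [CompleteSpace X] {R : X →L[ℂ] X} (hR : ∀ x, ‖R x‖ ≤ ‖x‖) (y x : X) {w : ℂ}
    (hw : ‖w‖ < 1) :
    HasSum (fun n : ℕ => inner ℂ y ((R ^ n) x) * w ^ n) (inner ℂ y (resolv R x w)) := by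
  have h := (innerSL ℂ y).hasSum (hasSum_resolv hR x hw)
  simpa only [map_smul, smul_eq_mul, innerSL_apply_apply, mul_comm] using h

theorem norm_smul_circle_lt {r : ℝ} (hr0 : 0 ≤ r) (hr1 : r < 1) (ζ : Circle) :
    ‖(r : ℂ) * ζ‖ < 1 := by
  rw [norm_mul, Circle.norm_coe, mul_one, Complex.norm_real, Real.norm_of_nonneg hr0]
  exact hr1

theorem hasSum_dilate {a : ℕ → ℂ} {F : ℂ → ℂ} {r : ℝ} (hr0 : 0 ≤ r) (hr1 : r < 1)
    (h : ∀ w : ℂ, ‖w‖ < 1 → HasSum (fun n => a n * w ^ n) (F w)) (ζ : Circle) :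
    HasSum (fun n => (a n * (r : ℂ) ^ n) * (ζ : ℂ) ^ n) (F (r * ζ)) := by
  simpa only [mul_pow, ← mul_assoc] using h _ (norm_smul_circle_lt hr0 hr1 ζ)

theorem summable_dilate {a : ℕ → ℂ} {F : ℂ → ℂ} {r : ℝ} (hr0 : 0 ≤ r) (hr1 : r < 1)
    (h : ∀ w : ℂ, ‖w‖ < 1 → HasSum (fun n => a n * w ^ n) (F w)) :
    Summable fun n => ‖a n * (r : ℂ) ^ n‖ := by
  refine (h r ?_).summable.norm
  rw [Complex.norm_real, Real.norm_of_nonneg hr0]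
  exact hr1

/-- ⟨x,y⟩ − ⟨Tx,Ty⟩ is a nonnegative form, so its diagonal controls it: apply contractivity to x −
cy with c unimodular and chosen to make the cross term positive. -/
theorem norm_form_le {T : X →L[ℂ] X} (hT : ∀ x, ‖T x‖ ≤ ‖x‖) (x y : X) :
    2 * ‖inner ℂ x y - inner ℂ (T x) (T y)‖ ≤
      (‖x‖ ^ 2 - ‖T x‖ ^ 2) + (‖y‖ ^ 2 - ‖T y‖ ^ 2) := by
  set s := inner ℂ x y - inner ℂ (T x) (T y) with hs
  obtain ⟨c, hc1, hcs⟩ : ∃ c : ℂ, ‖c‖ = 1 ∧ c * s = ‖s‖ := by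
    by_cases h0 : s = 0
    · exact ⟨1, norm_one, by simp [h0]⟩
    · have hn : (‖s‖ : ℂ) ≠ 0 := by exact_mod_cast norm_ne_zero_iff.mpr h0
      refine ⟨conj s / ‖s‖, ?_, ?_⟩
      · rw [norm_div, norm_conj, Complex.norm_real, norm_norm]
        exact div_self (norm_ne_zero_iff.mpr h0)
      · rw [div_mul_eq_mul_div, Complex.conj_mul', sq, mul_div_assoc, div_self hn, mul_one]
  have h1 := hT (x - c • y)
  have h2 := @norm_sub_sq ℂ X _ _ _ x (c • y)
  have h3 := @norm_sub_sq ℂ X _ _ _ (T x) (T (c • y))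
  rw [← map_sub] at h3
  have h4 : RCLike.re (inner ℂ x (c • y)) - RCLike.re (inner ℂ (T x) (T (c • y))) = ‖s‖ := by
    rw [← map_sub, map_smul, inner_smul_right, inner_smul_right, ← mul_sub, ← hs, hcs]
    simp
  have h5 : ‖T (x - c • y)‖ ^ 2 ≤ ‖x - c • y‖ ^ 2 := by gcongr
  rw [norm_smul, hc1, one_mul] at h2
  rw [map_smul, norm_smul, hc1, one_mul, ← map_smul] at h3
  linarith

/-- Uses wRF = F − x for F = (1−wR)⁻¹x. The left side is a nonnegative form; the right side is an
operator Poisson kernel, the sum of an analytic and a conjugate analytic part in w. -/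
theorem inner_resolv_form [CompleteSpace X] {R : X →L[ℂ] X} (hR : ∀ x, ‖R x‖ ≤ ‖x‖) (x y : X) {w : ℂ}
    (hw : ‖w‖ < 1) :
    inner ℂ (resolv R x w) (resolv R y w) -
      inner ℂ ((w • R) (resolv R x w)) ((w • R) (resolv R y w)) =
    inner ℂ x (resolv R y w) + (inner ℂ (resolv R x w) y - inner ℂ x y) := by
  have h1 : (w • R) (resolv R x w) = resolv R x w - x :=
    eq_sub_of_add_eq' (resolv_eq hR x hw).symm
  have h2 : (w • R) (resolv R y w) = resolv R y w - y :=
    eq_sub_of_add_eq' (resolv_eq hR y hw).symm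
  rw [h1, h2]
  simp only [inner_sub_left, inner_sub_right]
  ring

theorem norm_sq_resolv [CompleteSpace X] {R : X →L[ℂ] X} (hR : ∀ x, ‖R x‖ ≤ ‖x‖) (x : X) {w : ℂ}
    (hw : ‖w‖ < 1) :
    ‖resolv R x w‖ ^ 2 - ‖(w • R) (resolv R x w)‖ ^ 2 =
      2 * (inner ℂ x (resolv R x w)).re - ‖x‖ ^ 2 := by
  have hn : ∀ y : X, (inner ℂ y y).re = ‖y‖ ^ 2 := fun y => inner_self_eq_norm_sq (𝕜 := ℂ) y
  have h := congrArg Complex.re (inner_resolv_form hR x x hw)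
  rw [← inner_conj_symm (resolv R x w) x] at h
  simp only [Complex.sub_re, Complex.add_re, Complex.conj_re, hn] at h
  linarith

theorem continuous_inner_resolv [CompleteSpace X] {R : X →L[ℂ] X} (hR : ∀ x, ‖R x‖ ≤ ‖x‖)
    (y x : X) {r : ℝ} (hr0 : 0 ≤ r) (hr1 : r < 1) :
    Continuous fun ζ : Circle => inner ℂ y (resolv R x (r * ζ)) :=
  continuous_of_hasSum
    (summable_dilate hr0 hr1 fun _ hw => hasSum_inner_resolv hR y x hw)
    (hasSum_dilate hr0 hr1 fun _ hw => hasSum_inner_resolv hR y x hw)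

theorem integral_re_inner_resolv [CompleteSpace X] {R : X →L[ℂ] X} (hR : ∀ x, ‖R x‖ ≤ ‖x‖)
    (x : X) {r : ℝ} (hr0 : 0 ≤ r) (hr1 : r < 1) :
    ∫ ζ : Circle, (2 * (inner ℂ x (resolv R x (r * ζ))).re - ‖x‖ ^ 2) ∂arc = ‖x‖ ^ 2 := by
  have hi := integrable_of_continuous (continuous_inner_resolv hR x x hr0 hr1)
  have h1 : ∫ ζ : Circle, (inner ℂ x (resolv R x (r * ζ))).re ∂arc = ‖x‖ ^ 2 := by
    have h := integral_eq_of_hasSum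
      (summable_dilate hr0 hr1 fun _ hw => hasSum_inner_resolv hR x x hw)
      (hasSum_dilate hr0 hr1 fun _ hw => hasSum_inner_resolv hR x x hw)
    refine (integral_re hi).trans ?_
    rw [h]
    simp only [pow_zero, one_apply_eq_self, mul_one]
    exact inner_self_eq_norm_sq (𝕜 := ℂ) x
  have h2 := integral_sub (hi.re.const_mul 2) (integrable_const (μ := arc) (‖x‖ ^ 2))
  refine h2.trans ?_
  rw [integral_const_mul]
  simp only [RCLike.re_to_complex]
  rw [h1]
  simp
  ring

/-- A form of von Neumann's inequality. -/
theorem norm_tsum_smul_pow_le [CompleteSpace X] {R : X →L[ℂ] X} (hR : ∀ x, ‖R x‖ ≤ ‖x‖) {a : ℕ → ℂ}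
    (ha : Summable fun n => ‖a n‖) {F : Circle → ℂ}
    (hF : ∀ ζ : Circle, HasSum (fun n => a n * (ζ : ℂ) ^ n) (F ζ)) (hb : ∀ ζ, ‖F ζ‖ ≤ 1)
    {r : ℝ} (hr0 : 0 ≤ r) (hr1 : r < 1) (x : X) :
    ‖∑' n : ℕ, (conj (a n) * (r : ℂ) ^ n) • (R ^ n) x‖ ≤ ‖x‖ := by
  have hs : Summable fun n => ‖conj (a n) * (r : ℂ) ^ n‖ := by
    refine Summable.of_nonneg_of_le (fun n => norm_nonneg _) (fun n => ?_) ha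
    rw [norm_mul, norm_conj, norm_pow, Complex.norm_real, Real.norm_of_nonneg hr0]
    exact mul_le_of_le_one_right (norm_nonneg _) (pow_le_one₀ hr0 hr1.le)
  set Y := ∑' n : ℕ, (conj (a n) * (r : ℂ) ^ n) • (R ^ n) x with hY
  have hYs : HasSum (fun n : ℕ => (conj (a n) * (r : ℂ) ^ n) • (R ^ n) x) Y :=
    (summable_smul_pow hR x hs).hasSum
  have key : ∀ y : X, 2 * ‖inner ℂ y Y‖ ≤ ‖y‖ ^ 2 + ‖x‖ ^ 2 := by
    intro y
    have hw := norm_smul_circle_lt hr0 hr1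
    have hd := fun p q : X => hasSum_dilate hr0 hr1 fun w hw => hasSum_inner_resolv hR p q hw
    have hds := fun p q : X => summable_dilate hr0 hr1 fun w hw => hasSum_inner_resolv hR p q hw
    have hcont := fun p q : X => continuous_of_hasSum (hds p q) (hd p q)
    have hFc := continuous_of_hasSum ha hF
    have h1 : ∫ ζ : Circle, conj (F ζ) * inner ℂ y (resolv R x (r * ζ)) ∂arc = inner ℂ y Y := by
      refine (hasSum_integral_conj_mul ha (hds y x) hF (hd y x)).unique ?_
      have := (innerSL ℂ y).hasSum hYs
      simp only [map_smul, smul_eq_mul, innerSL_apply_apply] at this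
      refine hasSum_of_eq (fun n => ?_) this
      ring
    -- The integrand is the conjugate of an analytic function vanishing at 0. Adding this part
    -- completes the kernel to the nonnegative form of `inner_resolv_form` without changing the
    -- integral.
    have h2 : ∫ ζ : Circle, conj (F ζ) * (inner ℂ (resolv R y (r * ζ)) x - inner ℂ y x) ∂arc
        = 0 := by
      have e1 : ∫ ζ : Circle, F ζ * inner ℂ x (resolv R y (r * ζ)) ∂arc = a 0 * inner ℂ x y := by
        simpa using integral_mul_eq ha (hds x y) hF (hd x y)
      have e2 := integral_eq_of_hasSum ha hF
      have e3 : ∀ ζ : Circle, conj (F ζ) * (inner ℂ (resolv R y (r * ζ)) x - inner ℂ y x) =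
          conj (F ζ * inner ℂ x (resolv R y (r * ζ)) - F ζ * inner ℂ x y) := fun ζ => by
        rw [← mul_sub, map_mul, map_sub, inner_conj_symm, inner_conj_symm]
      simp only [e3]
      rw [integral_conj, integral_sub_of_continuous
        (F := fun ζ : Circle => F ζ * inner ℂ x (resolv R y (r * ζ)))
        (G := fun ζ => F ζ * inner ℂ x y) (hFc.mul (hcont x y)) (hFc.mul continuous_const), e1,
        integral_mul_const, e2, sub_self, map_zero]
    have hc1 : Continuous fun ζ : Circle => inner ℂ (resolv R y (r * ζ)) x := by
      have := Complex.continuous_conj.comp (hcont x y)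
      refine this.congr fun ζ => ?_
      exact inner_conj_symm _ _
    have h3 : inner ℂ y Y = ∫ ζ : Circle, conj (F ζ) *
        (inner ℂ y (resolv R x (r * ζ)) + (inner ℂ (resolv R y (r * ζ)) x - inner ℂ y x)) ∂arc := by
      simp only [mul_add]
      rw [integral_add_of_continuous
        (F := fun ζ : Circle => conj (F ζ) * inner ℂ y (resolv R x (r * ζ)))
        (G := fun ζ : Circle => conj (F ζ) * (inner ℂ (resolv R y (r * ζ)) x - inner ℂ y x))
        ((Complex.continuous_conj.comp hFc).mul (hcont y x))
        ((Complex.continuous_conj.comp hFc).mul (hc1.sub continuous_const)), h1, h2, add_zero]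
    have hpos := fun (p : X) (w : ℂ) (hw : ‖w‖ < 1) => norm_sq_resolv hR p hw
    have hint := fun p : X => integral_re_inner_resolv hR p hr0 hr1
    have hb2 : ‖inner ℂ y Y‖ ≤ ∫ ζ : Circle, ((2 * (inner ℂ y (resolv R y (r * ζ))).re - ‖y‖ ^ 2) +
        (2 * (inner ℂ x (resolv R x (r * ζ))).re - ‖x‖ ^ 2)) / 2 ∂arc := by
      rw [h3]
      refine norm_integral_le_of_norm_le ?_ (Filter.Eventually.of_forall fun ζ => ?_)
      · have hi := fun p : X => (integrable_of_continuous (hcont p p)).re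
        exact ((((hi y).const_mul 2).sub (integrable_const _)).add
          (((hi x).const_mul 2).sub (integrable_const _))).div_const 2
      · rw [norm_mul, norm_conj]
        have hw1 : ∀ p, ‖(((r : ℂ) * ζ) • R) p‖ ≤ ‖p‖ := fun p => by
          change ‖((r : ℂ) * ζ) • R p‖ ≤ ‖p‖
          rw [norm_smul]
          exact (mul_le_of_le_one_left (norm_nonneg _) (hw ζ).le).trans (hR p)
        have := norm_form_le hw1 (resolv R y (r * ζ)) (resolv R x (r * ζ))
        rw [inner_resolv_form hR y x (hw ζ), hpos y _ (hw ζ), hpos x _ (hw ζ)] at this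
        have h5 := mul_le_of_le_one_left (norm_nonneg (inner ℂ y (resolv R x (r * ζ)) +
          (inner ℂ (resolv R y (r * ζ)) x - inner ℂ y x))) (hb ζ)
        linarith
    have hii := fun p : X => ((integrable_of_continuous (hcont p p)).re.const_mul 2).sub
      (integrable_const (μ := arc) (‖p‖ ^ 2))
    have hsplit := integral_add (hii y) (hii x)
    rw [integral_div] at hb2
    have h6 := hint x
    have h7 := hint y
    simp only [Pi.sub_apply, RCLike.re_to_complex] at hsplit
    rw [h6, h7] at hsplit
    rw [hsplit] at hb2
    linarith
  by_contra hlt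
  push Not at hlt
  have hY0 : 0 < ‖Y‖ := (norm_nonneg x).trans_lt hlt
  -- Scaling Y to norm ‖x‖ optimizes the bound and gives 2‖x‖‖Y‖ ≤ 2‖x‖².
  have h := key (((‖x‖ / ‖Y‖ : ℝ) : ℂ) • Y)
  rw [inner_smul_left, norm_mul, norm_conj, Complex.norm_real, norm_smul, Complex.norm_real,
    inner_self_eq_norm_sq_to_K, Real.norm_of_nonneg (by positivity), norm_pow] at h
  rw [div_mul_cancel₀ _ hY0.ne'] at h
  simp only [RCLike.norm_ofReal, abs_norm] at h
  have h8 : ‖x‖ / ‖Y‖ * ‖Y‖ ^ 2 = ‖x‖ * ‖Y‖ := by field_simp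
  rw [h8] at h
  rcases (norm_nonneg x).eq_or_lt with h0 | h0
  · have hx0 : x = 0 := norm_eq_zero.mp h0.symm
    rw [hY, hx0] at hY0
    simp at hY0
  · nlinarith

end Contraction

/-! ### Contractions with a rank-one defect -/

theorem re_one_add_ofReal_mul (t : ℝ) (z : ℂ) : (1 + t * z).re = 1 + t * z.re := by
  simp

section Defect

variable {X : Type*} [NormedAddCommGroup X] [InnerProductSpace ℂ X]

/-- `R` is a contraction whose defect operator `1 - R* R` is the projection onto `u`. -/
def RankOneDefect (R : X →L[ℂ] X) (u : X) : Prop :=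
  ∀ x, ‖x‖ ^ 2 = ‖inner ℂ u x‖ ^ 2 + ‖R x‖ ^ 2

variable {R : X →L[ℂ] X} {u : X}

theorem RankOneDefect.norm_le (h : RankOneDefect R u) (x : X) : ‖R x‖ ≤ ‖x‖ := by
  refine abs_le_of_sq_le_sq' ?_ (norm_nonneg _) |>.2
  rw [h x]
  exact le_add_of_nonneg_left (by positivity)

theorem RankOneDefect.sum_range (h : RankOneDefect R u) (x : X) (n : ℕ) :
    ∑ m ∈ Finset.range n, ‖inner ℂ u ((R ^ m) x)‖ ^ 2 + ‖(R ^ n) x‖ ^ 2 = ‖x‖ ^ 2 := by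
  induction n with
  | zero => simp
  | succ n ih =>
    rw [Finset.sum_range_succ, ← ih, h ((R ^ n) x), pow_succ' R, mul_apply_eq_comp, add_assoc]

theorem RankOneDefect.summable (h : RankOneDefect R u) (x : X) :
    Summable fun n : ℕ => ‖inner ℂ u ((R ^ n) x)‖ ^ 2 :=
  summable_of_sum_range_le (fun _ => by positivity) (c := ‖x‖ ^ 2) fun n => by
    rw [← h.sum_range x n]
    exact le_add_of_nonneg_right (by positivity)

/-- The map which sends `x` to the function with Taylor coefficients `⟨u, Rⁿ x⟩`. -/
noncomputable def RankOneDefect.symbol (h : RankOneDefect R u) : X →L[ℂ] H2 :=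
  LinearMap.mkContinuous
    { toFun := fun x => ofCoeff (fun n => inner ℂ u ((R ^ n) x)) (h.summable x)
      map_add' := fun x y => H2_ext fun n => by
        rw [coeff_H2_add, coeff_ofCoeff, coeff_ofCoeff, coeff_ofCoeff, map_add, inner_add_right]
      map_smul' := fun c x => H2_ext fun n => by
        rw [RingHom.id_apply, coeff_H2_smul, coeff_ofCoeff, coeff_ofCoeff, map_smul,
          inner_smul_right] } 1 fun x => by
    rw [one_mul]
    refine abs_le_of_sq_le_sq' ?_ (norm_nonneg _) |>.2
    refine (hasSum_norm_sq _).tsum_eq.symm.trans_le ?_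
    simp only [LinearMap.coe_mk, AddHom.coe_mk, coeff_ofCoeff]
    refine (h.summable x).tsum_le_of_sum_range_le fun n => ?_
    rw [← h.sum_range x n]
    exact le_add_of_nonneg_right (by positivity)

theorem RankOneDefect.coeff_symbol (h : RankOneDefect R u) (x : X) (n : ℕ) :
    coeff (h.symbol x : L2) n = inner ℂ u ((R ^ n) x) :=
  coeff_ofCoeff _ (h.summable x) n

theorem RankOneDefect.norm_symbol_le (h : RankOneDefect R u) (x : X) : ‖h.symbol x‖ ≤ ‖x‖ := by
  refine abs_le_of_sq_le_sq' ?_ (norm_nonneg _) |>.2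
  rw [← (hasSum_norm_sq _).tsum_eq]
  simp only [h.coeff_symbol]
  refine (h.summable x).tsum_le_of_sum_range_le fun n => ?_
  rw [← h.sum_range x n]
  exact le_add_of_nonneg_right (by positivity)

theorem RankOneDefect.bshift_symbol (h : RankOneDefect R u) (x : X) :
    bshift (h.symbol x) = h.symbol (R x) :=
  H2_ext fun n => by
    rw [coeff_bshift, h.coeff_symbol, h.coeff_symbol, pow_succ, mul_apply_eq_comp]

theorem RankOneDefect.symbol_pow (h : RankOneDefect R u) (n : ℕ) (x : X) :
    h.symbol ((R ^ n) x) = (bshift ^ n) (h.symbol x) := by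
  induction n with
  | zero => simp
  | succ n ih =>
    rw [pow_succ', pow_succ', mul_apply_eq_comp, mul_apply_eq_comp, ← h.bshift_symbol, ih]

theorem norm_bshift_le (k : H2) : ‖bshift k‖ ≤ ‖k‖ := by
  have h1 : ‖bshift‖ ≤ 1 := by
    rw [bshift, LinearIsometryEquiv.norm_map]
    exact ContinuousLinearMap.opNorm_le_bound _ zero_le_one fun f => by
      rw [norm_shift, one_mul]
  exact (bshift.le_opNorm k).trans (mul_le_of_le_one_left (norm_nonneg _) h1)

theorem RankOneDefect.symbol_resolv [CompleteSpace X] (h : RankOneDefect R u) (x : X) {w : ℂ} (hw : ‖w‖ < 1) :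
    h.symbol (resolv R x w) = resolv bshift (h.symbol x) w := by
  have h1 := h.symbol.hasSum (hasSum_resolv h.norm_le x hw)
  refine h1.unique ?_
  simp only [map_smul, h.symbol_pow]
  exact hasSum_resolv norm_bshift_le (h.symbol x) hw

/-- The form `⟨x, y⟩ - ⟨J x, J y⟩` where `J` is the symbol map. -/
noncomputable def RankOneDefect.form (h : RankOneDefect R u) (x y : X) : ℂ :=
  inner ℂ x y - inner ℂ (h.symbol x) (h.symbol y)

theorem RankOneDefect.form_self (h : RankOneDefect R u) (x : X) :
    h.form x x = ((‖x‖ ^ 2 - ‖h.symbol x‖ ^ 2 : ℝ) : ℂ) := by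
  rw [form, show inner ℂ (h.symbol x) (h.symbol x) = (‖h.symbol x‖ : ℂ) ^ 2 from
    inner_self_eq_norm_sq_to_K (𝕜 := ℂ) (h.symbol x), inner_self_eq_norm_sq_to_K (𝕜 := ℂ)]
  push_cast
  rfl

theorem norm_sq_bshift (k : H2) : ‖k‖ ^ 2 = ‖coeff (k : L2) 0‖ ^ 2 + ‖bshift k‖ ^ 2 := by
  have h := hasSum_norm_sq k
  rw [← hasSum_nat_add_iff' 1] at h
  have h2 := hasSum_norm_sq (bshift k)
  simp only [coeff_bshift] at h2
  have := h.unique h2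
  simp only [Finset.range_one, Finset.sum_singleton, Nat.cast_zero] at this
  linarith

/-- Passing to Rx, respectively to the backward shift of Jx, removes the same amount |⟨u,x⟩|² from
both squared norms. -/
theorem RankOneDefect.form_self_map (h : RankOneDefect R u) (x : X) :
    ‖R x‖ ^ 2 - ‖h.symbol (R x)‖ ^ 2 = ‖x‖ ^ 2 - ‖h.symbol x‖ ^ 2 := by
  have h1 := norm_sq_bshift (h.symbol x)
  have h2 := h.coeff_symbol x 0
  rw [Nat.cast_zero, pow_zero, one_apply_eq_self] at h2
  rw [h.bshift_symbol, h2] at h1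
  have := h x
  linarith

variable [CompleteSpace X]

theorem RankOneDefect.hasSum_form_resolv (h : RankOneDefect R u) (y x : X) {w : ℂ}
    (hw : ‖w‖ < 1) :
    HasSum (fun n : ℕ => h.form y ((R ^ n) x) * w ^ n) (h.form y (resolv R x w)) := by
  have h1 := hasSum_inner_resolv h.norm_le y x hw
  have h2 := hasSum_inner_resolv norm_bshift_le (h.symbol y) (h.symbol x) hw
  rw [form, h.symbol_resolv x hw]
  refine hasSum_of_eq (fun n => ?_) (h1.sub h2)
  rw [form, h.symbol_pow, sub_mul]

/-- The function `w ↦ ⟨x, (1 + w R) (1 - w R)⁻¹ x⟩`, computed in the form `h.form`. -/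
noncomputable def RankOneDefect.herglotz (h : RankOneDefect R u) (x : X) (w : ℂ) : ℂ :=
  2 * h.form x (resolv R x w) - h.form x x

/-- With F = (1−wR)⁻¹x, expand A(F−x,F−x) in two ways: F − x = wRF, and R preserves the quadratic
form A, so it equals |w|²A(F,F). -/
theorem RankOneDefect.re_herglotz (h : RankOneDefect R u) (x : X) {w : ℂ} (hw : ‖w‖ < 1) :
    (h.herglotz x w).re =
      (1 - ‖w‖ ^ 2) * (‖resolv R x w‖ ^ 2 - ‖h.symbol (resolv R x w)‖ ^ 2) := by
  set F := resolv R x w with hF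
  have h1 : w • R F = F - x := eq_sub_of_add_eq' (resolv_eq h.norm_le x hw).symm
  have h2 := h.form_self_map F
  have h3 : ‖F - x‖ ^ 2 = ‖w‖ ^ 2 * ‖R F‖ ^ 2 := by rw [← h1, norm_smul, mul_pow]
  have h4 : ‖h.symbol F - h.symbol x‖ ^ 2 = ‖w‖ ^ 2 * ‖h.symbol (R F)‖ ^ 2 := by
    rw [← map_sub, ← h1, map_smul, norm_smul, mul_pow]
  have h5 : ‖F - x‖ ^ 2 = ‖F‖ ^ 2 - 2 * (inner ℂ x F).re + ‖x‖ ^ 2 := by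
    rw [@norm_sub_sq ℂ, ← inner_conj_symm, RCLike.conj_re]
    rfl
  have h6 : ‖h.symbol F - h.symbol x‖ ^ 2 = ‖h.symbol F‖ ^ 2 -
      2 * (inner ℂ (h.symbol x) (h.symbol F)).re + ‖h.symbol x‖ ^ 2 := by
    have := @norm_sub_sq ℂ _ _ _ _ (h.symbol F) (h.symbol x)
    rw [inner_H2_symm, RCLike.conj_re] at this
    exact this
  rw [herglotz, h.form_self]
  simp only [form, Complex.sub_re, Complex.mul_re, Complex.re_ofNat, Complex.im_ofNat, zero_mul,
    sub_zero, Complex.ofReal_re]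
  nlinarith

theorem RankOneDefect.re_herglotz_nonneg (h : RankOneDefect R u) (x : X) {w : ℂ}
    (hw : ‖w‖ < 1) : 0 ≤ (h.herglotz x w).re := by
  rw [h.re_herglotz x hw]
  have h1 : ‖w‖ ^ 2 ≤ 1 := pow_le_one₀ (norm_nonneg _) hw.le
  have h2 : ‖h.symbol (resolv R x w)‖ ^ 2 ≤ ‖resolv R x w‖ ^ 2 := by
    gcongr
    exact h.norm_symbol_le _
  exact mul_nonneg (sub_nonneg.mpr h1) (sub_nonneg.mpr h2)

theorem RankOneDefect.re_herglotz_le (h : RankOneDefect R u) (x : X) {w : ℂ}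
    (hw : ‖w‖ < 1) : (h.herglotz x w).re ≤ (1 - ‖w‖ ^ 2) * ‖resolv R x w‖ ^ 2 := by
  rw [h.re_herglotz x hw]
  have h1 : ‖w‖ ^ 2 ≤ 1 := pow_le_one₀ (norm_nonneg _) hw.le
  exact mul_le_mul_of_nonneg_left (sub_le_self _ (by positivity)) (sub_nonneg.mpr h1)

/-! ### The test functions -/

/-- The function `1 / (1 + t G)` where `G` is the Herglotz function of `x`. -/
noncomputable def RankOneDefect.test (h : RankOneDefect R u) (x : X) (t : ℝ) (w : ℂ) : ℂ :=
  (1 + t * h.herglotz x w)⁻¹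

theorem RankOneDefect.one_le_one_add (h : RankOneDefect R u) (x : X) {t : ℝ} (ht : 0 ≤ t) {w : ℂ}
    (hw : ‖w‖ < 1) : 1 ≤ 1 + t * (h.herglotz x w).re :=
  le_add_of_nonneg_right (mul_nonneg ht (h.re_herglotz_nonneg x hw))

theorem RankOneDefect.norm_test_le (h : RankOneDefect R u) (x : X) {t : ℝ} (ht : 0 ≤ t) {w : ℂ}
    (hw : ‖w‖ < 1) : ‖h.test x t w‖ ≤ (1 + t * (h.herglotz x w).re)⁻¹ := by
  rw [test, norm_inv]
  refine inv_anti₀ (zero_lt_one.trans_le (h.one_le_one_add x ht hw)) ?_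
  rw [← re_one_add_ofReal_mul]
  exact Complex.re_le_norm _

theorem RankOneDefect.norm_test_le_one (h : RankOneDefect R u) (x : X) {t : ℝ} (ht : 0 ≤ t)
    {w : ℂ} (hw : ‖w‖ < 1) : ‖h.test x t w‖ ≤ 1 :=
  (h.norm_test_le x ht hw).trans (inv_le_one_of_one_le₀ (h.one_le_one_add x ht hw))

theorem exists_taylor {F : ℂ → ℂ} (hF : DifferentiableOn ℂ F (Metric.ball 0 1)) :
    ∃ a : ℕ → ℂ, ∀ w : ℂ, ‖w‖ < 1 → HasSum (fun n => a n * w ^ n) (F w) := by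
  refine ⟨fun n => (n.factorial : ℂ)⁻¹ * iteratedDeriv n F 0, fun w hw => ?_⟩
  have := Complex.hasSum_taylorSeries_on_ball hF (mem_ball_zero_iff.mpr hw)
  refine hasSum_of_eq (fun n => ?_) this
  rw [sub_zero, smul_eq_mul, smul_eq_mul]
  ring

theorem differentiableOn_of_hasSum {a : ℕ → ℂ} {F : ℂ → ℂ}
    (h : ∀ w : ℂ, ‖w‖ < 1 → HasSum (fun n => a n * w ^ n) (F w)) :
    DifferentiableOn ℂ F (Metric.ball 0 1) := by
  have := (hasFPowerSeriesOnBall_of_hasSum h).differentiableOn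
  rwa [← ENNReal.ofReal_one, Metric.eball_ofReal] at this

theorem RankOneDefect.exists_taylor_test (h : RankOneDefect R u) (x : X) {t : ℝ} (ht : 0 ≤ t) :
    ∃ a : ℕ → ℂ, ∀ w : ℂ, ‖w‖ < 1 → HasSum (fun n => a n * w ^ n) (h.test x t w) := by
  refine exists_taylor ?_
  have h1 := differentiableOn_of_hasSum fun w hw => h.hasSum_form_resolv x x hw
  refine DifferentiableOn.inv (((h1.const_mul 2).sub_const _).const_mul _ |>.const_add _)
    fun w hw => ?_
  intro h0
  have h2 := h.one_le_one_add x ht (mem_ball_zero_iff.mp hw)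
  rw [← re_one_add_ofReal_mul, show (1 + (t : ℂ) * h.herglotz x w) = 0 from h0, Complex.zero_re] at h2
  exact absurd h2 (by norm_num)

theorem RankOneDefect.test_zero (h : RankOneDefect R u) (x : X) (t : ℝ) :
    h.test x t 0 = (((1 + t * (‖x‖ ^ 2 - ‖h.symbol x‖ ^ 2))⁻¹ : ℝ) : ℂ) := by
  have h1 : resolv R x 0 = x := by
    rw [resolv_eq h.norm_le x (by simp), zero_smul, add_zero]
  rw [test, herglotz, h1, h.form_self]
  push_cast
  ring_nf

/-- `∫ conj (P) Q = ∑ conj (pₙ) r²ⁿ A(x, Rⁿ x)` where `Q` is the real part of the Herglotz function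
and `P` the test function. -/
theorem RankOneDefect.hasSum_integral_test (h : RankOneDefect R u) (x : X) {t : ℝ}
    {a : ℕ → ℂ} (ha : ∀ w : ℂ, ‖w‖ < 1 → HasSum (fun n => a n * w ^ n) (h.test x t w))
    {r : ℝ} (hr0 : 0 ≤ r) (hr1 : r < 1) :
    HasSum (fun n : ℕ => (conj (a n * (r : ℂ) ^ n) * (r : ℂ) ^ n) * h.form x ((R ^ n) x))
      (∫ ζ : Circle, conj (h.test x t (r * ζ)) * ((h.herglotz x (r * ζ)).re : ℂ) ∂arc) := by
  have hsa := summable_dilate hr0 hr1 ha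
  have hda := hasSum_dilate hr0 hr1 ha
  have hsf := summable_dilate hr0 hr1 fun w hw => h.hasSum_form_resolv x x hw
  have hdf := hasSum_dilate hr0 hr1 fun w hw => h.hasSum_form_resolv x x hw
  have hca := continuous_of_hasSum hsa hda
  have hcf := continuous_of_hasSum hsf hdf
  have hcc : ∀ {F : Circle → ℂ}, Continuous F → Continuous fun ζ => conj (F ζ) :=
    fun hF => Complex.continuous_conj.comp hF
  have hreal : conj (h.form x x) = h.form x x := by rw [h.form_self, conj_ofReal]
  have e1 := hasSum_integral_conj_mul hsa hsf hda hdf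
  have e2 := integral_mul_eq hsa hsf hda hdf
  have e3 := integral_eq_of_hasSum hsa hda
  simp only [pow_zero, mul_one, one_apply_eq_self] at e2 e3
  -- Re G = A(x,F) + conj(A(x,F) − A(x,x)). Against conj(P), the second part is the conjugate of an
  -- analytic function vanishing at 0, so it integrates to 0.
  have e4 : ∀ ζ : Circle, conj (h.test x t (r * ζ)) * ((h.herglotz x (r * ζ)).re : ℂ) =
      conj (h.test x t (r * ζ)) * h.form x (resolv R x (r * ζ)) +
        conj (h.test x t (r * ζ) * h.form x (resolv R x (r * ζ)) -
          h.test x t (r * ζ) * h.form x x) := fun ζ => by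
    rw [Complex.re_eq_add_conj, herglotz]
    simp only [map_sub, map_mul, hreal, Complex.conj_ofNat]
    ring
  have e5 : ∫ ζ : Circle, conj (h.test x t (r * ζ)) * ((h.herglotz x (r * ζ)).re : ℂ) ∂arc =
      ∫ ζ : Circle, conj (h.test x t (r * ζ)) * h.form x (resolv R x (r * ζ)) ∂arc := by
    simp only [e4]
    rw [integral_add_of_continuous
      (F := fun ζ : Circle => conj (h.test x t (r * ζ)) * h.form x (resolv R x (r * ζ)))
      (G := fun ζ : Circle => conj (h.test x t (r * ζ) * h.form x (resolv R x (r * ζ)) -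
          h.test x t (r * ζ) * h.form x x)) ((hcc hca).mul hcf)
      (hcc ((hca.mul hcf).sub (hca.mul continuous_const))), integral_conj,
      integral_sub_of_continuous
      (F := fun ζ : Circle => h.test x t (r * ζ) * h.form x (resolv R x (r * ζ)))
      (G := fun ζ : Circle => h.test x t (r * ζ) * h.form x x) (hca.mul hcf)
      (hca.mul continuous_const), e2, integral_mul_const, e3, sub_self, map_zero, add_zero]
  rw [e5]
  refine hasSum_of_eq (fun n => ?_) e1
  ring

theorem RankOneDefect.continuous_herglotz (h : RankOneDefect R u) (x : X) {r : ℝ} (hr0 : 0 ≤ r)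
    (hr1 : r < 1) : Continuous fun ζ : Circle => (h.herglotz x (r * ζ)).re := by
  have hsf := summable_dilate hr0 hr1 fun w hw => h.hasSum_form_resolv x x hw
  have hdf := hasSum_dilate hr0 hr1 fun w hw => h.hasSum_form_resolv x x hw
  have hcf := continuous_of_hasSum hsf hdf
  exact Complex.continuous_re.comp ((continuous_const.mul hcf).sub continuous_const)

/-- The averages whose vanishing means that the Herglotz measure of `x` is singular. -/
noncomputable def RankOneDefect.average (h : RankOneDefect R u) (x : X) (t r : ℝ) : ℝ :=
  ∫ ζ : Circle, (h.herglotz x (r * ζ)).re / (1 + t * (h.herglotz x (r * ζ)).re) ∂arc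

/-- A vector `y` close to `x` in the coefficients of its symbol, for small `t`, whose form against
`x` is controlled by the average: `y = ∑ conj (pₙ) r²ⁿ Rⁿ x`, where `pₙ` are the Taylor coefficients
of the test function. -/
theorem RankOneDefect.exists_approx (h : RankOneDefect R u) (x : X) {t : ℝ} (ht : 0 ≤ t)
    {r : ℝ} (hr0 : 0 ≤ r) (hr1 : r < 1) :
    ∃ y : X, ‖y‖ ≤ ‖x‖ ∧ ‖h.form x y‖ ≤ h.average x t r ∧
      ∀ j : ℕ, ‖coeff (h.symbol x : L2) j - coeff (h.symbol y : L2) j‖ ≤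
        Real.sqrt (2 * (1 - (1 + t * (‖x‖ ^ 2 - ‖h.symbol x‖ ^ 2))⁻¹)) * ‖x‖ := by
  obtain ⟨a, ha⟩ := h.exists_taylor_test x ht
  have hsa := summable_dilate hr0 hr1 ha
  have hda := hasSum_dilate hr0 hr1 ha
  have hw := norm_smul_circle_lt hr0 hr1
  have hs : Summable fun n => ‖conj (a n * (r : ℂ) ^ n) * (r : ℂ) ^ n‖ := by
    refine Summable.of_nonneg_of_le (fun n => norm_nonneg _) (fun n => ?_) hsa
    rw [norm_mul, norm_conj, norm_pow, Complex.norm_real, Real.norm_of_nonneg hr0]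
    exact mul_le_of_le_one_right (norm_nonneg _) (pow_le_one₀ hr0 hr1.le)
  have hy := (summable_smul_pow h.norm_le x hs).hasSum
  set y := ∑' n : ℕ, (conj (a n * (r : ℂ) ^ n) * (r : ℂ) ^ n) • (R ^ n) x
  refine ⟨y, ?_, ?_, fun j => ?_⟩
  · exact norm_tsum_smul_pow_le h.norm_le hsa hda
      (fun ζ => h.norm_test_le_one x ht (hw ζ)) hr0 hr1 x
  · have h1 : h.form x y =
        ∫ ζ : Circle, conj (h.test x t (r * ζ)) * ((h.herglotz x (r * ζ)).re : ℂ) ∂arc := by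
      refine HasSum.unique ?_ (h.hasSum_integral_test x ha hr0 hr1)
      have h2 := (innerSL ℂ x).hasSum hy
      have h3 := (innerSL ℂ (h.symbol x)).hasSum (h.symbol.hasSum hy)
      simp only [map_smul, innerSL_apply_apply, smul_eq_mul] at h2 h3
      rw [form]
      refine hasSum_of_eq (fun n => ?_) (h2.sub h3)
      rw [form, mul_sub]
    rw [h1, average]
    have hpos := fun ζ : Circle => h.re_herglotz_nonneg x (hw ζ)
    have hone := fun ζ : Circle => h.one_le_one_add x ht (hw ζ)
    have hc := h.continuous_herglotz x hr0 hr1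
    refine norm_integral_le_of_norm_le ?_ (Filter.Eventually.of_forall fun ζ => ?_)
    · refine Continuous.integrable_of_hasCompactSupport ?_ (HasCompactSupport.of_compactSpace _)
      exact hc.div (continuous_const.add (continuous_const.mul hc))
        fun ζ => (zero_lt_one.trans_le (hone ζ)).ne'
    · rw [norm_mul, norm_conj, Complex.norm_real, Real.norm_of_nonneg (hpos ζ), div_eq_inv_mul]
      exact mul_le_mul_of_nonneg_right (h.norm_test_le x ht (hw ζ)) (hpos ζ)
  · have hr2 : 0 ≤ r * r := mul_nonneg hr0 hr0
    have hr3 : r * r < 1 := by nlinarith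
    obtain ⟨p, hp, hpa⟩ := exists_H2_of_hasSum (summable_dilate hr2 hr3 ha)
      (hasSum_dilate hr2 hr3 ha)
    have ha0 : a 0 = h.test x t 0 := by
      refine HasSum.unique ?_ (ha 0 (by simp))
      convert hasSum_ite_eq (0 : ℕ) (a 0) with n
      rcases eq_or_ne n 0 with rfl | hn <;> simp [*]
    have hp1 : ‖p‖ ^ 2 ≤ 1 := by
      have h1 := integral_norm_sq_of_hasSum (summable_dilate hr2 hr3 ha)
        (hasSum_dilate hr2 hr3 ha)
      have h2 := hasSum_norm_sq p
      simp only [hpa] at h2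
      rw [h2.unique h1]
      have hc := continuous_of_hasSum (summable_dilate hr2 hr3 ha) (hasSum_dilate hr2 hr3 ha)
      have hi : Integrable (fun ζ : Circle => ‖h.test x t ((r * r : ℝ) * ζ)‖ ^ 2) arc :=
        (hc.norm.pow 2).integrable_of_hasCompactSupport (HasCompactSupport.of_compactSpace _)
      refine (integral_mono hi (integrable_const 1) fun ζ => ?_).trans_eq (by simp)
      exact pow_le_one₀ (norm_nonneg _)
        (h.norm_test_le_one x ht (norm_smul_circle_lt hr2 hr3 ζ))
    -- p is the test function P dilated by r². As ‖p‖ ≤ 1 and p(0) = P(0) is real, ‖1 − p‖² = 1 −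
    -- 2P(0) + ‖p‖² ≤ 2(1 − P(0)).
    have hq : ‖hmon 0 - p‖ ^ 2 ≤ 2 * (1 - (1 + t * (‖x‖ ^ 2 - ‖h.symbol x‖ ^ 2))⁻¹) := by
      have h1 := @norm_sub_sq ℂ _ _ _ _ (hmon 0) p
      have h2 : inner ℂ (hmon 0) p = h.test x t 0 := by
        rw [inner_hmon, hpa, pow_zero, mul_one, ha0]
      rw [h.test_zero] at h2
      rw [h2] at h1
      simp only [RCLike.re_to_complex, Complex.ofReal_re] at h1
      rw [h1, orthonormal_hmon.1 0]
      linarith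
    -- The j-th coefficient of Jy is ∑ conj(pₙ)r²ⁿ⟨u,Rⁿ⁺ʲx⟩ = ⟨p, J(Rʲx)⟩, and that of Jx is ⟨1,
    -- J(Rʲx)⟩.
    have e1 : coeff (h.symbol x : L2) j - coeff (h.symbol y : L2) j =
        inner ℂ (hmon 0 - p) (h.symbol ((R ^ j) x)) := by
      have h1 : inner ℂ (hmon 0) (h.symbol ((R ^ j) x)) = coeff (h.symbol x : L2) j := by
        rw [inner_hmon, h.coeff_symbol, h.coeff_symbol, pow_zero, one_apply_eq_self]
      have h2 : inner ℂ p (h.symbol ((R ^ j) x)) = coeff (h.symbol y : L2) j := by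
        rw [h.coeff_symbol]
        have h3 := ((innerSL ℂ u).comp (R ^ j)).hasSum hy
        refine (hasSum_inner p _).unique ?_
        rw [ContinuousLinearMap.comp_apply, innerSL_apply_apply] at h3
        refine hasSum_of_eq (fun n => ?_) h3
        rw [map_smul, ContinuousLinearMap.comp_apply, innerSL_apply_apply, h.coeff_symbol, hpa,
          smul_eq_mul, ← mul_apply_eq_comp, ← mul_apply_eq_comp, ← pow_add, ← pow_add,
          add_comm j n]
        push_cast
        simp only [map_mul, map_pow, conj_ofReal, mul_pow]
        ring
      rw [← h1, ← h2]
      exact (inner_sub_left (𝕜 := ℂ) (hmon 0) p (h.symbol ((R ^ j) x))).symm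
    rw [e1]
    refine (norm_inner_le_norm (𝕜 := ℂ) (hmon 0 - p) (h.symbol ((R ^ j) x))).trans ?_
    refine mul_le_mul (Real.le_sqrt_of_sq_le hq) ?_ (norm_nonneg _) (Real.sqrt_nonneg _)
    exact (h.norm_symbol_le _).trans (norm_pow_apply_le h.norm_le j x)

end Defect

/-! ### Poisson averages -/

/-- The Poisson kernel. -/
noncomputable def poisson (w : ℂ) (ζ : Circle) : ℝ := (1 - ‖w‖ ^ 2) / ‖(ζ : ℂ) - w‖ ^ 2

theorem circle_sub_ne_zero {w : ℂ} (hw : ‖w‖ < 1) (ζ : Circle) : (ζ : ℂ) - w ≠ 0 := by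
  intro h0
  rw [← sub_eq_zero.mp h0, Circle.norm_coe] at hw
  exact lt_irrefl _ hw

theorem poisson_nonneg {w : ℂ} (hw : ‖w‖ < 1) (ζ : Circle) : 0 ≤ poisson w ζ := by
  have : ‖w‖ ^ 2 ≤ 1 := pow_le_one₀ (norm_nonneg _) hw.le
  exact div_nonneg (by linarith) (by positivity)

theorem continuous_poisson {r : ℝ} (hr0 : 0 ≤ r) (hr1 : r < 1) :
    Continuous fun p : Circle × Circle => poisson (r * p.1) p.2 := by
  refine Continuous.div (by fun_prop) (by fun_prop) fun p => ?_
  exact pow_ne_zero _ (norm_ne_zero_iff.mpr (circle_sub_ne_zero (norm_smul_circle_lt hr0 hr1 _) _))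

/-- The average runs over the centre rη with ζ fixed. The kernel is (1−r²) times the squared modulus
of a geometric series, whose mean is 1/(1−r²) by Parseval. -/
theorem integral_poisson {r : ℝ} (hr0 : 0 ≤ r) (hr1 : r < 1) (ζ : Circle) :
    ∫ η : Circle, poisson (r * η) ζ ∂arc = 1 := by
  have hr2 : r ^ 2 < 1 := pow_lt_one₀ hr0 hr1 two_ne_zero
  have hn : ∀ n : ℕ, ‖((ζ : ℂ)⁻¹ * r) ^ n‖ = r ^ n := fun n => by
    rw [norm_pow, norm_mul, norm_inv, Circle.norm_coe, inv_one, one_mul, Complex.norm_real,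
      Real.norm_of_nonneg hr0]
  have hs : Summable fun n : ℕ => ‖((ζ : ℂ)⁻¹ * r) ^ n‖ := by
    simp only [hn]
    exact summable_geometric_of_lt_one hr0 hr1
  have hF : ∀ η : Circle, HasSum (fun n : ℕ => ((ζ : ℂ)⁻¹ * r) ^ n * (η : ℂ) ^ n)
      ((1 - (ζ : ℂ)⁻¹ * r * η)⁻¹) := fun η => by
    have h1 : ‖(ζ : ℂ)⁻¹ * r * η‖ < 1 := by
      rw [norm_mul, norm_mul, norm_inv, Circle.norm_coe, Circle.norm_coe, inv_one, one_mul,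
        mul_one, Complex.norm_real, Real.norm_of_nonneg hr0]
      exact hr1
    simpa only [mul_pow] using hasSum_geometric_of_norm_lt_one h1
  have h1 := integral_norm_sq_of_hasSum hs hF
  simp only [hn, ← pow_mul, mul_comm _ 2] at h1
  simp only [pow_mul] at h1
  have h2 := h1.unique (hasSum_geometric_of_lt_one (sq_nonneg r) hr2)
  have h3 : ∀ η : Circle, poisson (r * η) ζ = (1 - r ^ 2) * ‖(1 - (ζ : ℂ)⁻¹ * r * η)⁻¹‖ ^ 2 :=
    fun η => by
    have h4 : (ζ : ℂ) - r * η = ζ * (1 - (ζ : ℂ)⁻¹ * r * η) := by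
      have := ζ.coe_ne_zero
      field_simp
    rw [poisson, h4, norm_mul, norm_mul, Circle.norm_coe, Circle.norm_coe, one_mul, mul_one,
      Complex.norm_real, Real.norm_of_nonneg hr0, norm_inv, inv_pow, div_eq_mul_inv]
  simp only [h3]
  rw [integral_const_mul, h2]
  exact mul_inv_cancel₀ (by linarith)

theorem integrable_poisson_mul {r : ℝ} (hr0 : 0 ≤ r) (hr1 : r < 1) {g : Circle → ℝ}
    (hg : Integrable g arc) :
    Integrable (fun p : Circle × Circle => poisson (r * p.1) p.2 * g p.2) (arc.prod arc) := by
  have hc := continuous_poisson hr0 hr1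
  obtain ⟨C, hC⟩ := (isCompact_univ.image hc).isBounded.exists_norm_le
  have h1 : Integrable (fun p : Circle × Circle => g p.2) (arc.prod arc) := hg.comp_snd arc
  exact h1.bdd_mul hc.aestronglyMeasurable
    (Filter.Eventually.of_forall fun p => hC _ ⟨p, trivial, rfl⟩)

theorem integrable_integral_poisson_mul {r : ℝ} (hr0 : 0 ≤ r) (hr1 : r < 1) {g : Circle → ℝ}
    (hg : Integrable g arc) :
    Integrable (fun η : Circle => ∫ ζ, poisson (r * η) ζ * g ζ ∂arc) arc :=
  (integrable_poisson_mul hr0 hr1 hg).integral_prod_left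

theorem integral_integral_poisson_mul {r : ℝ} (hr0 : 0 ≤ r) (hr1 : r < 1) {g : Circle → ℝ}
    (hg : Integrable g arc) :
    ∫ η : Circle, ∫ ζ, poisson (r * η) ζ * g ζ ∂arc ∂arc = ∫ ζ, g ζ ∂arc := by
  rw [integral_integral_swap (integrable_poisson_mul hr0 hr1 hg)]
  refine integral_congr_ae (Filter.Eventually.of_forall fun ζ => ?_)
  change ∫ η : Circle, poisson (r * η) ζ * g ζ ∂arc = g ζ
  rw [integral_mul_const, integral_poisson hr0 hr1, one_mul]

theorem integrable_norm_sq (f : L2) : Integrable (fun ζ => ‖f ζ‖ ^ 2) arc :=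
  (memLp_two_iff_integrable_sq_norm (Lp.aestronglyMeasurable f)).mp (Lp.memLp f)

theorem integral_norm_sq (f : H2) : ∫ ζ, ‖(f : L2) ζ‖ ^ 2 ∂arc = ‖f‖ ^ 2 := by
  have h1 : inner ℂ (f : L2) (f : L2) = ((‖f‖ ^ 2 : ℝ) : ℂ) := by
    rw [inner_self_eq_norm_sq_to_K]
    norm_cast
  rw [L2.inner_def] at h1
  have h2 : ∀ ζ, inner ℂ ((f : L2) ζ) ((f : L2) ζ) = ((‖(f : L2) ζ‖ ^ 2 : ℝ) : ℂ) := fun ζ => by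
    rw [inner_self_eq_norm_sq_to_K]
    norm_cast
  simp only [h2] at h1
  exact Complex.ofReal_injective
    ((integral_ofReal (𝕜 := ℂ) (f := fun ζ => ‖(f : L2) ζ‖ ^ 2)).symm.trans h1)

/-- The set where `f` is larger than `B`. -/
def large (f : L2) (B : ℝ) : Set Circle := {ζ | B < ‖f ζ‖}

theorem measurableSet_large (f : L2) (B : ℝ) : MeasurableSet (large f B) :=
  measurableSet_lt measurable_const (Lp.stronglyMeasurable f).norm.measurable

/-- Dominated convergence: the sets |f| > n decrease to the empty set. -/
theorem tendsto_integral_large (f g : L2) :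
    Filter.Tendsto (fun n : ℕ => ∫ ζ, (large f n).indicator (fun ζ => ‖g ζ‖ ^ 2) ζ ∂arc)
      Filter.atTop (nhds 0) := by
  have h0 : ∫ _ : Circle, (0 : ℝ) ∂arc = 0 := integral_zero _ _
  rw [← h0]
  refine tendsto_integral_of_dominated_convergence (fun ζ => ‖g ζ‖ ^ 2) (fun n => ?_)
    (integrable_norm_sq g) (fun n => ?_) ?_
  · exact ((integrable_norm_sq g).indicator (measurableSet_large f n)).aestronglyMeasurable
  · refine Filter.Eventually.of_forall fun ζ => ?_
    refine (norm_indicator_le_norm_self _ _).trans ?_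
    rw [Real.norm_of_nonneg (by positivity)]
  · refine Filter.Eventually.of_forall fun ζ => ?_
    obtain ⟨N, hN⟩ := exists_nat_ge ‖f ζ‖
    refine tendsto_const_nhds.congr' ?_
    filter_upwards [Filter.eventually_ge_atTop N] with n hn
    rw [Set.indicator_of_notMem]
    have : (N : ℝ) ≤ n := by exact_mod_cast hn
    exact not_lt.mpr (hN.trans this)

/-! ### Bounded sequences whose coefficients converge -/

/-- Boundedness together with coefficientwise convergence gives weak convergence, by approximating g
with polynomials. -/
theorem tendsto_inner_of_coeff {d : ℕ → H2} {D : ℝ} (hD : ∀ m, ‖d m‖ ≤ D)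
    (hc : ∀ j : ℕ, Filter.Tendsto (fun m => coeff (d m : L2) j) Filter.atTop (nhds 0)) (g : H2) :
    Filter.Tendsto (fun m => inner ℂ g (d m)) Filter.atTop (nhds 0) := by
  have hD0 : 0 ≤ D := (norm_nonneg _).trans (hD 0)
  rw [Metric.tendsto_nhds]
  intro ε hε
  have h1 := (hasSum_hmon g).tendsto_sum_nat
  have hδ : 0 < ε / (2 * (D + 1)) := by positivity
  obtain ⟨N, hN⟩ := ((Metric.tendsto_nhds.mp h1) _ hδ).exists
  set s := ∑ j ∈ Finset.range N, coeff (g : L2) j • hmon j with hs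
  have h2 : Filter.Tendsto (fun m => inner ℂ s (d m)) Filter.atTop (nhds 0) := by
    have h3 : ∀ m, inner ℂ s (d m) =
        ∑ j ∈ Finset.range N, conj (coeff (g : L2) j) * coeff (d m : L2) j := fun m => by
      refine (sum_inner (𝕜 := ℂ) (Finset.range N) (fun j => coeff (g : L2) j • hmon j) (d m)).trans ?_
      refine Finset.sum_congr rfl fun j _ => ?_
      refine (inner_smul_left (𝕜 := ℂ) (hmon j) (d m) _).trans ?_
      rw [inner_hmon]
    simp only [h3]
    have h4 := tendsto_finsetSum (Finset.range N)
      fun j _ => (hc j).const_mul (conj (coeff (g : L2) j))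
    simpa using h4
  filter_upwards [(Metric.tendsto_nhds.mp h2) (ε / 2) (half_pos hε)] with m hm
  rw [dist_zero_right] at hm ⊢
  have h5 : inner ℂ g (d m) = inner ℂ (g - s) (d m) + inner ℂ s (d m) := by
    have := inner_add_left (𝕜 := ℂ) (g - s) s (d m)
    rwa [sub_add_cancel] at this
  have h6 : ‖inner ℂ (g - s) (d m)‖ ≤ ε / (2 * (D + 1)) * D := by
    refine (norm_inner_le_norm (𝕜 := ℂ) (g - s) (d m)).trans ?_
    refine mul_le_mul ?_ (hD m) (norm_nonneg _) hδ.le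
    rw [← dist_eq_norm, dist_comm]
    exact hN.le
  have h7 : ε / (2 * (D + 1)) * D ≤ ε / 2 := by
    rw [div_mul_eq_mul_div, div_le_div_iff₀ (by positivity) two_pos]
    nlinarith
  rw [h5]
  refine (norm_add_le _ _).trans_lt ?_
  linarith

theorem integral_le_of_ae_le {f k g₁ g₂ : Circle → ℝ} {b c d : ℝ} (hf : Integrable f arc)
    (hk : Integrable k arc) (hg₁ : Integrable g₁ arc) (hg₂ : Integrable g₂ arc)
    (h : ∀ᵐ ζ ∂arc, f ζ ≤ b * k ζ + c * g₁ ζ + d * g₂ ζ) :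
    ∫ ζ, f ζ ∂arc ≤ b * ∫ ζ, k ζ ∂arc + c * ∫ ζ, g₁ ζ ∂arc + d * ∫ ζ, g₂ ζ ∂arc := by
  have h1 := (hk.const_mul b).add (hg₁.const_mul c)
  refine (integral_mono_ae hf (h1.add (hg₂.const_mul d)) h).trans_eq ?_
  rw [integral_add' h1 (hg₂.const_mul d), integral_add' (hk.const_mul b) (hg₁.const_mul c),
    integral_const_mul, integral_const_mul, integral_const_mul]

/-- Used with δ = 1 − r² and s = |ζ − w|, when δ/s² is the Poisson kernel. -/
theorem sq_bound_of_le {δ s c f x v r : ℝ} (hs : 0 < s) (hδ : 0 ≤ δ) (hr1 : r ≤ 1)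
    (hc : 0 ≤ c) (hf : 0 ≤ f) (hv : 0 ≤ v) (h : s * f ≤ x + r * c * v) :
    δ * f ^ 2 ≤ 2 * (δ / s ^ 2 * x ^ 2) + 2 * c ^ 2 * (δ / s ^ 2 * v ^ 2) := by
  have h1 : r * c ≤ c := mul_le_of_le_one_left hc hr1
  have h2 : s * f ≤ x + c * v := h.trans (by gcongr)
  have h3 := pow_le_pow_left₀ (by positivity) h2 2
  have h4 : (s * f) ^ 2 ≤ 2 * x ^ 2 + 2 * c ^ 2 * v ^ 2 := by
    nlinarith [sq_nonneg (x - c * v)]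
  have h5 : f ^ 2 ≤ (2 * x ^ 2 + 2 * c ^ 2 * v ^ 2) / s ^ 2 := by
    rw [le_div_iff₀ (by positivity), mul_comm, ← mul_pow]
    exact h4
  refine (mul_le_mul_of_nonneg_left h5 hδ).trans_eq ?_
  ring

theorem integrable_poisson_mul_right {r : ℝ} (hr0 : 0 ≤ r) (hr1 : r < 1) (η : Circle)
    {g : Circle → ℝ} (hg : Integrable g arc) :
    Integrable (fun ζ => poisson (r * η) ζ * g ζ) arc := by
  have hc : Continuous fun ζ : Circle => poisson (r * η) ζ := by
    refine Continuous.div (by fun_prop) (by fun_prop) fun ζ => ?_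
    exact pow_ne_zero _ (norm_ne_zero_iff.mpr (circle_sub_ne_zero (norm_smul_circle_lt hr0 hr1 _) _))
  obtain ⟨C, hC⟩ := (isCompact_univ.image hc).isBounded.exists_norm_le
  refine hg.bdd_mul (c := C) hc.aestronglyMeasurable (Filter.Eventually.of_forall fun p => ?_)
  exact hC _ (Set.mem_image_of_mem _ trivial)

/-! ### The factorization ιx = ιu · Jx and bounds for the Herglotz function -/

section Model

variable {X : Type*} [NormedAddCommGroup X] [InnerProductSpace ℂ X]
variable {R : X →L[ℂ] X} {u : X} {ι : X →ₗᵢ[ℂ] H2}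

/-- Iterating ιx = ⟨u,x⟩ιu + zι(Rx) gives the Cauchy product of ιu and Jx. -/
theorem RankOneDefect.coeff_model (h : RankOneDefect R u)
    (hι : ∀ x, ι x = inner ℂ u x • ι u + shift (ι (R x))) (n : ℕ) (x : X) :
    coeff (ι x : L2) n =
      ∑ m ∈ Finset.range (n + 1), coeff (h.symbol x : L2) m * coeff (ι u : L2) (n - m : ℕ) := by
  induction n generalizing x with
  | zero =>
    rw [hι x, coeff_H2_add, coeff_H2_smul, Finset.sum_range_one, h.coeff_symbol, pow_zero,
      one_apply_eq_self]
    have := coeff_shift_zero (ι (R x))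
    push_cast
    rw [this, add_zero]
  | succ n ih =>
    rw [hι x, coeff_H2_add, coeff_H2_smul, coeff_shift_succ, ih, Finset.sum_range_succ' _ (n + 1),
      add_comm]
    congr 1
    · refine Finset.sum_congr rfl fun m _ => ?_
      rw [h.coeff_symbol, h.coeff_symbol, pow_succ R, mul_apply_eq_comp, Nat.add_sub_add_right]
    · rw [h.coeff_symbol, pow_zero, one_apply_eq_self, Nat.sub_zero]

theorem RankOneDefect.model_ae (h : RankOneDefect R u)
    (hι : ∀ x, ι x = inner ℂ u x • ι u + shift (ι (R x))) (x : X) :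
    (ι x : L2) =ᵐ[arc] fun ζ => (ι u : L2) ζ * (h.symbol x : L2) ζ := by
  refine ae_eq_of_coeff_eq (integrable_L2 _) (integrable_mul_L2 _ _) fun n => ?_
  rcases lt_or_ge n 0 with hn | hn
  · rw [coeff_mul_neg _ _ hn, (ι x).2 n hn]
  · lift n to ℕ using hn
    rw [coeff_mul_nat, h.coeff_model hι]

theorem RankOneDefect.discFun_model (h : RankOneDefect R u)
    (hι : ∀ x, ι x = inner ℂ u x • ι u + shift (ι (R x))) (x : X) (z : 𝔻) :
    discFun (ι x) z = discFun (ι u) z * discFun (h.symbol x) z :=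
  discFun_mul_of_ae (h.model_ae hι x) z

/-- Solves the recursion for ιF on the circle. Dividing by ζ − w makes Poisson kernels appear in
|ιF|². -/
theorem RankOneDefect.model_resolv_ae [CompleteSpace X] (h : RankOneDefect R u)
    (hι : ∀ x, ι x = inner ℂ u x • ι u + shift (ι (R x))) (x : X) {w : ℂ} (hw : ‖w‖ < 1) :
    ∀ᵐ ζ : Circle ∂arc, ((ζ : ℂ) - w) * (ι (resolv R x w) : L2) ζ =
      ζ * (ι x : L2) ζ - w * inner ℂ u (resolv R x w) * (ι u : L2) ζ := by
  set F := resolv R x w with hF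
  have h1 : w • ι F = (w * inner ℂ u F) • ι u + (shift (ι F) - shift (ι x)) := by
    have h2 : ι F - ι x = w • ι (R F) := by
      rw [← map_sub, ← map_smul]
      congr 1
      rw [sub_eq_iff_eq_add, add_comm]
      exact resolv_eq h.norm_le x hw
    rw [← map_sub, h2, map_smul, ← smul_smul, ← smul_add, ← hι F]
  have h3 : w • (ι F : L2) =
      (w * inner ℂ u F) • (ι u : L2) + ((shift (ι F) : H2) - (shift (ι x) : H2) : L2) :=
    congrArg (fun f : H2 => (f : L2)) h1
  have h4 := Lp.coeFn_smul w (ι F : L2)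
  rw [h3] at h4
  filter_upwards [h4, Lp.coeFn_add ((w * inner ℂ u F) • (ι u : L2))
      ((shift (ι F) : H2) - (shift (ι x) : H2) : L2), Lp.coeFn_smul (w * inner ℂ u F) (ι u : L2),
    Lp.coeFn_sub (shift (ι F) : L2) (shift (ι x) : L2), coeFn_shift (ι F), coeFn_shift (ι x)]
    with ζ e1 e2 e3 e4 e5 e6
  rw [e2, Pi.add_apply, e3, e4, Pi.sub_apply, e5, e6] at e1
  simp only [Pi.smul_apply, smul_eq_mul] at e1
  linear_combination e1

variable [CompleteSpace X]

/-- Start from Re G ≤ (1−r²)‖ιF‖². Where |ιu| ≤ B, ιF = ιu · JF gives |ιF| ≤ B|JF|; elsewhere the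
explicit formula for (ζ−w)ιF gives Poisson integrals over the set |ιu| > B, which is small for large
B. -/
theorem RankOneDefect.re_herglotz_le_of_model (h : RankOneDefect R u)
    (hι : ∀ x, ι x = inner ℂ u x • ι u + shift (ι (R x))) (x : X) (B : ℝ)
    {r : ℝ} (hr0 : 0 ≤ r) (hr1 : r < 1) (η : Circle) :
    (h.herglotz x (r * η)).re ≤
      B ^ 2 * ((1 - r ^ 2) * ‖h.symbol (resolv R x (r * η))‖ ^ 2) +
      2 * ∫ ζ, poisson (r * η) ζ * (large (ι u) B).indicator (fun ζ => ‖(ι x : L2) ζ‖ ^ 2) ζ ∂arc +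
      2 * ‖inner ℂ u (resolv R x (r * η))‖ ^ 2 *
        ∫ ζ, poisson (r * η) ζ * (large (ι u) B).indicator (fun ζ => ‖(ι u : L2) ζ‖ ^ 2) ζ ∂arc := by
  have hw := norm_smul_circle_lt hr0 hr1 η
  have hwr : ‖(r : ℂ) * η‖ = r := by
    rw [norm_mul, Circle.norm_coe, mul_one, Complex.norm_real, Real.norm_of_nonneg hr0]
  set w : ℂ := r * η with hwdef
  set F := resolv R x w with hF
  set c := inner ℂ u F with hc
  set E := large (ι u) B with hE
  have hr2 : 0 < 1 - r ^ 2 := by nlinarith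
  have hi : ∀ f : H2, Integrable
      (fun ζ => poisson w ζ * E.indicator (fun ζ => ‖(f : L2) ζ‖ ^ 2) ζ) arc := fun f => by
    exact integrable_poisson_mul_right hr0 hr1 η
      ((integrable_norm_sq _).indicator (measurableSet_large _ _))
  refine (h.re_herglotz_le x hw).trans ?_
  have key := integral_le_of_ae_le (b := B ^ 2 * (1 - r ^ 2)) (c := 2) (d := 2 * ‖c‖ ^ 2)
    ((integrable_norm_sq (ι F : L2)).const_mul (1 - r ^ 2))
    (integrable_norm_sq (h.symbol F : L2)) (hi (ι x)) (hi (ι u)) ?_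
  · rw [integral_const_mul, integral_norm_sq, integral_norm_sq, ι.norm_map, mul_assoc] at key
    rw [hwr]
    exact key
  filter_upwards [h.model_ae hι F, h.model_resolv_ae hι x hw] with ζ e1 e2
  rw [← hF, ← hc] at e2
  by_cases hζ : ζ ∈ E
  · rw [Set.indicator_of_mem hζ, Set.indicator_of_mem hζ, poisson, hwr]
    have h0 : 0 < ‖(ζ : ℂ) - w‖ := norm_pos_iff.mpr (circle_sub_ne_zero hw ζ)
    have e3 : ‖(ζ : ℂ) - w‖ * ‖(ι F : L2) ζ‖ ≤ ‖(ι x : L2) ζ‖ + r * ‖c‖ * ‖(ι u : L2) ζ‖ := by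
      rw [← norm_mul, e2]
      refine (norm_sub_le _ _).trans_eq ?_
      rw [norm_mul, norm_mul, norm_mul, Circle.norm_coe, one_mul, hwr]
    have e4 := sq_bound_of_le h0 hr2.le hr1.le (norm_nonneg _) (norm_nonneg _) (norm_nonneg _) e3
    have e7 : 0 ≤ B ^ 2 * (1 - r ^ 2) * ‖(h.symbol F : L2) ζ‖ ^ 2 :=
      mul_nonneg (mul_nonneg (sq_nonneg _) hr2.le) (sq_nonneg _)
    rw [add_assoc]
    exact e4.trans (le_add_of_nonneg_left e7)
  · rw [Set.indicator_of_notMem hζ, Set.indicator_of_notMem hζ, mul_zero, mul_zero, mul_zero,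
      add_zero, add_zero, e1, norm_mul, mul_pow]
    have e8 : ‖(ι u : L2) ζ‖ ^ 2 ≤ B ^ 2 := pow_le_pow_left₀ (norm_nonneg _) (not_lt.mp hζ) 2
    have e9 := mul_le_mul_of_nonneg_right e8
      (mul_nonneg hr2.le (sq_nonneg ‖(h.symbol F : L2) ζ‖))
    linarith

/-- `(1 - |w|²) ‖(1 - w B)⁻¹ k‖²` for the backward shift `B`. -/
theorem RankOneDefect.norm_sq_symbol_resolv (h : RankOneDefect R u) (x : X) {w : ℂ}
    (hw : ‖w‖ < 1) :
    (1 - ‖w‖ ^ 2) * ‖h.symbol (resolv R x w)‖ ^ 2 =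
      (2 * (inner ℂ (h.symbol x) (resolv bshift (h.symbol x) w)).re - ‖h.symbol x‖ ^ 2) -
        ‖w‖ ^ 2 * ‖inner ℂ u (resolv R x w)‖ ^ 2 := by
  have h1 := norm_sq_resolv norm_bshift_le (h.symbol x) hw
  rw [← h1, ← h.symbol_resolv x hw]
  have h2 := norm_sq_bshift (h.symbol (resolv R x w))
  have h3 : coeff (h.symbol (resolv R x w) : L2) 0 = inner ℂ u (resolv R x w) := by
    have := h.coeff_symbol (resolv R x w) 0
    rwa [pow_zero, one_apply_eq_self] at this
  rw [h3] at h2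
  have h4 : ‖(w • bshift) (h.symbol (resolv R x w))‖ = ‖w‖ * ‖bshift (h.symbol (resolv R x w))‖ :=
    norm_smul w (bshift (h.symbol (resolv R x w)))
  rw [h4]
  linear_combination -‖w‖ ^ 2 * h2

/-- ⟨u,(1−wR)⁻¹x⟩ is the value of Jx at w, so these are the circular means of |Jx|². -/
theorem RankOneDefect.hasSum_integral_norm_sq (h : RankOneDefect R u) (x : X) {r : ℝ}
    (hr0 : 0 ≤ r) (hr1 : r < 1) :
    HasSum (fun n : ℕ => ‖coeff (h.symbol x : L2) n‖ ^ 2 * r ^ (2 * n))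
      (∫ η : Circle, ‖inner ℂ u (resolv R x (r * η))‖ ^ 2 ∂arc) := by
  have hs := fun w hw => hasSum_inner_resolv h.norm_le u x (w := w) hw
  have h1 := integral_norm_sq_of_hasSum (summable_dilate hr0 hr1 hs) (hasSum_dilate hr0 hr1 hs)
  convert h1 using 2 with n
  rw [h.coeff_symbol, norm_mul, mul_pow, norm_pow, Complex.norm_real, Real.norm_of_nonneg hr0,
    pow_mul']

end Model

/-- The product av need not be integrable with a useful bound. Where a ≤ C it is at most Cv; where a
> C the quotient is at most 1/t ≤ a/(tC), a Chebyshev-type estimate. -/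
theorem div_one_add_le {q t C p a v : ℝ} (hq : 0 ≤ q) (ht : 0 < t) (hC : 0 < C) (hp : 0 ≤ p)
    (ha : 0 ≤ a) (hv : 0 ≤ v) (h : q ≤ p + 2 * a * v) :
    q / (1 + t * q) ≤ p + (t * C)⁻¹ * a + 2 * C * v := by
  have h0 : 0 < 1 + t * q := by positivity
  have h1 : 0 ≤ (t * C)⁻¹ * a := by positivity
  have h2 : 0 ≤ 2 * C * v := by positivity
  rcases le_or_gt a C with hac | hac
  · have h3 : q / (1 + t * q) ≤ q := div_le_self hq (le_add_of_nonneg_right (by positivity))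
    have h4 : 2 * a * v ≤ 2 * C * v := by gcongr
    linarith
  · have h3 : q / (1 + t * q) ≤ (t * C)⁻¹ * C := by
      rw [div_le_iff₀ h0, mul_inv, mul_assoc t⁻¹, inv_mul_cancel₀ hC.ne', mul_one, mul_add, mul_one,
        inv_mul_cancel_left₀ ht.ne']
      exact le_add_of_nonneg_left (by positivity)
    have h4 : (t * C)⁻¹ * C ≤ (t * C)⁻¹ * a := mul_le_mul_of_nonneg_left hac.le (by positivity)
    linarith

theorem integral_le_of_le {f k g₁ g₂ g₃ : Circle → ℝ} {b c d e : ℝ} (hf : Integrable f arc)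
    (hk : Integrable k arc) (hg₁ : Integrable g₁ arc) (hg₂ : Integrable g₂ arc)
    (hg₃ : Integrable g₃ arc) (h : ∀ ζ, f ζ ≤ b * k ζ + c * g₁ ζ + d * g₂ ζ + e * g₃ ζ) :
    ∫ ζ, f ζ ∂arc ≤ b * ∫ ζ, k ζ ∂arc + c * ∫ ζ, g₁ ζ ∂arc + d * ∫ ζ, g₂ ζ ∂arc +
      e * ∫ ζ, g₃ ζ ∂arc := by
  have h1 := integral_le_of_ae_le (f := fun ζ => f ζ - e * g₃ ζ) (hf.sub (hg₃.const_mul e)) hk hg₁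
    hg₂ (Filter.Eventually.of_forall fun ζ => sub_le_iff_le_add.mpr (h ζ))
  rwa [integral_sub hf (hg₃.const_mul e), integral_const_mul, sub_le_iff_le_add] at h1

/-! ### Vanishing of the averages and isometry of the symbol map -/

section Model

variable {X : Type*} [NormedAddCommGroup X] [InnerProductSpace ℂ X] [CompleteSpace X]
variable {R : X →L[ℂ] X} {u : X} {ι : X →ₗᵢ[ℂ] H2}

theorem RankOneDefect.integral_norm_sq_le (h : RankOneDefect R u) (x : X) {r : ℝ}
    (hr0 : 0 ≤ r) (hr1 : r < 1) :
    ∫ η : Circle, ‖inner ℂ u (resolv R x (r * η))‖ ^ 2 ∂arc ≤ ‖h.symbol x‖ ^ 2 := by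
  refine hasSum_le (fun n => ?_) (h.hasSum_integral_norm_sq x hr0 hr1) (hasSum_norm_sq _)
  exact mul_le_of_le_one_right (by positivity) (pow_le_one₀ hr0 hr1.le)

/-- The circular means of |Jx|² tend to ‖Jx‖² as r → 1; a finite partial sum already comes within δ.
-/
theorem RankOneDefect.exists_radius (h : RankOneDefect R u) (x : X) {δ : ℝ} (hδ : 0 < δ) :
    ∃ r : ℝ, 0 ≤ r ∧ r < 1 ∧ ‖h.symbol x‖ ^ 2 -
      r ^ 2 * ∫ η : Circle, ‖inner ℂ u (resolv R x (r * η))‖ ^ 2 ∂arc < δ := by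
  have h1 := (hasSum_norm_sq (h.symbol x)).tendsto_sum_nat
  obtain ⟨N, hN⟩ := (h1.eventually (lt_mem_nhds (sub_lt_self _ hδ))).exists
  have h2 : Continuous fun r : ℝ =>
      r ^ 2 * ∑ n ∈ Finset.range N, ‖coeff (h.symbol x : L2) n‖ ^ 2 * r ^ (2 * n) := by fun_prop
  have h3 : ∀ᶠ r : ℝ in nhdsWithin 1 (Set.Iio 1), ‖h.symbol x‖ ^ 2 - δ <
      r ^ 2 * ∑ n ∈ Finset.range N, ‖coeff (h.symbol x : L2) n‖ ^ 2 * r ^ (2 * n) := by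
    refine (h2.continuousAt.eventually (lt_mem_nhds ?_)).filter_mono nhdsWithin_le_nhds
    simpa using hN
  obtain ⟨r, h4, hr0, hr1⟩ := (h3.and (Ioo_mem_nhdsLT zero_lt_one)).exists
  refine ⟨r, hr0.le, hr1, ?_⟩
  have h5 := sum_le_hasSum (Finset.range N) (fun n _ => by positivity)
    (h.hasSum_integral_norm_sq x hr0.le hr1)
  have h6 := mul_le_mul_of_nonneg_left h5 (sq_nonneg r)
  linarith

/-- The pointwise bounds are integrated over η. Poisson averages disappear by Fubini, and
(1−r²)‖JF‖² integrates to the deficit ‖Jx‖² − r²∫|Jx(rη)|². -/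
theorem RankOneDefect.average_le (h : RankOneDefect R u)
    (hι : ∀ x, ι x = inner ℂ u x • ι u + shift (ι (R x))) (x : X) {t C : ℝ} (ht : 0 < t)
    (hC : 0 < C) (B : ℝ) {r : ℝ} (hr0 : 0 ≤ r) (hr1 : r < 1) :
    h.average x t r ≤
      B ^ 2 * (‖h.symbol x‖ ^ 2 -
        r ^ 2 * ∫ η : Circle, ‖inner ℂ u (resolv R x (r * η))‖ ^ 2 ∂arc) +
      2 * ∫ ζ, (large (ι u) B).indicator (fun ζ => ‖(ι x : L2) ζ‖ ^ 2) ζ ∂arc +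
      (t * C)⁻¹ * ‖h.symbol x‖ ^ 2 +
      2 * C * ∫ ζ, (large (ι u) B).indicator (fun ζ => ‖(ι u : L2) ζ‖ ^ 2) ζ ∂arc := by
  have hw := norm_smul_circle_lt hr0 hr1
  have hwr : ∀ η : Circle, ‖(r : ℂ) * η‖ = r := fun η => by
    rw [norm_mul, Circle.norm_coe, mul_one, Complex.norm_real, Real.norm_of_nonneg hr0]
  have hr2 : 0 ≤ 1 - r ^ 2 := by nlinarith
  have hG : ∀ f : H2, Integrable ((large (ι u) B).indicator (fun ζ => ‖(f : L2) ζ‖ ^ 2)) arc :=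
    fun f => (integrable_norm_sq _).indicator (measurableSet_large _ _)
  have hG0 : ∀ (f : H2) (η : Circle), 0 ≤ ∫ ζ, poisson (r * η) ζ *
      (large (ι u) B).indicator (fun ζ => ‖(f : L2) ζ‖ ^ 2) ζ ∂arc := fun f η =>
    integral_nonneg fun ζ => mul_nonneg (poisson_nonneg (hw η) ζ)
      (Set.indicator_nonneg (fun _ _ => sq_nonneg _) _)
  have hca : Continuous fun η : Circle => ‖inner ℂ u (resolv R x (r * η))‖ ^ 2 :=
    (continuous_inner_resolv h.norm_le u x hr0 hr1).norm.pow 2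
  have hck : Continuous fun η : Circle =>
      2 * (inner ℂ (h.symbol x) (resolv bshift (h.symbol x) (r * η))).re - ‖h.symbol x‖ ^ 2 :=
    ((Complex.continuous_re.comp
      (continuous_inner_resolv norm_bshift_le (h.symbol x) (h.symbol x) hr0 hr1)).const_mul
        2).sub continuous_const
  have hint : ∀ {F : Circle → ℝ}, Continuous F → Integrable F arc := fun hF =>
    hF.integrable_of_hasCompactSupport (HasCompactSupport.of_compactSpace _)
  have hia := hint hca
  have hik := hint hck
  have hiV := integrable_integral_poisson_mul hr0 hr1 (hG (ι x))
  have hiW := integrable_integral_poisson_mul hr0 hr1 (hG (ι u))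
  have hS : ∀ η : Circle, (1 - r ^ 2) * ‖h.symbol (resolv R x (r * η))‖ ^ 2 =
      (2 * (inner ℂ (h.symbol x) (resolv bshift (h.symbol x) (r * η))).re - ‖h.symbol x‖ ^ 2) -
        r ^ 2 * ‖inner ℂ u (resolv R x (r * η))‖ ^ 2 := fun η => by
    have := h.norm_sq_symbol_resolv x (hw η)
    rwa [hwr] at this
  have hiS : Integrable (fun η : Circle =>
      (1 - r ^ 2) * ‖h.symbol (resolv R x (r * η))‖ ^ 2) arc := by
    simp only [hS]
    exact hik.sub (hia.const_mul _)
  have hS2 : ∫ η : Circle, (1 - r ^ 2) * ‖h.symbol (resolv R x (r * η))‖ ^ 2 ∂arc =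
      ‖h.symbol x‖ ^ 2 - r ^ 2 * ∫ η : Circle, ‖inner ℂ u (resolv R x (r * η))‖ ^ 2 ∂arc := by
    simp only [hS]
    rw [integral_sub hik (hia.const_mul _), integral_const_mul,
      integral_re_inner_resolv norm_bshift_le (h.symbol x) hr0 hr1]
  have hcq := h.continuous_herglotz x hr0 hr1
  have hq0 := fun η : Circle => h.re_herglotz_nonneg x (hw η)
  have hle := integral_le_of_le (b := B ^ 2) (c := 2) (d := (t * C)⁻¹) (e := 2 * C)
    (hint (hcq.div (continuous_const.add (continuous_const.mul hcq))
        fun ζ => (zero_lt_one.trans_le (h.one_le_one_add x ht.le (hw ζ))).ne')) hiS hiV hia hiW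
    fun η => by
      refine div_one_add_le (hq0 η) ht hC ?_ (sq_nonneg _) (hG0 _ η)
        (h.re_herglotz_le_of_model hι x B hr0 hr1 η)
      exact add_nonneg (mul_nonneg (sq_nonneg _) (mul_nonneg hr2 (sq_nonneg _)))
        (mul_nonneg zero_le_two (hG0 _ η))
  refine hle.trans ?_
  rw [hS2, integral_integral_poisson_mul hr0 hr1 (hG _),
    integral_integral_poisson_mul hr0 hr1 (hG _)]
  have := mul_le_mul_of_nonneg_left (h.integral_norm_sq_le x hr0 hr1)
    (inv_nonneg.mpr (mul_pos ht hC).le)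
  linarith

theorem RankOneDefect.exists_average_lt (h : RankOneDefect R u)
    (hι : ∀ x, ι x = inner ℂ u x • ι u + shift (ι (R x))) (x : X) {t : ℝ} (ht : 0 < t)
    {ε : ℝ} (hε : 0 < ε) : ∃ r : ℝ, 0 ≤ r ∧ r < 1 ∧ h.average x t r < ε := by
  have hk := sq_nonneg ‖h.symbol x‖
  -- The order of choice matters: C from t and ε, then the truncation level N from C, then r from N,
  -- since N² multiplies the deficit.
  obtain ⟨C, hC, hCε⟩ : ∃ C : ℝ, 0 < C ∧ (t * C)⁻¹ * ‖h.symbol x‖ ^ 2 < ε / 3 := by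
    refine ⟨3 * (‖h.symbol x‖ ^ 2 + 1) / (t * ε), by positivity, ?_⟩
    rw [inv_mul_eq_div, div_lt_iff₀ (by positivity)]
    have : ε / 3 * (t * (3 * (‖h.symbol x‖ ^ 2 + 1) / (t * ε))) = ‖h.symbol x‖ ^ 2 + 1 := by
      field_simp
    linarith
  have h1 := ((tendsto_integral_large (ι u) (ι x)).const_mul 2).add
    ((tendsto_integral_large (ι u) (ι u)).const_mul (2 * C))
  rw [mul_zero, mul_zero, add_zero] at h1
  obtain ⟨N, hN⟩ := (h1.eventually (gt_mem_nhds (show 0 < ε / 3 by positivity))).exists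
  obtain ⟨r, hr0, hr1, hr⟩ := h.exists_radius x
    (show 0 < ε / 3 / ((N : ℝ) ^ 2 + 1) by positivity)
  refine ⟨r, hr0, hr1, (h.average_le hι x ht hC N hr0 hr1).trans_lt ?_⟩
  have h2 : (N : ℝ) ^ 2 * (‖h.symbol x‖ ^ 2 -
      r ^ 2 * ∫ η : Circle, ‖inner ℂ u (resolv R x (r * η))‖ ^ 2 ∂arc) ≤ ε / 3 := by
    refine (mul_le_mul_of_nonneg_left hr.le (sq_nonneg _)).trans ?_
    rw [mul_div_assoc', div_le_iff₀ (by positivity)]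
    nlinarith
  linarith

/-- The isometry at the heart of Hitt's theorem. -/
theorem RankOneDefect.norm_symbol (h : RankOneDefect R u)
    (hι : ∀ x, ι x = inner ℂ u x • ι u + shift (ι (R x))) (x : X) : ‖h.symbol x‖ = ‖x‖ := by
  have hex : ∀ m : ℕ, ∃ y : X, ‖y‖ ≤ ‖x‖ ∧ ‖h.form x y‖ ≤ 1 / ((m : ℝ) + 1) ∧
      ∀ j : ℕ, ‖coeff (h.symbol x : L2) j - coeff (h.symbol y : L2) j‖ ≤
        Real.sqrt (2 * (1 - (1 + 1 / ((m : ℝ) + 1) * (‖x‖ ^ 2 - ‖h.symbol x‖ ^ 2))⁻¹)) *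
          ‖x‖ := fun m => by
    have ht : 0 < 1 / ((m : ℝ) + 1) := by positivity
    obtain ⟨r, hr0, hr1, hr⟩ := h.exists_average_lt hι x ht ht
    obtain ⟨y, h1, h2, h3⟩ := h.exists_approx x ht.le hr0 hr1
    exact ⟨y, h1, h2.trans hr.le, h3⟩
  choose y hy1 hy2 hy3 using hex
  have hlim : Filter.Tendsto (fun m : ℕ => Real.sqrt (2 * (1 - (1 + 1 / ((m : ℝ) + 1) *
      (‖x‖ ^ 2 - ‖h.symbol x‖ ^ 2))⁻¹)) * ‖x‖) Filter.atTop (nhds 0) := by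
    have hc : ContinuousAt (fun t : ℝ => Real.sqrt (2 * (1 - (1 + t *
        (‖x‖ ^ 2 - ‖h.symbol x‖ ^ 2))⁻¹)) * ‖x‖) 0 := by
      have : ContinuousAt (fun t : ℝ => (1 + t * (‖x‖ ^ 2 - ‖h.symbol x‖ ^ 2))⁻¹) 0 :=
        ContinuousAt.inv₀ (by fun_prop) (by simp)
      exact ((continuousAt_const.mul (continuousAt_const.sub this)).sqrt).mul continuousAt_const
    have h2 := hc.tendsto.comp (tendsto_one_div_add_atTop_nhds_zero_nat (𝕜 := ℝ))
    simpa [Function.comp_def] using h2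
  have hJ : ∀ j : ℕ, Filter.Tendsto (fun m => coeff (h.symbol (y m - x) : L2) j) Filter.atTop
      (nhds 0) := fun j => by
    refine squeeze_zero_norm (fun m => ?_) hlim
    rw [map_sub, coeff_H2_sub, norm_sub_rev]
    exact hy3 m j
  -- Each coefficient of ιz is a finite combination of coefficients of Jz, so coefficientwise
  -- convergence passes from J to ι.
  have hI : ∀ j : ℕ, Filter.Tendsto (fun m => coeff (ι (y m - x) : L2) j) Filter.atTop
      (nhds 0) := fun j => by
    have hm := fun m => h.coeff_model hι j (y m - x)
    simp only [hm]
    have := tendsto_finsetSum (Finset.range (j + 1))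
      fun i _ => (hJ i).mul_const (coeff (ι u : L2) (j - i : ℕ))
    simpa using this
  have hb : ∀ m, ‖y m - x‖ ≤ 2 * ‖x‖ := fun m => by
    refine (norm_sub_le _ _).trans ?_
    linarith [hy1 m]
  have h1 := tendsto_inner_of_coeff (fun m => (ι.norm_map _).trans_le (hb m)) hI (ι x)
  have h2 := tendsto_inner_of_coeff (fun m => (h.norm_symbol_le _).trans (hb m)) hJ (h.symbol x)
  -- A(x, yₘ − x) is expressed through ι and J, where weak convergence in H² sends it to 0. Since
  -- also A(x, yₘ) → 0, A(x,x) = 0.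
  have h3 : ∀ m, inner ℂ (ι x) (ι (y m - x)) - inner ℂ (h.symbol x) (h.symbol (y m - x)) =
      h.form x (y m) - h.form x x := fun m => by
    have e1 : inner ℂ (ι x) (ι (y m - x)) = inner ℂ x (y m - x) := ι.inner_map_map x (y m - x)
    have e2 : inner ℂ (h.symbol x) (h.symbol (y m - x)) =
        inner ℂ (h.symbol x) (h.symbol (y m)) - inner ℂ (h.symbol x) (h.symbol x) := by
      rw [map_sub]
      exact inner_sub_right (𝕜 := ℂ) (h.symbol x) (h.symbol (y m)) (h.symbol x)
    rw [e1, e2, inner_sub_right, form, form]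
    ring
  have h4 := h1.sub h2
  simp only [h3, sub_zero] at h4
  have h5 : Filter.Tendsto (fun m => h.form x (y m)) Filter.atTop (nhds 0) :=
    squeeze_zero_norm hy2 tendsto_one_div_add_atTop_nhds_zero_nat
  have h6 := tendsto_nhds_unique h4 (h5.sub tendsto_const_nhds)
  rw [zero_sub, eq_comm, neg_eq_zero, h.form_self, ofReal_eq_zero, sub_eq_zero] at h6
  exact ((sq_eq_sq₀ (norm_nonneg _) (norm_nonneg _)).mp h6).symm

end Model

/-! ### Hitt's theorem for the shift -/

theorem norm_sq_sub_inner_smul {X : Type*} [NormedAddCommGroup X] [InnerProductSpace ℂ X] {u : X}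
    (hu : ‖u‖ = 1) (x : X) :
    ‖x‖ ^ 2 = ‖inner ℂ u x‖ ^ 2 + ‖x - inner ℂ u x • u‖ ^ 2 := by
  have h1 : inner ℂ (inner ℂ u x • u) (x - inner ℂ u x • u) = 0 := by
    rw [inner_smul_left, inner_sub_right, inner_smul_right, inner_self_eq_norm_sq_to_K, hu]
    simp
  have h2 := norm_add_sq_eq_norm_sq_add_norm_sq_of_inner_eq_zero _ _ h1
  rw [add_sub_cancel, norm_smul, hu, mul_one] at h2
  linarith

/-- Hitt's theorem for the range of an isometry: a nonzero closed nearly invariant subspace is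
`u K_θ` for an isometric multiplier `u` of `K_θ`. -/
theorem exists_multiplier_of_isometry {X : Type*} [NormedAddCommGroup X] [InnerProductSpace ℂ X]
    [CompleteSpace X] (ι : X →ₗᵢ[ℂ] H2) (hne : ∃ x, coeff (ι x : L2) 0 ≠ 0)
    (hinv : ∀ f, shift f ∈ LinearMap.range ι.toLinearMap → f ∈ LinearMap.range ι.toLinearMap) :
    ∃ (θ : Linf) (u : H2), (IsInner θ ∨ θ = 0) ∧ IsIsometricMultiplier u (modelSpace θ) ∧
      ∀ g : H2, g ∈ LinearMap.range ι.toLinearMap ↔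
        ∃ f ∈ modelSpace θ, ∀ z, discFun g z = discFun u z * discFun f z := by
  -- The reproducing kernel at 0 of the range, pulled back to X; its normalization u spans the
  -- orthogonal complement of the vectors with (ιx)(0) = 0.
  obtain ⟨κ, hκi⟩ : ∃ κ : X, ∀ x, inner ℂ κ x = coeff (ι x : L2) 0 :=
    ⟨ContinuousLinearMap.adjoint ι.toContinuousLinearMap (hmon 0), fun x =>
      (ContinuousLinearMap.adjoint_inner_left ι.toContinuousLinearMap x (hmon 0)).trans
        (inner_hmon 0 (ι x))⟩
  have hκ0 : κ ≠ 0 := by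
    rintro rfl
    obtain ⟨x, hx⟩ := hne
    rw [← hκi, inner_zero_left] at hx
    exact hx rfl
  have hκn : (‖κ‖ : ℂ) ≠ 0 := ofReal_ne_zero.mpr (norm_ne_zero_iff.mpr hκ0)
  obtain ⟨u, hu⟩ : ∃ u : X, u = (‖κ‖ : ℂ)⁻¹ • κ := ⟨_, rfl⟩
  have hu1 : ‖u‖ = 1 := by
    rw [hu]
    exact norm_smul_inv_norm hκ0
  have hui : ∀ x : X, inner ℂ u x * ‖κ‖ = coeff (ι x : L2) 0 := fun x => by
    rw [hu, inner_smul_left, map_inv₀, conj_ofReal, hκi, mul_comm, mul_inv_cancel_left₀ hκn]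
  have hu0 : coeff (ι u : L2) 0 = ‖κ‖ := by
    rw [← hui, inner_self_eq_norm_sq_to_K, hu1]
    simp
  let S : X →L[ℂ] X := ContinuousLinearMap.id ℂ X - (innerSL ℂ u).smulRight u
  have hS : ∀ x, S x = x - inner ℂ u x • u := fun x => rfl
  have hS0 : ∀ x, shift (bshift (ι (S x))) = ι (S x) := fun x => by
    refine shift_bshift ?_
    rw [hS, map_sub, map_smul, coeff_H2_sub, coeff_H2_smul, hu0, hui, sub_self]
  -- Sx is x without its u-component, so ι(Sx) vanishes at 0; near invariance keeps its quotient by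
  -- z in the range, which makes R well defined.
  have hmem : ∀ x, bshift (ι (S x)) ∈ LinearMap.range ι.toLinearMap := fun x => by
    refine hinv _ ?_
    rw [hS0]
    exact ⟨S x, rfl⟩
  let R : X →L[ℂ] X := (ι.equivRange.symm.toContinuousLinearEquiv : _ →L[ℂ] X) ∘L
    (bshift ∘L ι.toContinuousLinearMap ∘L S).codRestrict (LinearMap.range ι.toLinearMap) hmem
  have hR : ∀ x, ι (R x) = bshift (ι (S x)) := fun x =>
    congrArg Subtype.val (ι.equivRange.apply_symm_apply ⟨bshift (ι (S x)), hmem x⟩)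
  have h : RankOneDefect R u := fun x => by
    rw [← ι.norm_map (R x), hR, ← norm_shift, hS0, ι.norm_map, hS]
    exact norm_sq_sub_inner_smul hu1 x
  have hι : ∀ x, ι x = inner ℂ u x • ι u + shift (ι (R x)) := fun x => by
    rw [hR, hS0, hS, map_sub, map_smul, add_sub_cancel]
  have hiso := h.norm_symbol hι
  -- Isometry of J is used twice: for the closed range that Beurling's theorem needs, and for ‖ιx‖ =
  -- ‖Jx‖, the isometry of multiplication by ιu.
  have hcl : IsClosed ((LinearMap.range (h.symbol : X →ₗ[ℂ] H2) : Submodule ℂ H2) : Set H2) :=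
    (AddMonoidHomClass.isometry_of_norm h.symbol hiso).isClosedEmbedding.isClosed_range
  obtain ⟨θ, hθ, hK⟩ := exists_modelSpace_eq hcl (by
    rintro _ ⟨x, rfl⟩
    exact ⟨R x, (h.bshift_symbol x).symm⟩)
  refine ⟨θ, ι u, hθ, ?_, fun g => ?_⟩
  · rw [hK]
    rintro _ ⟨x, rfl⟩
    exact ⟨ι x, h.discFun_model hι x, (ι.norm_map x).trans (hiso x).symm⟩
  · rw [hK]
    constructor
    · rintro ⟨x, rfl⟩
      exact ⟨h.symbol x, ⟨x, rfl⟩, h.discFun_model hι x⟩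
    · rintro ⟨_, ⟨x, rfl⟩, hz⟩
      exact ⟨x, discFun_injective (funext fun z => (h.discFun_model hι x z).trans (hz z).symm)⟩

theorem exists_isometry_range_eq.{v} {E : Type v} [NormedAddCommGroup E] [InnerProductSpace ℂ E]
    [CompleteSpace E] {N : Submodule ℂ E} (hN : IsClosed (N : Set E)) :
    ∃ (X : Type v) (_ : NormedAddCommGroup X) (_ : InnerProductSpace ℂ X) (_ : CompleteSpace X)
      (ι : X →ₗᵢ[ℂ] E), LinearMap.range ι.toLinearMap = N :=
  ⟨N, inferInstance, inferInstance, hN.completeSpace_coe, N.subtypeₗᵢ, N.range_subtype⟩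

theorem exists_multiplier_modelSpace {N : Submodule ℂ H2} (hN : IsClosed (N : Set H2))
    (hne : N ≠ ⊥) (hinv : ∀ f, shift f ∈ N → f ∈ N) :
    ∃ (θ : Linf) (u : H2), (IsInner θ ∨ θ = 0) ∧ IsIsometricMultiplier u (modelSpace θ) ∧
      ∀ g : H2, g ∈ N ↔ ∃ f ∈ modelSpace θ, ∀ z, discFun g z = discFun u z * discFun f z := by
  obtain ⟨X, _, _, _, ι, rfl⟩ := exists_isometry_range_eq hN
  refine exists_multiplier_of_isometry ι ?_ hinv
  by_contra! h0
  refine hne (eq_bot_of_coeff_zero hinv ?_)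
  rintro _ ⟨x, rfl⟩
  exact h0 x

/-! ### Nearly invariant subspaces for several automorphisms -/

/-- With θ = 1 the zero subspace also acquires the required form, with u = 1. -/
theorem modelSpace_one : modelSpace (contSymbol 1) = ⊥ := by
  rw [eq_bot_iff]
  intro f hf
  have h1 : (f : L2) ∈ H2.map (mulOp (contSymbol 1) : L2 →ₗ[ℂ] L2) := by
    refine ⟨f, f.2, ?_⟩
    have h2 := isAnalytic_one.coe_toeplitz f
    rw [toeplitz_one] at h2
    exact h2.symm
  have h3 : inner ℂ (f : L2) (f : L2) = 0 := hf _ h1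
  exact Subtype.ext (inner_self_eq_zero.mp h3)

theorem isInner_one : IsInner (contSymbol 1) := by
  refine ⟨fun n hn => ?_, ?_⟩
  · rw [coeff_congr (coeFn_contSymbol 1)]
    exact isAnalytic_one n hn
  · filter_upwards [coeFn_contSymbol 1] with ζ hζ
    rw [hζ]
    exact norm_one

/-- Only ψ enters the construction of θ and u; each χ contributes merely a point where u cannot
vanish. -/
theorem exists_hasForm {ι : Type*} (ψ : DiscAut) (χ : ι → DiscAut) {M : Submodule ℂ H2}
    (hM : IsClosed (M : Set H2)) (hψ : ∀ f, toeplitz (contSymbol ψ.boundary) f ∈ M → f ∈ M)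
    (hχ : ∀ i f, toeplitz (contSymbol (χ i).boundary) f ∈ M → f ∈ M) :
    ∃ (θ : Linf) (u : H2), (IsInner θ ∨ θ = 0) ∧ discFun u 0 ≠ 0 ∧
      (∀ i, discFun u (ψ.onDisc (χ i).a) ≠ 0) ∧
      IsIsometricMultiplier u (modelSpace θ) ∧ HasForm ψ θ u M := by
  by_cases hne : M = ⊥
  · have hd : ∀ z, discFun (hmon 0) z ≠ 0 := fun z => by
      rw [discFun_hmon, pow_zero]
      exact one_ne_zero
    have hu : IsIsometricMultiplier (hmon 0) (modelSpace (contSymbol 1)) := by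
      rw [modelSpace_one]
      intro f hf
      rw [Submodule.mem_bot] at hf
      refine ⟨0, fun z => ?_, by rw [hf]⟩
      rw [hf, discFun_zero_left, mul_zero]
    refine ⟨contSymbol 1, hmon 0, Or.inl isInner_one, hd _, fun _ => hd _, hu, ?_⟩
    rw [hasForm_iff hu, modelSpace_one, hne]
    intro m
    constructor
    · intro hm
      rw [Submodule.mem_bot] at hm
      refine ⟨0, Submodule.zero_mem _, fun z => ?_⟩
      rw [hm, map_zero, discFun_zero_left, mul_zero]
    · rintro ⟨f, hf, hz⟩
      rw [Submodule.mem_bot] at hf ⊢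
      have h1 : comp ψ.symm m = 0 := discFun_injective (funext fun z => by
        rw [hz, hf, discFun_zero_left, mul_zero])
      rw [← comp_comp_symm ψ m, h1, map_zero]
  · set N := M.comap (comp ψ : H2 →ₗ[ℂ] H2) with hN
    have hmem : ∀ m, comp ψ.symm m ∈ N ↔ m ∈ M := fun m => by
      change comp ψ (comp ψ.symm m) ∈ M ↔ m ∈ M
      rw [comp_comp_symm]
    have hNne : N ≠ ⊥ := by
      intro h0
      refine hne (eq_bot_iff.mpr fun m hm => ?_)
      rw [← hmem, h0, Submodule.mem_bot] at hm
      rw [Submodule.mem_bot, ← comp_comp_symm ψ m, hm, map_zero]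
    obtain ⟨θ, u, hθ, hu, hNu⟩ := exists_multiplier_modelSpace (hM.preimage (comp ψ).continuous)
      hNne (shift_mem_comap hψ)
    have hform : ∀ m : H2, m ∈ M ↔ ∃ f ∈ modelSpace θ, ∀ z,
        discFun (comp ψ.symm m) z = discFun u z * discFun f z := fun m => by
      rw [← hmem, ← hNu]
    have hval : ∀ χ : DiscAut, (∀ f, toeplitz (contSymbol χ.boundary) f ∈ M → f ∈ M) →
        discFun u (ψ.onDisc χ.a) ≠ 0 := fun χ hχ h0 => by
      obtain ⟨m, hm, hmv⟩ := exists_discFun_ne_zero hne hχ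
      obtain ⟨f, -, hz⟩ := (hform m).mp hm
      refine hmv ?_
      rw [← comp_comp_symm ψ m, discFun_comp, hz, h0, zero_mul]
    refine ⟨θ, u, hθ, ?_, fun i => hval (χ i) (hχ i), hu, (hasForm_iff hu).mpr hform⟩
    -- u(0) ≠ 0 is the nonvanishing condition for ψ itself, as ψ sends its zero to 0.
    rw [← ψ.onDisc_a]
    exact hval ψ hψ

/-! ### From generators to the semigroup, and the theorem -/

theorem mem_of_toeplitz_pow_mem {χ : DiscAut} {M : Submodule ℂ H2}
    (hM : ∀ f, toeplitz (contSymbol χ.boundary) f ∈ M → f ∈ M) (n : ℕ) (f : H2)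
    (hf : toeplitz (contSymbol (χ.boundary ^ n)) f ∈ M) : f ∈ M := by
  induction n with
  | zero => rwa [pow_zero, toeplitz_one] at hf
  | succ n ih =>
    rw [pow_succ', χ.isAnalytic_boundary.toeplitz_mul (χ.isAnalytic_boundary.pow n)] at hf
    exact ih (hM _ hf)

/-- Analyticity of the partial product is carried through the induction because splitting the
Toeplitz operator requires it. -/
theorem mem_of_toeplitz_prod_mem {ι : Type*} {χ : ι → DiscAut} {M : Submodule ℂ H2}
    (hM : ∀ i f, toeplitz (contSymbol (χ i).boundary) f ∈ M → f ∈ M) (m : ι → ℕ) (s : Finset ι) :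
    IsAnalytic (∏ i ∈ s, (χ i).boundary ^ m i) ∧
      ∀ f, toeplitz (contSymbol (∏ i ∈ s, (χ i).boundary ^ m i)) f ∈ M → f ∈ M := by
  classical
  induction s using Finset.induction_on with
  | empty =>
    rw [Finset.prod_empty]
    exact ⟨isAnalytic_one, fun f hf => by rwa [toeplitz_one] at hf⟩
  | insert i s hi ih =>
    have hi' := (χ i).isAnalytic_boundary.pow (m i)
    rw [Finset.prod_insert hi]
    refine ⟨hi'.mul ih.1, fun f hf => ?_⟩
    rw [hi'.toeplitz_mul ih.1] at hf
    exact ih.2 f (mem_of_toeplitz_pow_mem (hM i) _ _ hf)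

end HardyDisc

theorem mainTheorem2 :
    (∀ ψ₁ ψ₂ : DiscAut, ψ₁ ≠ ψ₂ → ψ₁.a ≠ ψ₂.a → ∀ M : Submodule ℂ H2,
      (IsClosed (M : Set H2) ∧
        NearlyInvariant
          (fun p : ℕ × ℕ => toeplitz (contSymbol (ψ₁.boundary ^ p.1 * ψ₂.boundary ^ p.2))) M) ↔
      ∃ (θ : Linf) (u : H2), (IsInner θ ∨ θ = 0) ∧
        discFun u 0 ≠ 0 ∧ discFun u (ψ₁.onDisc ψ₂.a) ≠ 0 ∧
        IsIsometricMultiplier u (modelSpace θ) ∧ HasForm ψ₁ θ u M) ∧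
    (∀ ψ : ℕ → DiscAut, Function.Injective ψ → ∀ M : Submodule ℂ H2,
      (IsClosed (M : Set H2) ∧
        NearlyInvariant
          (fun m : ℕ →₀ ℕ => toeplitz (contSymbol (m.prod fun i k => (ψ i).boundary ^ k))) M) ↔
      ∃ (θ : Linf) (u : H2), (IsInner θ ∨ θ = 0) ∧
        discFun u 0 ≠ 0 ∧ (∀ k : ℕ, discFun u ((ψ 0).onDisc (ψ k).a) ≠ 0) ∧
        IsIsometricMultiplier u (modelSpace θ) ∧ HasForm (ψ 0) θ u M) := by
  refine ⟨fun ψ₁ ψ₂ _ _ M => ⟨?_, ?_⟩, fun ψ _ M => ⟨?_, ?_⟩⟩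
  · rintro ⟨hM, hinv⟩
    have h1 : ∀ f, toeplitz (contSymbol ψ₁.boundary) f ∈ M → f ∈ M := fun f hf => by
      refine hinv (1, 0) f ?_
      simpa only [pow_one, pow_zero, mul_one] using hf
    have h2 : ∀ f, toeplitz (contSymbol ψ₂.boundary) f ∈ M → f ∈ M := fun f hf => by
      refine hinv (0, 1) f ?_
      simpa only [pow_one, pow_zero, one_mul] using hf
    obtain ⟨θ, u, hθ, h0, ha, hu, hform⟩ :=
      exists_hasForm ψ₁ (fun _ : Unit => ψ₂) hM h1 fun _ => h2
    exact ⟨θ, u, hθ, h0, ha (), hu, hform⟩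
  · rintro ⟨θ, u, -, h0, ha, hu, hform⟩
    refine ⟨isClosed_of_hasForm hu hform, fun p f hf => ?_⟩
    have h1 := mem_of_toeplitz_mem_of_hasForm (χ := ψ₁) hu hform (by rwa [ψ₁.onDisc_a])
    have h2 := mem_of_toeplitz_mem_of_hasForm (χ := ψ₂) hu hform ha
    have h3 : toeplitz (contSymbol (ψ₁.boundary ^ p.1 * ψ₂.boundary ^ p.2)) f ∈ M := hf
    rw [(ψ₁.isAnalytic_boundary.pow p.1).toeplitz_mul (ψ₂.isAnalytic_boundary.pow p.2)] at h3
    exact mem_of_toeplitz_pow_mem h2 _ _ (mem_of_toeplitz_pow_mem h1 _ _ h3)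
  · rintro ⟨hM, hinv⟩
    have h1 : ∀ i f, toeplitz (contSymbol (ψ i).boundary) f ∈ M → f ∈ M := fun i f hf => by
      refine hinv (Finsupp.single i 1) f ?_
      have h2 : ((Finsupp.single i 1).prod fun i k => (ψ i).boundary ^ k) = (ψ i).boundary :=
        (Finsupp.prod_single_index (h := fun i k => (ψ i).boundary ^ k) (pow_zero _)).trans
          (pow_one _)
      change toeplitz (contSymbol ((Finsupp.single i 1).prod fun i k => (ψ i).boundary ^ k)) f ∈ M
      rwa [h2]
    -- Indices start at 0, so `ψ 0` plays the role of ψ₁.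
    exact exists_hasForm (ψ 0) ψ hM (h1 0) h1
  · rintro ⟨θ, u, -, -, ha, hu, hform⟩
    refine ⟨isClosed_of_hasForm hu hform, fun m f hf => ?_⟩
    exact (mem_of_toeplitz_prod_mem
      (fun i => mem_of_toeplitz_mem_of_hasForm hu hform (ha i)) m m.support).2 f hf
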